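/- **Theorem 2.4.** Let $B:\mathbb{R}^2\to\mathbb{R}$ satisfy $B\in L^p_{\rm loc}(\mathbb{R}^2)$ for some $p>2$ and $|B(x)|=\mathcal{O}(|x|^{-\tau})$ as $|x|\to\infty$ for some $\tau>2$. Put $$\alpha=\frac1{2\pi}\int_{\mathbb{R}^2}B\,dx,\qquad h(x)=-\frac1{2\pi}\int_{\mathbb{R}^2}B(y)\log|x-y|\,dy,\qquad A_h=(\partial_{x_2}h,\,-\partial_{x_1}h),$$ and, for $\rho>0$, let $g_+(\rho;r)=1$ if $0\le r\le\rho$ and $g_+(\rho;r)=\rho^{-\alpha}r^{\alpha}$ if $r>\rho$, and $$k_+(\rho)=\inf_{x\in\mathbb{R}^2}\frac{e^{-h(x)}}{g_+(\rho;|x|)},\qquad K_+(\rho)=\sup_{x\in\mathbb{R}^2}\frac{e^{-h(x)}}{g_+(\rho;|x|)},\qquad \beta_+(B;\rho)=\Big(\frac{k_+(\rho)}{K_+(\rho)}\Big)^2 .$$ Suppose that $\alpha$ is an integer with $\alpha\ge 0$. Let $A$ be either $A_h$ or any vector field in $L^\infty(\mathbb{R}^2;\mathbb{R}^2)$ such that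 $\partial_{x_1}A_2-\partial_{x_2}A_1=B$ in the sense of distributions. Then for every $\rho>0$ and every $u\in H^1(\mathbb{R}^2)$ (complex-valued) the function $|(i\nabla+A)u|^2+B|u|^2$ is integrable on $\mathbb{R}^2$, and $$Q_+[u]:=\int_{\mathbb{R}^2}\big(|(i\nabla+A)u|^2+B|u|^2\big)\,dx\ \ge\ \beta_+(B;\rho)\,\frac{\alpha}{4\alpha+\pi}\int_{\mathbb{R}^2}\frac{|u|^2}{\rho^2+|x|^2\big(1+\log^2(|x|/\rho)\big)}\,dx .$$ -/

import Mathlib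

open MeasureTheory
open scoped ENNReal ContDiff

noncomputable section

namespace PauliHardy

/-- The Euclidean plane. -/
abbrev Plane : Type := EuclideanSpace ℝ (Fin 2)

/-- The classical partial derivative `∂ f / ∂ x_j` at `x` (the coordinates are numbered `0, 1`). -/
def partialDeriv (j : Fin 2) (f : Plane → ℝ) (x : Plane) : ℝ :=
  fderiv ℝ f x (EuclideanSpace.single j 1)

/-- Test functions: real-valued, smooth, compactly supported. -/
structure IsTest (φ : Plane → ℝ) : Prop where
  smooth : ContDiff ℝ ∞ φ
  compact : HasCompactSupport φ

/-- `u ∈ H¹(ℝ²; ℂ)` with weak gradient `Du = (∂₀ u, ∂₁ u)`. -/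
structure IsH1 (u : Plane → ℂ) (Du : Fin 2 → Plane → ℂ) : Prop where
  memLp : MemLp u 2 volume
  memLp_grad : ∀ j, MemLp (Du j) 2 volume
  weak_grad : ∀ j, ∀ φ : Plane → ℝ, IsTest φ →
    ∫ x, ((partialDeriv j φ x : ℝ) : ℂ) * u x = -∫ x, ((φ x : ℝ) : ℂ) * Du j x

/-- The assumption on the magnetic field: `B ∈ L^p_loc(ℝ²)` for some `p > 2`, and
`|B(x)| = O(|x|^{-τ})` as `|x| → ∞` for some `τ > 2`. -/
structure AdmissibleField (B : Plane → ℝ) : Prop where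
  locally_memLp : ∃ p : ℝ≥0∞, 2 < p ∧ ∀ K : Set Plane, IsCompact K →
    MemLp B p (volume.restrict K)
  decay : ∃ τ : ℝ, 2 < τ ∧ ∃ C R : ℝ, ∀ᵐ x : Plane, R ≤ ‖x‖ → |B x| ≤ C * ‖x‖ ^ (-τ)

/-- The normalized flux `α = (1 / 2π) ∫ B`. -/
def flux (B : Plane → ℝ) : ℝ :=
  1 / (2 * Real.pi) * ∫ x, B x

/-- The scalar potential `h(x) = -(1 / 2π) ∫ B(y) log |x - y| dy`. -/
def scalarPotential (B : Plane → ℝ) (x : Plane) : ℝ :=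
  -(1 / (2 * Real.pi)) * ∫ y, B y * Real.log ‖x - y‖

/-- The vector potential `A_h = (∂₁ h, -∂₀ h)` (coordinates numbered `0, 1`). Here `h` is of
class `C¹` when `B` is admissible, so that the derivatives are classical ones. -/
def vectorPotential (B : Plane → ℝ) (x : Plane) : Plane :=
  !₂[partialDeriv 1 (scalarPotential B) x, -partialDeriv 0 (scalarPotential B) x]

/-- `A ∈ L^∞(ℝ²; ℝ²)` and `∂₀ A₁ - ∂₁ A₀ = B` in the sense of distributions. -/
structure IsBoundedPotential (B : Plane → ℝ) (A : Plane → Plane) : Prop where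
  bounded : MemLp A ∞ volume
  curl_eq : ∀ φ : Plane → ℝ, IsTest φ →
    ∫ x, (A x 0 * partialDeriv 1 φ x - A x 1 * partialDeriv 0 φ x) = ∫ x, B x * φ x

/-- `g₊(ρ; r)`, for flux `α`: it is `1` for `r ≤ ρ` and `ρ^{-α} r^α` for `r > ρ`. -/
def gPlus (α ρ r : ℝ) : ℝ :=
  if r ≤ ρ then 1 else ρ ^ (-α) * r ^ α

/-- `k₊(ρ) = inf_x e^{-h(x)} / g₊(ρ; |x|)`. -/
def kPlus (B : Plane → ℝ) (ρ : ℝ) : ℝ :=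
  ⨅ x : Plane, Real.exp (-scalarPotential B x) / gPlus (flux B) ρ ‖x‖

/-- `K₊(ρ) = sup_x e^{-h(x)} / g₊(ρ; |x|)`. -/
def KPlus (B : Plane → ℝ) (ρ : ℝ) : ℝ :=
  ⨆ x : Plane, Real.exp (-scalarPotential B x) / gPlus (flux B) ρ ‖x‖

/-- `β₊(B; ρ) = (k₊(ρ) / K₊(ρ))²`. -/
def betaPlus (B : Plane → ℝ) (ρ : ℝ) : ℝ :=
  (kPlus B ρ / KPlus B ρ) ^ 2

/-- The density `|(i∇ + A) u|² + B |u|²`, for a function `u` with weak gradient `Du`. -/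
def pauliDensity (B : Plane → ℝ) (A : Plane → Plane) (u : Plane → ℂ) (Du : Fin 2 → Plane → ℂ)
    (x : Plane) : ℝ :=
  (∑ j : Fin 2, ‖Complex.I * Du j x + ((A x j : ℝ) : ℂ) * u x‖ ^ 2) + B x * ‖u x‖ ^ 2

/-- The Pauli form `Q₊[u] = ∫ (|(i∇ + A) u|² + B |u|²) dx`. -/
def QPlus (B : Plane → ℝ) (A : Plane → Plane) (u : Plane → ℂ) (Du : Fin 2 → Plane → ℂ) : ℝ :=
  ∫ x, pauliDensity B A u Du x

end PauliHardy

end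

/-! ### Integrability of admissible fields and uniform bounds on their Riesz potentials -/

namespace PauliHardy
open Set Filter Topology

/-! Write P = i∇ + A and ∂ = ∂₀ - i∂₁. Integrating by parts and using curl A = B gives Q₊[u] = ∫
|(P₀ - iP₁)u|² for smooth compactly supported u (`integral_norm_pauliOp_sq_smooth`). Since A and A_h
have the same curl, A = A_h + ∇φ formally. With F = h - iφ and v = e^F u one has i∂v = e^F (P₀ -
iP₁)u (`norm_dz_exp_mul`), so Q₊[u] = ∫ e^{-2h} |∂v|² while |u| = e^{-h}|v|. Because k₊ g₊ ≤ e^{-h}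
≤ K₊ g₊, the potential may be replaced by its radial model g₊ at the cost of the factor (k₊/K₊)²,
and what remains is the weighted inequality `radial_hardy`.

For that inequality no Fourier expansion in the angle is needed. In polar coordinates r|∂v|² =
r|v_r|² + |v_θ|²/r + 2 Im(v̄_r v_θ), and the last term is a divergence. Subtracting it together with
a radial divergence (s(r)|v|²)_r, with s chosen separately inside and outside the circle of radius
ρ, leaves a nonnegative quantity after completing squares. Outside, one works with w = g₊v. For
integer α the mode v = r^{-α}e^{iαθ} satisfies ∂v = 0 with |w| constant; this resonance is why the
exterior estimate is a logarithmic Hardy inequality. The fluxes through the circle combine to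
(α-1)/4 ∫|v|². Integrality of α serves only to separate α = 0, where the right-hand side vanishes,
from α ≥ 1, where this term is nonnegative.

Low regularity is handled in two ways. The gauge φ is constructed for mollified A and h; as h is
Lipschitz, e^h changes only by a factor close to 1. The passage to H¹ needs B to be form bounded:
-Δh = B weakly, with ∇h bounded, applied to |B| in place of B, gives ∫|B|f ≤ C∫|∇f|, and f = |w|²
yields a bound by the H¹ norm (`exists_integral_abs_mul_norm_sq_le`). -/

theorem AdmissibleField.abs {B : Plane → ℝ} (hB : AdmissibleField B) :
    AdmissibleField (fun x => |B x|) := by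
  obtain ⟨⟨p, hp, hloc⟩, τ, hτ, C, R, hC⟩ := hB
  refine ⟨⟨p, hp, fun K hK => (hloc K hK).norm⟩, τ, hτ, C, R, ?_⟩
  simpa using hC

/-- Above the exponent `2` one may choose a finite one. -/
theorem AdmissibleField.exists_real_exponent {B : Plane → ℝ} (hB : AdmissibleField B) :
    ∃ p : ℝ, 2 < p ∧ ∀ K : Set Plane, IsCompact K →
      MemLp B (ENNReal.ofReal p) (volume.restrict K) := by
  obtain ⟨p, hp, hloc⟩ := hB.locally_memLp
  obtain ⟨q, hq1, hq2⟩ := ENNReal.lt_iff_exists_nnreal_btwn.1 hp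
  refine ⟨q, by exact_mod_cast hq1, fun K hK => ?_⟩
  have : IsFiniteMeasure (volume.restrict K) :=
    ⟨by simpa using hK.measure_lt_top⟩
  simpa using (hloc K hK).mono_exponent (by simpa using hq2.le)

theorem AdmissibleField.locallyIntegrable {B : Plane → ℝ} (hB : AdmissibleField B) :
    LocallyIntegrable B := by
  obtain ⟨p, hp, hloc⟩ := hB.locally_memLp
  refine MeasureTheory.locallyIntegrable_iff.2 fun K hK => ?_
  have : IsFiniteMeasure (volume.restrict K) :=
    ⟨by simpa using hK.measure_lt_top⟩
  exact (hloc K hK).integrable (le_trans (by norm_num) hp.le)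

theorem AdmissibleField.aestronglyMeasurable {B : Plane → ℝ} (hB : AdmissibleField B) :
    AEStronglyMeasurable B :=
  hB.locallyIntegrable.aestronglyMeasurable

theorem AdmissibleField.decay_one_add {B : Plane → ℝ} (hB : AdmissibleField B) :
    ∃ τ : ℝ, 2 < τ ∧ ∃ C R : ℝ, 0 ≤ C ∧
      ∀ᵐ x : Plane, x ∉ Metric.closedBall (0 : Plane) R → |B x| ≤ C * (1 + ‖x‖) ^ (-τ) := by
  obtain ⟨τ, hτ, C, R, hC⟩ := hB.decay
  refine ⟨τ, hτ, max C 0 * 2 ^ τ, max R 1, by positivity, ?_⟩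
  filter_upwards [hC] with x hx hxR
  have hxR' : max R 1 < ‖x‖ := by simpa using hxR
  have h1 : 1 < ‖x‖ := (le_max_right _ _).trans_lt hxR'
  refine (hx ((le_max_left _ _).trans hxR'.le)).trans ?_
  have h2 : ‖x‖ ^ (-τ) ≤ 2 ^ τ * (1 + ‖x‖) ^ (-τ) := by
    have : ((1 + ‖x‖) / 2) ^ τ ≤ ‖x‖ ^ τ :=
      Real.rpow_le_rpow (by positivity) (by linarith) (by linarith)
    rw [Real.div_rpow (by positivity) (by norm_num)] at this
    rw [Real.rpow_neg (by positivity), Real.rpow_neg (by positivity), ← div_eq_mul_inv,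
      inv_le_comm₀ (Real.rpow_pos_of_pos (by linarith) _) (by positivity), inv_div]
    exact this
  calc C * ‖x‖ ^ (-τ) ≤ max C 0 * ‖x‖ ^ (-τ) := by gcongr; exact le_max_left _ _
    _ ≤ max C 0 * (2 ^ τ * (1 + ‖x‖) ^ (-τ)) := by gcongr
    _ = _ := by ring

theorem integrable_of_integrableOn_of_decay {F : Plane → ℝ} {R C σ : ℝ} (hσ : 2 < σ)
    (hm : AEStronglyMeasurable F) (hloc : IntegrableOn F (Metric.closedBall 0 R))
    (hd : ∀ᵐ x : Plane, x ∉ Metric.closedBall (0 : Plane) R → |F x| ≤ C * (1 + ‖x‖) ^ (-σ)) :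
    Integrable F := by
  have h2 : IntegrableOn F (Metric.closedBall 0 R)ᶜ := by
    have hI : Integrable (fun x : Plane => C * (1 + ‖x‖) ^ (-σ)) :=
      (integrable_one_add_norm (by simpa using hσ)).const_mul C
    refine Integrable.mono' hI.integrableOn hm.restrict ?_
    rw [ae_restrict_iff' Metric.isClosed_closedBall.measurableSet.compl]
    exact hd
  have := hloc.union h2
  rwa [union_compl_self, integrableOn_univ] at this

/-- `|B| (1 + |y|)^δ` is integrable for small `δ`. -/
theorem AdmissibleField.exists_integrable_mul_rpow {B : Plane → ℝ} (hB : AdmissibleField B) :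
    ∃ δ : ℝ, 0 < δ ∧ Integrable (fun y => B y * (1 + ‖y‖) ^ δ) := by
  obtain ⟨τ, hτ, C, R, hC, hd⟩ := hB.decay_one_add
  have hcont : Continuous (fun y : Plane => (1 + ‖y‖) ^ ((τ - 2) / 2)) :=
    (continuous_const.add continuous_norm).rpow_const fun x =>
      Or.inl (add_pos_of_pos_of_nonneg one_pos (norm_nonneg x)).ne'
  refine ⟨(τ - 2) / 2, by linarith, integrable_of_integrableOn_of_decay (σ := (τ + 2) / 2)
    (C := C) (R := R) (by linarith) (hB.aestronglyMeasurable.mul hcont.aestronglyMeasurable)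
    ?_ ?_⟩
  · exact (hB.locallyIntegrable.integrableOn_isCompact (isCompact_closedBall _ _)).mul_continuousOn
      hcont.continuousOn (isCompact_closedBall _ _)
  · filter_upwards [hd] with x hx hxR
    rw [abs_mul, abs_of_nonneg (by positivity : (0:ℝ) ≤ (1 + ‖x‖) ^ ((τ - 2) / 2))]
    calc _ ≤ C * (1 + ‖x‖) ^ (-τ) * (1 + ‖x‖) ^ ((τ - 2) / 2) := by
          gcongr; exact hx hxR
      _ = _ := by
          rw [mul_assoc, ← Real.rpow_add (by positivity)]; ring_nf

theorem AdmissibleField.integrable {B : Plane → ℝ} (hB : AdmissibleField B) : Integrable B := by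
  obtain ⟨δ, hδ, hI⟩ := hB.exists_integrable_mul_rpow
  refine hI.mono hB.aestronglyMeasurable (Eventually.of_forall fun x => ?_)
  rw [norm_mul]
  refine le_mul_of_one_le_right (norm_nonneg _) ?_
  rw [Real.norm_of_nonneg (by positivity)]
  exact Real.one_le_rpow (by linarith [norm_nonneg x]) hδ.le

theorem AdmissibleField.exists_integrable_rpow {B : Plane → ℝ} (hB : AdmissibleField B) :
    ∃ p : ℝ, 2 < p ∧ Integrable (fun y => |B y| ^ p) := by
  obtain ⟨p, hp, hloc⟩ := hB.exists_real_exponent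
  obtain ⟨τ, hτ, C, R, hC, hd⟩ := hB.decay_one_add
  refine ⟨p, hp, integrable_of_integrableOn_of_decay (σ := τ * p) (C := C ^ p) (R := R)
    (by nlinarith) ?_ ?_ ?_⟩
  · exact (hB.aestronglyMeasurable.norm.aemeasurable.pow_const p).aestronglyMeasurable
  · have := (hloc _ (isCompact_closedBall (0 : Plane) R)).integrable_norm_rpow (by simp; linarith)
      (by simp)
    rw [ENNReal.toReal_ofReal (by linarith)] at this
    exact this
  · filter_upwards [hd] with x hx hxR
    rw [abs_of_nonneg (by positivity)]
    calc _ ≤ (C * (1 + ‖x‖) ^ (-τ)) ^ p := by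
          gcongr
          exact hx hxR
      _ = _ := by
          rw [Real.mul_rpow hC (by positivity), ← Real.rpow_mul (by positivity)]; ring_nf

theorem integrable_indicator_rpow_norm {q : ℝ} (hq : q < 2) :
    Integrable (fun x : Plane => if ‖x‖ < 1 then ‖x‖ ^ (-q) else 0) := by
  have := (MeasureTheory.integrable_fun_norm_addHaar (volume : Measure Plane)
    (f := fun r : ℝ => if r < 1 then r ^ (-q) else 0)).2 ?_
  · exact this
  have h1 : IntegrableOn (fun r : ℝ => r ^ (1 - q)) (Ioo 0 1) :=
    (intervalIntegral.integrableOn_Ioo_rpow_iff one_pos).2 (by linarith)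
  have h2 : IntegrableOn ((Ioo (0:ℝ) 1).indicator (fun r : ℝ => r ^ (1 - q))) (Ioi 0) :=
    (integrable_indicator_iff measurableSet_Ioo).2 h1 |>.integrableOn
  refine h2.congr_fun (fun r hr => ?_) measurableSet_Ioi
  have hr : 0 < r := hr
  by_cases h : r < 1
  · simp only [indicator_of_mem (show r ∈ Ioo (0:ℝ) 1 from ⟨hr, h⟩), h, if_true, finrank_euclideanSpace_fin,
      smul_eq_mul]
    rw [show (1 - q) = 1 + (-q) by ring, Real.rpow_add hr]; simp
  · rw [indicator_of_notMem (fun hh => h hh.2)]; simp [h]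

/-- The potentials `∫ |B(y)| |x - y|^{-s} dy` are bounded for some `s > 1`. -/
theorem AdmissibleField.exists_riesz_bound {B : Plane → ℝ} (hB : AdmissibleField B) :
    ∃ s : ℝ, 1 < s ∧ s ≤ 2 ∧ ∃ C : ℝ, ∀ x : Plane,
      Integrable (fun y => |B y| * ‖x - y‖ ^ (-s)) ∧ ∫ y, |B y| * ‖x - y‖ ^ (-s) ≤ C := by
  obtain ⟨p, hp, hI⟩ := hB.exists_integrable_rpow
  set q : ℝ := p / (p - 1) with hq
  have hpq : p.HolderConjugate q := Real.HolderConjugate.conjExponent (by linarith)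
  have hq1 : 1 < q := hpq.symm.lt
  have hq2 : q < 2 := by rw [hq, div_lt_iff₀ (by linarith)]; linarith
  -- Since p > 2, the conjugate exponent satisfies q < 2, so 1 < 2/q. The midpoint s exceeds 1,
  -- while sq < 2 keeps the singularity |x|^{-sq} integrable in dimension two.
  set s : ℝ := (1 + 2 / q) / 2 with hs
  have hq3 : 1 < 2 / q := by rw [lt_div_iff₀ (by linarith)]; linarith
  have hq4 : 2 / q < 2 := by rw [div_lt_iff₀ (by linarith)]; linarith
  have hsq : s * q < 2 := by
    have : s < 2 / q := by rw [hs]; linarith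
    rwa [lt_div_iff₀ (by linarith)] at this
  have hK := integrable_indicator_rpow_norm hsq
  set k : Plane → ℝ := fun x : Plane => if ‖x‖ < 1 then ‖x‖ ^ (-(s * q)) else 0 with hk
  -- Young's inequality is used for |x - y| < 1; elsewhere the kernel is at most 1. The integral of
  -- the majorant does not depend on x, by translation invariance.
  have hpt : ∀ x y : Plane, |B y| * ‖x - y‖ ^ (-s) ≤ |B y| + |B y| ^ p + k (x - y) := by
    intro x y
    by_cases h : ‖x - y‖ < 1
    · have h1 := Real.young_inequality_of_nonneg (abs_nonneg (B y))
        (by positivity : 0 ≤ ‖x - y‖ ^ (-s)) hpq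
      have h2 : |B y| ^ p / p ≤ |B y| ^ p := div_le_self (by positivity) (by linarith)
      have h3 : (‖x - y‖ ^ (-s)) ^ q / q ≤ (‖x - y‖ ^ (-s)) ^ q :=
        div_le_self (by positivity) (by linarith)
      rw [← Real.rpow_mul (norm_nonneg _), neg_mul] at h3
      rw [← Real.rpow_mul (norm_nonneg _), neg_mul] at h1
      have : k (x - y) = ‖x - y‖ ^ (-(s * q)) := by simp [hk, h]
      rw [this]
      linarith [abs_nonneg (B y)]
    · have h1 : ‖x - y‖ ^ (-s) ≤ 1 :=
        Real.rpow_le_one_of_one_le_of_nonpos (by linarith) (by linarith)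
      have : k (x - y) = 0 := by simp [hk, h]
      rw [this]
      have : |B y| * ‖x - y‖ ^ (-s) ≤ |B y| * 1 := by gcongr
      have h4 : 0 ≤ |B y| ^ p := by positivity
      linarith
  have hint : ∀ x : Plane, Integrable (fun y => |B y| + |B y| ^ p + k (x - y)) := fun x =>
    (hB.integrable.abs.add hI).add (hK.comp_sub_left x)
  refine ⟨s, by linarith, by linarith, (∫ y, |B y|) + (∫ y, |B y| ^ p) + ∫ y, k y, fun x => ?_⟩
  have hint2 : Integrable (fun y => |B y| * ‖x - y‖ ^ (-s)) := by
    refine (hint x).mono' ?_ (Eventually.of_forall fun y => ?_)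
    · have : Measurable (fun y => ‖x - y‖ ^ (-s)) := by fun_prop
      exact hB.integrable.abs.aestronglyMeasurable.mul this.aestronglyMeasurable
    · rw [Real.norm_of_nonneg (by positivity)]; exact hpt x y
  refine ⟨hint2, (integral_mono hint2 (hint x) (hpt x)).trans_eq ?_⟩
  have e1 : ∫ y, (|B y| + |B y| ^ p + k (x - y))
      = (∫ y, (|B y| + |B y| ^ p)) + ∫ y, k (x - y) :=
    integral_add (hB.integrable.abs.add hI) (hK.comp_sub_left x)
  rw [e1, integral_add hB.integrable.abs hI, integral_sub_left_eq_self k]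

theorem AdmissibleField.exists_newton_bound {B : Plane → ℝ} (hB : AdmissibleField B) :
    ∃ C : ℝ, ∀ x : Plane,
      Integrable (fun y => |B y| * ‖x - y‖⁻¹) ∧ ∫ y, |B y| * ‖x - y‖⁻¹ ≤ C := by
  obtain ⟨s, hs, -, C, hC⟩ := hB.exists_riesz_bound
  refine ⟨(∫ y, |B y|) + C, fun x => ?_⟩
  have hpt : ∀ y : Plane, |B y| * ‖x - y‖⁻¹ ≤ |B y| + |B y| * ‖x - y‖ ^ (-s) := by
    intro y
    rw [← mul_one_add]
    gcongr
    rcases eq_or_ne (‖x - y‖) 0 with h0 | h0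
    · rw [h0]; simp; positivity
    have hpos : 0 < ‖x - y‖ := lt_of_le_of_ne (norm_nonneg _) h0.symm
    rcases le_total 1 ‖x - y‖ with h | h
    · have := inv_le_one_of_one_le₀ h
      have : 0 ≤ ‖x - y‖ ^ (-s) := by positivity
      linarith
    · have : ‖x - y‖ ^ (-1 : ℝ) ≤ ‖x - y‖ ^ (-s) :=
        Real.rpow_le_rpow_of_exponent_ge hpos h (by linarith)
      rw [Real.rpow_neg_one] at this
      linarith
  have hI := hB.integrable.abs.add (hC x).1
  have hint2 : Integrable (fun y => |B y| * ‖x - y‖⁻¹) := by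
    refine hI.mono' ?_ (Eventually.of_forall fun y => ?_)
    · have : Measurable (fun y => ‖x - y‖⁻¹) := by fun_prop
      exact hB.integrable.abs.aestronglyMeasurable.mul this.aestronglyMeasurable
    · rw [Real.norm_of_nonneg (by positivity)]; exact hpt y
  refine ⟨hint2, (integral_mono hint2 hI hpt).trans ?_⟩
  have : ∫ y, ((fun y => |B y|) + fun y => |B y| * ‖x - y‖ ^ (-s)) y = _ :=
    integral_add' hB.integrable.abs (hC x).1
  rw [this]
  linarith [(hC x).2]

/-- The logarithm is controlled from below by 1 - 1/t, hence by the Newton bound near the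
singularity, and from above by t^δ/δ, for which the decay rate τ > 2 leaves room at infinity. -/
theorem AdmissibleField.integrable_mul_log {B : Plane → ℝ} (hB : AdmissibleField B) (x : Plane) :
    Integrable (fun y => B y * Real.log ‖x - y‖) := by
  obtain ⟨δ, hδ, hI⟩ := hB.exists_integrable_mul_rpow
  obtain ⟨C, hC⟩ := hB.exists_newton_bound
  refine (((hC x).1.add (hI.abs.const_mul ((1 + ‖x‖) ^ δ / δ)))).mono' ?_
    (Eventually.of_forall fun y => ?_)
  · have : Measurable (fun y => Real.log ‖x - y‖) := by fun_prop
    exact hB.aestronglyMeasurable.mul this.aestronglyMeasurable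
  have key : |Real.log ‖x - y‖| ≤ ‖x - y‖⁻¹ + (1 + ‖x‖) ^ δ / δ * (1 + ‖y‖) ^ δ := by
    rcases eq_or_ne (‖x - y‖) 0 with h0 | h0
    · rw [h0]; simp; positivity
    have hpos : 0 < ‖x - y‖ := lt_of_le_of_ne (norm_nonneg _) h0.symm
    have hup : Real.log ‖x - y‖ ≤ (1 + ‖x‖) ^ δ / δ * (1 + ‖y‖) ^ δ := by
      refine (Real.log_le_rpow_div hpos.le hδ).trans ?_
      rw [div_mul_eq_mul_div, ← Real.mul_rpow (by positivity) (by positivity)]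
      gcongr
      nlinarith [norm_sub_le x y, norm_nonneg x, norm_nonneg y]
    have hlo := Real.one_sub_inv_le_log_of_pos hpos
    have h3 : 0 ≤ (1 + ‖x‖) ^ δ / δ * (1 + ‖y‖) ^ δ := by positivity
    have h4 : 0 ≤ ‖x - y‖⁻¹ := by positivity
    rw [abs_le]; constructor <;> linarith
  simp only [norm_mul, Real.norm_eq_abs, Pi.add_apply, abs_mul]
  rw [abs_of_nonneg (by positivity : (0:ℝ) ≤ (1 + ‖y‖) ^ δ)]
  calc _ ≤ |B y| * (‖x - y‖⁻¹ + (1 + ‖x‖) ^ δ / δ * (1 + ‖y‖) ^ δ) := by gcongr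
    _ = _ := by ring

end PauliHardy

/-! ### Differentiability of the scalar potential -/

namespace PauliHardy
open Set Filter Topology

/-- Uniform first-order Taylor estimate for `log ‖·‖`. -/
theorem abs_log_norm_add_sub_le {E : Type*} [NormedAddCommGroup E] [InnerProductSpace ℝ E]
    {s : ℝ} (hs1 : 1 < s) (hs2 : s ≤ 2) {z k : E} (hz : z ≠ 0) (hzk : z + k ≠ 0) :
    |Real.log ‖z + k‖ - Real.log ‖z‖ - inner ℝ z k / ‖z‖ ^ 2|
      ≤ 8 * ‖k‖ ^ s * (‖z‖ ^ (-s) + ‖z + k‖ ^ (-s)) := by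
  set a := ‖z‖ with ha
  set b := ‖z + k‖ with hb
  set κ := ‖k‖ with hκ
  have ha0 : 0 < a := norm_pos_iff.2 hz
  have hb0 : 0 < b := norm_pos_iff.2 hzk
  have hκ0 : 0 ≤ κ := norm_nonneg _
  have hab : b ≤ a + κ := norm_add_le _ _
  have hba : a ≤ b + κ := by
    have := norm_sub_le (z + k) k
    simpa using this
  have hin : inner ℝ z k = (b ^ 2 - a ^ 2 - κ ^ 2) / 2 := by
    have := norm_add_sq_real z k
    rw [← ha, ← hb, ← hκ] at this
    linarith
  have hinner : |inner ℝ z k| ≤ a * κ := abs_real_inner_le_norm z k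
  have e1 : κ ^ s * a ^ (-s) = (κ / a) ^ s := by
    rw [Real.div_rpow hκ0 ha0.le, Real.rpow_neg ha0.le, div_eq_mul_inv]
  have e2 : κ ^ s * b ^ (-s) = (κ / b) ^ s := by
    rw [Real.div_rpow hκ0 hb0.le, Real.rpow_neg hb0.le, div_eq_mul_inv]
  rw [mul_assoc, mul_add, e1, e2]
  have hpow : ∀ t : ℝ, 1 / 2 ≤ t → t ≤ 4 * t ^ s := by
    intro t ht
    rcases le_total 1 t with h1 | h1
    · have := Real.rpow_le_rpow_of_exponent_le h1 hs1.le
      rw [Real.rpow_one] at this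
      linarith
    · have := Real.rpow_le_rpow_of_exponent_ge (by linarith : 0 < t) h1 hs2
      rw [Real.rpow_two] at this
      nlinarith
  have p1 : 0 ≤ (κ / a) ^ s := by positivity
  have p2 : 0 ≤ (κ / b) ^ s := by positivity
  have hlogab : Real.log b - Real.log a = Real.log (b / a) := (Real.log_div hb0.ne' ha0.ne').symm
  -- For ‖k‖ ≥ ‖z‖/2 no cancellation is needed: each term is at most linear in ‖k‖/‖z‖ or ‖k‖/‖z +
  -- k‖, and such a ratio, being at least 1/2 where it is used, is absorbed into its s-th power by
  -- `hpow`.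
  rcases le_total (a / 2) κ with hc | hc
  · have hta : 1 / 2 ≤ κ / a := by rw [le_div_iff₀ ha0]; linarith
    have h1 : |inner ℝ z k / a ^ 2| ≤ κ / a := by
      rw [abs_div, abs_of_pos (by positivity : 0 < a ^ 2), div_le_div_iff₀ (by positivity) ha0]
      nlinarith
    have h2 := hpow _ hta
    have h3 : Real.log b - Real.log a ≤ κ / a := by
      rw [hlogab]
      refine (Real.log_le_sub_one_of_pos (by positivity)).trans ?_
      rw [div_sub_one ha0.ne']
      gcongr
      linarith
    have h4 : -(4 * (κ / b) ^ s) ≤ Real.log b - Real.log a := by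
      rcases le_total a b with h | h
      · have := Real.log_le_log ha0 h
        linarith
      · have htb : κ / a ≤ κ / b := by gcongr
        have h5 := hpow _ (hta.trans htb)
        have h6 : Real.log (a / b) ≤ κ / b := by
          refine (Real.log_le_sub_one_of_pos (by positivity)).trans ?_
          rw [div_sub_one hb0.ne']
          gcongr
          linarith
        rw [Real.log_div ha0.ne' hb0.ne'] at h6
        linarith
    rw [abs_le] at h1 ⊢
    constructor <;> linarith [h1.1, h1.2]
  -- For small k the inner product is rewritten through the norms, so the linear term is (x² - 1 -
  -- t²)/2. Both log x and (x² - 1)/2 equal x - 1 up to multiples of (x - 1)² ≤ t², and t² ≤ t^s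
  -- because t ≤ 1 and s ≤ 2.
  · set x := b / a with hx
    set t := κ / a with ht
    have ht0 : 0 ≤ t := by positivity
    have ht2 : t ≤ 1 / 2 := by rw [ht, div_le_iff₀ ha0]; linarith
    have hx1 : x - 1 ≤ t := by
      rw [hx, ht, div_sub_one ha0.ne']; gcongr; linarith
    have hx2 : -t ≤ x - 1 := by
      rw [hx, ht, div_sub_one ha0.ne', ← neg_div]; gcongr; linarith
    have hx0 : 1 / 2 ≤ x := by linarith
    have e3 : inner ℝ z k / a ^ 2 = (x ^ 2 - 1 - t ^ 2) / 2 := by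
      rw [hin, hx, ht]; field_simp
    have l1 : Real.log x ≤ x - 1 := Real.log_le_sub_one_of_pos (by linarith)
    have l2 : 1 - x⁻¹ ≤ Real.log x := Real.one_sub_inv_le_log_of_pos (by linarith)
    have l3 : (x - 1) - 2 * (x - 1) ^ 2 ≤ 1 - x⁻¹ := by
      have hxi : x * x⁻¹ = 1 := mul_inv_cancel₀ (by linarith)
      have : (1 - x⁻¹) - ((x - 1) - 2 * (x - 1) ^ 2) = (x - 1) ^ 2 * (2 * x - 1) * x⁻¹ := by
        linear_combination (-(2 * x ^ 2 - 5 * x + 4)) * hxi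
      have h0 : 0 ≤ (x - 1) ^ 2 * (2 * x - 1) * x⁻¹ :=
        mul_nonneg (mul_nonneg (sq_nonneg _) (by linarith)) (by positivity)
      linarith
    have hsq : (x - 1) ^ 2 ≤ t ^ 2 := by nlinarith
    have hts : t ^ 2 ≤ t ^ s := by
      rcases ht0.eq_or_lt with h | h
      · rw [← h]; simp; positivity
      · have := Real.rpow_le_rpow_of_exponent_ge h (by linarith) hs2
        rwa [Real.rpow_two] at this
    rw [hlogab, e3, abs_le]
    constructor <;> nlinarith [sq_nonneg (x - 1)]

/-- The integrand of the gradient of the Newtonian potential. -/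
noncomputable def newtonKernel (B : Plane → ℝ) (x y : Plane) : Plane →L[ℝ] ℝ :=
  (B y / ‖x - y‖ ^ 2) • innerSL ℝ (x - y)

theorem norm_newtonKernel (B : Plane → ℝ) (x y : Plane) :
    ‖newtonKernel B x y‖ = |B y| * ‖x - y‖⁻¹ := by
  rw [newtonKernel, norm_smul, innerSL_apply_norm, norm_div, Real.norm_eq_abs, norm_pow,
    norm_norm]
  rcases eq_or_ne ‖x - y‖ 0 with h | h
  · simp [h]
  · field_simp

theorem AdmissibleField.integrable_newtonKernel {B : Plane → ℝ} (hB : AdmissibleField B)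
    (x : Plane) : Integrable (newtonKernel B x) := by
  obtain ⟨C, hC⟩ := hB.exists_newton_bound
  refine (hC x).1.mono' ?_ (Eventually.of_forall fun y => (norm_newtonKernel B x y).le)
  have h1 : Measurable (fun y => (‖x - y‖ ^ 2)⁻¹) := by fun_prop
  have h2 : Measurable (fun y => innerSL ℝ (x - y)) := by fun_prop
  exact (hB.aestronglyMeasurable.mul h1.aestronglyMeasurable).smul h2.aestronglyMeasurable

/-- The singularity of the kernel moves with x. The Taylor remainder of the logarithm is therefore
integrated directly: it is O(‖k‖^s), since the Riesz potentials at x and at x + k share one bound,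
and s > 1 makes this o(‖k‖). -/
theorem AdmissibleField.hasFDerivAt_scalarPotential {B : Plane → ℝ} (hB : AdmissibleField B)
    (x : Plane) :
    HasFDerivAt (scalarPotential B) ((-(1 / (2 * Real.pi))) • ∫ y, newtonKernel B x y) x := by
  obtain ⟨s, hs1, hs2, C, hC⟩ := hB.exists_riesz_bound
  have hC0 : 0 ≤ C := le_trans (integral_nonneg fun y => by positivity) (hC x).2
  suffices h : HasFDerivAt (fun x => ∫ y, B y * Real.log ‖x - y‖) (∫ y, newtonKernel B x y) x from
    h.const_mul _
  have key : ∀ k : Plane, ‖(∫ y, B y * Real.log ‖x + k - y‖) - (∫ y, B y * Real.log ‖x - y‖)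
      - (∫ y, newtonKernel B x y) k‖ ≤ (16 * C) * ‖k‖ ^ s := by
    intro k
    have hK : (∫ y, newtonKernel B x y) k = ∫ y, newtonKernel B x y k :=
      (ContinuousLinearMap.integral_apply (hB.integrable_newtonKernel x) k)
    have hKI : Integrable fun y => newtonKernel B x y k :=
      (hB.integrable_newtonKernel x).apply_continuousLinearMap k
    have I1 := hB.integrable_mul_log (x + k)
    have I2 := hB.integrable_mul_log x
    have I12 : Integrable (fun y => B y * Real.log ‖x + k - y‖ - B y * Real.log ‖x - y‖) :=
      I1.sub I2
    rw [hK, ← integral_sub I1 I2, ← integral_sub I12 hKI]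
    have J : Integrable (fun y => 8 * ‖k‖ ^ s * (|B y| * ‖x - y‖ ^ (-s)
        + |B y| * ‖x + k - y‖ ^ (-s))) := ((hC x).1.add (hC (x + k)).1).const_mul _
    calc _ ≤ ∫ y, 8 * ‖k‖ ^ s * (|B y| * ‖x - y‖ ^ (-s) + |B y| * ‖x + k - y‖ ^ (-s)) := by
          refine norm_integral_le_of_norm_le J ?_
          have n1 : ∀ᵐ y : Plane, y ≠ x := by
            simp [ae_iff]
          have n2 : ∀ᵐ y : Plane, y ≠ x + k := by
            simp [ae_iff]
          filter_upwards [n1, n2] with y h1 h2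
          have h3 := abs_log_norm_add_sub_le hs1 hs2 (z := x - y) (k := k)
            (sub_ne_zero.2 h1.symm) (by
              rw [show x - y + k = x + k - y by abel]; exact sub_ne_zero.2 h2.symm)
          rw [show x - y + k = x + k - y by abel] at h3
          have e : B y * Real.log ‖x + k - y‖ - B y * Real.log ‖x - y‖ - newtonKernel B x y k
              = B y * (Real.log ‖x + k - y‖ - Real.log ‖x - y‖
                - inner ℝ (x - y) k / ‖x - y‖ ^ 2) := by
            simp only [newtonKernel, smul_apply, innerSL_apply_apply,
              smul_eq_mul]
            ring
          rw [e, norm_mul, Real.norm_eq_abs, Real.norm_eq_abs]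
          calc _ ≤ |B y| * (8 * ‖k‖ ^ s * (‖x - y‖ ^ (-s) + ‖x + k - y‖ ^ (-s))) := by gcongr
            _ = _ := by ring
      _ = 8 * ‖k‖ ^ s * ((∫ y, |B y| * ‖x - y‖ ^ (-s)) + ∫ y, |B y| * ‖x + k - y‖ ^ (-s)) := by
          rw [integral_const_mul, integral_add (hC x).1 (hC (x + k)).1]
      _ ≤ 8 * ‖k‖ ^ s * (C + C) := by
          gcongr
          · exact (hC x).2
          · exact (hC (x + k)).2
      _ = _ := by ring
  rw [hasFDerivAt_iff_isLittleO_nhds_zero]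
  have h1 : (fun k : Plane => (∫ y, B y * Real.log ‖x + k - y‖) - (∫ y, B y * Real.log ‖x - y‖)
      - (∫ y, newtonKernel B x y) k) =O[𝓝 0] fun k : Plane => ‖k‖ ^ s :=
    Asymptotics.IsBigO.of_bound (16 * C) (Eventually.of_forall fun k => by
      rw [Real.norm_of_nonneg (by positivity : (0:ℝ) ≤ ‖k‖ ^ s)]; exact key k)
  refine h1.trans_isLittleO ?_
  rw [Asymptotics.isLittleO_iff]
  intro c hc
  have ht : Tendsto (fun k : Plane => ‖k‖ ^ (s - 1)) (𝓝 0) (𝓝 0) := by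
    have : ContinuousAt (fun k : Plane => ‖k‖ ^ (s - 1)) 0 :=
      (continuous_norm.rpow_const fun _ => Or.inr (by linarith)).continuousAt
    have h2 := this.tendsto
    simpa [Real.zero_rpow (by linarith : s - 1 ≠ 0)] using h2
  filter_upwards [ht.eventually (gt_mem_nhds hc)] with k hk
  rw [Real.norm_of_nonneg (by positivity : (0:ℝ) ≤ ‖k‖ ^ s)]
  rcases eq_or_ne ‖k‖ 0 with h0 | h0
  · rw [h0, Real.zero_rpow (by linarith)]; simp
  have hpos : 0 < ‖k‖ := lt_of_le_of_ne (norm_nonneg _) h0.symm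
  calc ‖k‖ ^ s = ‖k‖ ^ (s - 1) * ‖k‖ := by
        rw [← Real.rpow_add_one h0]; ring_nf
    _ ≤ c * ‖k‖ := by gcongr

theorem AdmissibleField.fderiv_scalarPotential {B : Plane → ℝ} (hB : AdmissibleField B)
    (x : Plane) :
    fderiv ℝ (scalarPotential B) x = (-(1 / (2 * Real.pi))) • ∫ y, newtonKernel B x y :=
  (hB.hasFDerivAt_scalarPotential x).fderiv

theorem AdmissibleField.differentiable_scalarPotential {B : Plane → ℝ} (hB : AdmissibleField B) :
    Differentiable ℝ (scalarPotential B) := fun x =>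
  (hB.hasFDerivAt_scalarPotential x).differentiableAt

theorem AdmissibleField.exists_norm_fderiv_scalarPotential_le {B : Plane → ℝ}
    (hB : AdmissibleField B) :
    ∃ C : ℝ, 0 ≤ C ∧ ∀ x, ‖fderiv ℝ (scalarPotential B) x‖ ≤ C := by
  obtain ⟨C, hC⟩ := hB.exists_newton_bound
  have hC0 : 0 ≤ C := le_trans (integral_nonneg fun y => by positivity) (hC 0).2
  refine ⟨1 / (2 * Real.pi) * C, by positivity, fun x => ?_⟩
  rw [hB.fderiv_scalarPotential, norm_smul, norm_neg, Real.norm_of_nonneg (by positivity)]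
  gcongr
  refine (norm_integral_le_integral_norm _).trans ?_
  simp_rw [norm_newtonKernel]
  exact (hC x).2

end PauliHardy

/-! ### Polar coordinates and the weak equation -Δh = B -/

namespace PauliHardy
open Set Filter Topology

/-- The point with polar coordinates `(r, θ)`. -/
noncomputable def polarPt (p : ℝ × ℝ) : Plane := !₂[p.1 * Real.cos p.2, p.1 * Real.sin p.2]

theorem polarPt_eq (p : ℝ × ℝ) : polarPt p =
    (p.1 * Real.cos p.2) • EuclideanSpace.single 0 1
      + (p.1 * Real.sin p.2) • EuclideanSpace.single 1 1 := by
  ext i; fin_cases i <;> simp [polarPt]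

theorem contDiff_polarPt {n : WithTop ℕ∞} : ContDiff ℝ n polarPt := by
  have : polarPt = fun p : ℝ × ℝ => (p.1 * Real.cos p.2) • EuclideanSpace.single (0 : Fin 2) (1:ℝ)
      + (p.1 * Real.sin p.2) • EuclideanSpace.single (1 : Fin 2) (1:ℝ) := funext polarPt_eq
  rw [this]
  fun_prop

theorem norm_polarPt (p : ℝ × ℝ) : ‖polarPt p‖ = |p.1| := by
  rw [EuclideanSpace.norm_eq, ← Real.sqrt_sq_eq_abs]
  congr 1
  simp [polarPt, Fin.sum_univ_two]
  nlinarith [Real.sin_sq_add_cos_sq p.2]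

theorem hasFDerivAt_polarPt (p : ℝ × ℝ) :
    HasFDerivAt polarPt (fderiv ℝ polarPt p) p :=
  (contDiff_polarPt.differentiable one_ne_zero p).hasFDerivAt

theorem fderiv_polarPt_radial (p : ℝ × ℝ) : fderiv ℝ polarPt p (1, 0) =
    (Real.cos p.2) • EuclideanSpace.single 0 1 + (Real.sin p.2) • EuclideanSpace.single 1 1 := by
  have h : HasDerivAt (fun t : ℝ => polarPt (p + t • ((1 : ℝ), (0 : ℝ))))
      (fderiv ℝ polarPt p (1, 0)) 0 := by
    have := (hasFDerivAt_polarPt p).hasLineDerivAt (1, 0)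
    exact this
  refine h.unique ?_
  simp only [polarPt_eq, Prod.smul_mk, smul_eq_mul, mul_one, mul_zero, Prod.fst_add, Prod.snd_add,
    add_zero]
  have h1 : HasDerivAt (fun t : ℝ => (p.1 + t)) 1 0 := (hasDerivAt_id 0).const_add _
  have h2 := ((h1.mul_const (Real.cos p.2)).smul_const
    (EuclideanSpace.single (0 : Fin 2) (1:ℝ))).fun_add ((h1.mul_const (Real.sin p.2)).smul_const
    (EuclideanSpace.single (1 : Fin 2) (1:ℝ)))
  simpa using h2

theorem fderiv_polarPt_angular (p : ℝ × ℝ) : fderiv ℝ polarPt p (0, 1) =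
    (-(p.1 * Real.sin p.2)) • EuclideanSpace.single 0 1
      + (p.1 * Real.cos p.2) • EuclideanSpace.single 1 1 := by
  have h : HasDerivAt (fun t : ℝ => polarPt (p + t • ((0 : ℝ), (1 : ℝ))))
      (fderiv ℝ polarPt p (0, 1)) 0 := (hasFDerivAt_polarPt p).hasLineDerivAt (0, 1)
  refine h.unique ?_
  simp only [polarPt_eq, Prod.smul_mk, smul_eq_mul, mul_one, mul_zero, Prod.fst_add, Prod.snd_add,
    add_zero]
  have h1 : HasDerivAt (fun t : ℝ => (p.2 + t)) 1 0 := (hasDerivAt_id 0).const_add _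
  have h2 := ((h1.cos.const_mul p.1).smul_const
    (EuclideanSpace.single (0 : Fin 2) (1:ℝ))).fun_add ((h1.sin.const_mul p.1).smul_const
    (EuclideanSpace.single (1 : Fin 2) (1:ℝ)))
  simpa using h2

theorem polarPt_add_two_pi (r θ : ℝ) : polarPt (r, θ + 2 * Real.pi) = polarPt (r, θ) := by
  simp [polarPt]

theorem integral_eq_integral_polar {E : Type*} [NormedAddCommGroup E] [NormedSpace ℝ E]
    (f : Plane → E) :
    ∫ x, f x = ∫ p in Ioi (0 : ℝ) ×ˢ Ioo (-Real.pi) Real.pi, p.1 • f (polarPt p) := by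
  have e1 : ∫ x, f x = ∫ p : ℝ × ℝ, f (!₂[p.1, p.2]) := by
    have m1 := (PiLp.volume_preserving_toLp (Fin 2))
    have m2 := (volume_preserving_finTwoArrow ℝ).symm
    rw [← m1.integral_comp (MeasurableEquiv.toLp 2 (Fin 2 → ℝ)).measurableEmbedding,
      ← m2.integral_comp (MeasurableEquiv.finTwoArrow (α := ℝ)).symm.measurableEmbedding]
    rfl
  rw [e1, ← integral_comp_polarCoord_symm, polarCoord_target]
  rfl

/-- Integration of a compactly supported function in polar coordinates. -/
theorem integral_eq_intervalIntegral_polar {R : ℝ} (hR : 0 ≤ R) (f : Plane → ℝ) (F : ℝ × ℝ → ℝ)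
    (hF : ContinuousOn F (Icc 0 R ×ˢ Icc (-Real.pi) Real.pi))
    (hfF : ∀ p : ℝ × ℝ, 0 < p.1 → p.1 ≤ R → p.1 * f (polarPt p) = F p)
    (hf : ∀ x, R < ‖x‖ → f x = 0) :
    ∫ x, f x = ∫ r in (0)..R, ∫ θ in (-Real.pi)..Real.pi, F (r, θ) := by
  have hpi : -Real.pi ≤ Real.pi := by linarith [Real.pi_pos]
  rw [integral_eq_integral_polar]
  have e1 : ∫ p in Ioi (0 : ℝ) ×ˢ Ioo (-Real.pi) Real.pi, p.1 • f (polarPt p)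
      = ∫ p in Ioc (0 : ℝ) R ×ˢ Ioo (-Real.pi) Real.pi, p.1 • f (polarPt p) := by
    refine setIntegral_eq_of_subset_of_forall_sdiff_eq_zero
      (measurableSet_Ioi.prod measurableSet_Ioo)
      (Set.prod_mono Ioc_subset_Ioi_self le_rfl) ?_
    rintro p ⟨⟨h1, h2⟩, h3⟩
    have h1 : 0 < p.1 := h1
    have : R < p.1 := by
      by_contra! hle
      exact h3 ⟨⟨h1, hle⟩, h2⟩
    rw [hf, smul_zero]
    rwa [norm_polarPt, abs_of_pos h1]
  have e2 : ∫ p in Ioc (0 : ℝ) R ×ˢ Ioo (-Real.pi) Real.pi, p.1 • f (polarPt p)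
      = ∫ p in Ioc (0 : ℝ) R ×ˢ Ioo (-Real.pi) Real.pi, F p :=
    setIntegral_congr_fun (measurableSet_Ioc.prod measurableSet_Ioo)
      fun p hp => hfF p hp.1.1 hp.1.2
  have hI : IntegrableOn F (Ioc (0 : ℝ) R ×ˢ Ioo (-Real.pi) Real.pi) :=
    (hF.integrableOn_compact (isCompact_Icc.prod isCompact_Icc)).mono_set
      (Set.prod_mono Ioc_subset_Icc_self Ioo_subset_Icc_self)
  rw [e1, e2, Measure.volume_eq_prod, setIntegral_prod _ (by rwa [← Measure.volume_eq_prod]),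
    intervalIntegral.integral_of_le hR]
  refine setIntegral_congr_fun measurableSet_Ioc fun r _ => ?_
  rw [intervalIntegral.integral_of_le hpi, integral_Ioc_eq_integral_Ioo]

theorem IsTest.comp_add_right {φ : Plane → ℝ} (hφ : IsTest φ) (y : Plane) :
    IsTest (fun x => φ (x + y)) :=
  ⟨hφ.smooth.comp (contDiff_id.add contDiff_const),
    hφ.compact.comp_homeomorph (Homeomorph.addRight y)⟩

theorem _root_.HasCompactSupport.exists_norm_lt {E : Type*} [Zero E] {f : Plane → E}
    (hf : HasCompactSupport f) : ∃ R : ℝ, 0 < R ∧ ∀ x, R ≤ ‖x‖ → f x = 0 := by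
  obtain ⟨R, hR⟩ := hf.isCompact.isBounded.subset_closedBall (0 : Plane)
  refine ⟨max R 0 + 1, by positivity, fun x hx => ?_⟩
  by_contra hne
  have h1 := hR (subset_tsupport f hne)
  rw [mem_closedBall_zero_iff] at h1
  linarith [le_max_left R 0]

/-- `log ‖·‖ / 2π` is a fundamental solution of the Laplacian. -/
theorem integral_fderiv_self_div_norm_sq {ψ : Plane → ℝ} (hψ : IsTest ψ) :
    ∫ x, fderiv ℝ ψ x x / ‖x‖ ^ 2 = -(2 * Real.pi * ψ 0) := by
  obtain ⟨R, hR, hsupp⟩ := hψ.compact.exists_norm_lt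
  obtain ⟨R', hR', hsupp'⟩ := (hψ.compact.fderiv (𝕜 := ℝ)).exists_norm_lt
  set S := max R R' with hS
  have hS0 : 0 < S := lt_max_of_lt_left hR
  have hψ1 : ContDiff ℝ 1 ψ := hψ.smooth.of_le (by exact_mod_cast le_top)
  set Ψ : ℝ × ℝ → ℝ := fun p => ψ (polarPt p) with hΨ
  have hΨ1 : ContDiff ℝ 1 Ψ := hψ1.comp contDiff_polarPt
  have hcont : Continuous (fun p => fderiv ℝ Ψ p (1, 0)) :=
    (hΨ1.continuous_fderiv one_ne_zero).clm_apply continuous_const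
  -- The Jacobian cancels the singularity: r (x·∇ψ)/r² = ∂_r ψ, which is continuous up to r = 0. The
  -- integral is then a boundary term; on the side r = 0 the function has the constant value ψ(0).
  rw [integral_eq_intervalIntegral_polar hS0.le _ (fun p => fderiv ℝ Ψ p (1, 0))
    hcont.continuousOn]
  · have := integral2_divergence_prod_of_hasFDerivAt Ψ (fun _ => (0 : ℝ)) (fderiv ℝ Ψ)
      (fun _ => 0) 0 (-Real.pi) S Real.pi hΨ1.continuous.continuousOn continuousOn_const
      (fun x _ => (hΨ1.differentiable one_ne_zero x).hasFDerivAt)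
      (fun x _ => hasFDerivAt_const _ _) ?_
    · simp only [_root_.zero_apply, add_zero] at this
      rw [this]
      have h1 : ∀ θ, Ψ (S, θ) = 0 := fun θ => hsupp _ (by
        rw [norm_polarPt, abs_of_pos hS0]; exact le_max_left _ _)
      have h2 : ∀ θ, Ψ (0, θ) = ψ 0 := fun θ => by
        simp only [hΨ]; congr 1; ext i; fin_cases i <;> simp [polarPt]
      simp only [h1, h2, intervalIntegral.integral_zero, intervalIntegral.integral_const]
      simp only [sub_self, zero_add, zero_sub, smul_eq_mul]
      ring
    · simp only [_root_.zero_apply, add_zero]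
      exact hcont.continuousOn.integrableOn_compact (isCompact_uIcc.prod isCompact_uIcc)
  · intro p hp _
    have : fderiv ℝ Ψ p = (fderiv ℝ ψ (polarPt p)).comp (fderiv ℝ polarPt p) :=
      fderiv_comp p (hψ1.differentiable one_ne_zero _) (hasFDerivAt_polarPt p).differentiableAt
    have e : polarPt p = p.1 • fderiv ℝ polarPt p (1, 0) := by
      rw [fderiv_polarPt_radial, polarPt_eq, smul_add, smul_smul, smul_smul]
    simp only [this, ContinuousLinearMap.comp_apply, norm_polarPt, sq_abs]
    have e2 : (fderiv ℝ ψ (polarPt p)) (polarPt p)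
      = p.1 * (fderiv ℝ ψ (polarPt p)) (fderiv ℝ polarPt p (1, 0)) := by
      conv_lhs => rw [show (fderiv ℝ ψ (polarPt p)) (polarPt p)
        = (fderiv ℝ ψ (polarPt p)) (p.1 • fderiv ℝ polarPt p (1, 0)) from congrArg _ e]
      rw [map_smul, smul_eq_mul]
    rw [e2]
    field_simp
  · intro x hx
    rw [hsupp' x ((le_max_right _ _).trans hx.le)]
    simp

/-- The gradient of a function on the plane. -/
noncomputable def grad (φ : Plane → ℝ) (x : Plane) : Plane := !₂[partialDeriv 0 φ x, partialDeriv 1 φ x]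

theorem plane_eq_sum (v : Plane) :
    v = v 0 • EuclideanSpace.single 0 1 + v 1 • EuclideanSpace.single 1 1 := by
  ext i; fin_cases i <;> simp

theorem clm_apply_plane {E : Type*} [NormedAddCommGroup E] [NormedSpace ℝ E] (L : Plane →L[ℝ] E)
    (v : Plane) : L v = v 0 • L (EuclideanSpace.single 0 1) + v 1 • L (EuclideanSpace.single 1 1) := by
  conv_lhs => rw [plane_eq_sum v]
  simp

theorem fderiv_apply_eq (φ : Plane → ℝ) (x v : Plane) :
    fderiv ℝ φ x v = v 0 * partialDeriv 0 φ x + v 1 * partialDeriv 1 φ x := by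
  rw [clm_apply_plane]; rfl

theorem inner_grad (φ : Plane → ℝ) (x v : Plane) : inner ℝ v (grad φ x) = fderiv ℝ φ x v := by
  rw [fderiv_apply_eq]
  simp [grad, PiLp.inner_apply, Fin.sum_univ_two]
  ring

theorem IsTest.continuous_partialDeriv {φ : Plane → ℝ} (hφ : IsTest φ) (j : Fin 2) :
    Continuous (partialDeriv j φ) :=
  (hφ.smooth.continuous_fderiv (by simp)).clm_apply continuous_const

theorem IsTest.hasCompactSupport_partialDeriv {φ : Plane → ℝ} (hφ : IsTest φ) (j : Fin 2) :
    HasCompactSupport (partialDeriv j φ) :=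
  hφ.compact.fderiv_apply (𝕜 := ℝ) _

theorem IsTest.continuous_grad {φ : Plane → ℝ} (hφ : IsTest φ) : Continuous (grad φ) := by
  have h0 := hφ.continuous_partialDeriv 0
  have h1 := hφ.continuous_partialDeriv 1
  have : grad φ = fun x => partialDeriv 0 φ x • EuclideanSpace.single (0 : Fin 2) (1:ℝ)
      + partialDeriv 1 φ x • EuclideanSpace.single (1 : Fin 2) (1:ℝ) := by
    funext x; ext i; fin_cases i <;> simp [grad]
  rw [this]
  fun_prop

theorem IsTest.hasCompactSupport_grad {φ : Plane → ℝ} (hφ : IsTest φ) :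
    HasCompactSupport (grad φ) := by
  refine (hφ.compact.fderiv (𝕜 := ℝ)).mono' ((Function.support_subset_iff'.2 fun x hx => ?_).trans subset_closure)
  have h : fderiv ℝ φ x = 0 := by simpa using hx
  ext i
  fin_cases i <;> simp [grad, partialDeriv, h]

/-- This is -Δh = B in weak form. The Newton bound and the compact support of ∇φ justify Fubini,
after which the fundamental solution identity is applied at each y. -/
theorem AdmissibleField.integral_fderiv_scalarPotential_grad {B : Plane → ℝ}
    (hB : AdmissibleField B) {φ : Plane → ℝ} (hφ : IsTest φ) :
    ∫ x, fderiv ℝ (scalarPotential B) x (grad φ x) = ∫ x, B x * φ x := by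
  obtain ⟨C, hC⟩ := hB.exists_newton_bound
  have hG := hφ.continuous_grad
  set F : Plane → Plane → ℝ := fun x y => B y * (inner ℝ (x - y) (grad φ x) / ‖x - y‖ ^ 2) with hF
  have hFn : ∀ x y, ‖F x y‖ ≤ ‖grad φ x‖ * (|B y| * ‖x - y‖⁻¹) := by
    intro x y
    simp only [hF, norm_mul, norm_div, Real.norm_eq_abs, norm_pow, abs_norm]
    have := abs_real_inner_le_norm (x - y) (grad φ x)
    calc _ ≤ |B y| * (‖x - y‖ * ‖grad φ x‖ / ‖x - y‖ ^ 2) := by gcongr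
      _ = _ := by
        rcases eq_or_ne ‖x - y‖ 0 with h | h
        · simp [h]
        · field_simp
  have hmeas : AEStronglyMeasurable (Function.uncurry F) (volume.prod volume) := by
    have h1 : AEStronglyMeasurable (fun p : Plane × Plane => B p.2) (volume.prod volume) :=
      hB.aestronglyMeasurable.comp_snd
    have hGm : Measurable (grad φ) := hG.measurable
    have h2 : Measurable (fun p : Plane × Plane =>
        (inner ℝ (p.1 - p.2) (grad φ p.1) / ‖p.1 - p.2‖ ^ 2 : ℝ)) := by fun_prop
    exact h1.mul h2.aestronglyMeasurable
  have hFx : ∀ x, Integrable (F x) := fun x => by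
    refine ((hC x).1.const_mul ‖grad φ x‖).mono' ?_ (Eventually.of_forall (hFn x))
    have h2 : Measurable (fun y : Plane =>
        (inner ℝ (x - y) (grad φ x) / ‖x - y‖ ^ 2 : ℝ)) := by fun_prop
    exact hB.aestronglyMeasurable.mul h2.aestronglyMeasurable
  have hGi : Integrable (grad φ) := hG.integrable_of_hasCompactSupport hφ.hasCompactSupport_grad
  have hint : Integrable (Function.uncurry F) (volume.prod volume) := by
    rw [integrable_prod_iff hmeas]
    refine ⟨Eventually.of_forall fun x => hFx x, ?_⟩
    refine (hGi.norm.mul_const C).mono' hmeas.norm.integral_prod_right'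
      (Eventually.of_forall fun x => ?_)
    rw [Real.norm_of_nonneg (integral_nonneg fun y => norm_nonneg _)]
    calc _ ≤ ∫ y, ‖grad φ x‖ * (|B y| * ‖x - y‖⁻¹) :=
          integral_mono (hFx x).norm ((hC x).1.const_mul _) (hFn x)
      _ ≤ _ := by
          rw [integral_const_mul]
          gcongr
          exact (hC x).2
  have e1 : ∀ x, fderiv ℝ (scalarPotential B) x (grad φ x)
      = -(1 / (2 * Real.pi)) * ∫ y, F x y := by
    intro x
    rw [hB.fderiv_scalarPotential, smul_apply, smul_eq_mul,
      ContinuousLinearMap.integral_apply (hB.integrable_newtonKernel x)]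
    congr 2
    funext y
    simp only [newtonKernel, hF, smul_apply, innerSL_apply_apply, smul_eq_mul]
    ring
  simp_rw [e1]
  rw [integral_const_mul, integral_integral_swap hint, ← integral_const_mul]
  congr 1
  funext y
  simp only [hF]
  rw [integral_const_mul]
  have e2 : ∫ x, inner ℝ (x - y) (grad φ x) / ‖x - y‖ ^ 2 = -(2 * Real.pi * φ y) := by
    have h1 := integral_fderiv_self_div_norm_sq (hφ.comp_add_right y)
    simp only [zero_add] at h1
    rw [← h1, ← integral_add_right_eq_self _ y]
    congr 1
    funext x
    rw [inner_grad, fderiv_comp_add_right, add_sub_cancel_right]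
  rw [e2]
  field_simp

/-- Pairing A_h with the rotated gradient of φ gives ∇h·∇φ, so the curl equation is the weak Poisson
equation. This reduces the choice A = A_h to the bounded case. -/
theorem AdmissibleField.isBoundedPotential {B : Plane → ℝ} (hB : AdmissibleField B) :
    IsBoundedPotential B (vectorPotential B) := by
  obtain ⟨C, hC0, hC⟩ := hB.exists_norm_fderiv_scalarPotential_le
  have hpd : ∀ j x, |partialDeriv j (scalarPotential B) x| ≤ C := fun j x => by
    refine (le_trans ((fderiv ℝ (scalarPotential B) x).le_opNorm _) ?_)
    simpa using hC x
  have hm : ∀ j, Measurable (partialDeriv j (scalarPotential B)) := fun j =>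
    measurable_fderiv_apply_const ℝ _ _
  refine ⟨?_, fun φ hφ => ?_⟩
  · refine memLp_top_of_bound (C := C + C) ?_ (Eventually.of_forall fun x => ?_)
    · have h0 := hm 0
      have h1 := hm 1
      have : Measurable (fun x => ![partialDeriv 1 (scalarPotential B) x,
          -partialDeriv 0 (scalarPotential B) x]) := by
        refine measurable_pi_iff.2 fun i => ?_
        fin_cases i
        · simpa using h1
        · simpa using h0
      exact ((MeasurableEquiv.toLp 2 (Fin 2 → ℝ)).measurable.comp this).aestronglyMeasurable
    · rw [plane_eq_sum (vectorPotential B x)]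
      refine (norm_add_le _ _).trans ?_
      simp only [norm_smul, vectorPotential]
      simpa using add_le_add (hpd 1 x) (hpd 0 x)
  · rw [← hB.integral_fderiv_scalarPotential_grad hφ]
    congr 1
    funext x
    rw [fderiv_apply_eq]
    simp [vectorPotential, grad]
    ring

/-- The bounded gradient of h turns the weak Poisson equation into a first-order estimate. Applied
to |B|, it supplies the form bound on the field. -/
theorem AdmissibleField.exists_integral_mul_le {B : Plane → ℝ} (hB : AdmissibleField B) :
    ∃ C : ℝ, 0 ≤ C ∧ ∀ φ : Plane → ℝ, IsTest φ → ∫ x, B x * φ x ≤ C * ∫ x, ‖grad φ x‖ := by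
  obtain ⟨C, hC0, hC⟩ := hB.exists_norm_fderiv_scalarPotential_le
  refine ⟨C, hC0, fun φ hφ => ?_⟩
  have hGi : Integrable (grad φ) :=
    hφ.continuous_grad.integrable_of_hasCompactSupport hφ.hasCompactSupport_grad
  rw [← hB.integral_fderiv_scalarPotential_grad hφ, ← integral_const_mul]
  refine (Real.le_norm_self _).trans (norm_integral_le_of_norm_le (hGi.norm.const_mul C)
    (Eventually.of_forall fun x => ?_))
  refine ((fderiv ℝ (scalarPotential B) x).le_opNorm _).trans ?_
  gcongr
  exact hC x

end PauliHardy

/-! ### Divergence identities on the strip of polar coordinates -/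

namespace PauliHardy
open Set Filter Topology ComplexConjugate

theorem intervalIntegral_prod_eq_setIntegral {a b c d : ℝ} (hab : a ≤ b) (hcd : c ≤ d)
    {G : ℝ × ℝ → ℝ} (hG : ContinuousOn G (Icc a b ×ˢ Icc c d)) :
    ∫ r in a..b, ∫ θ in c..d, G (r, θ) = ∫ p in Ioc a b ×ˢ Ioc c d, G p := by
  have hI : IntegrableOn G (Ioc a b ×ˢ Ioc c d) :=
    (hG.integrableOn_compact (isCompact_Icc.prod isCompact_Icc)).mono_set
      (Set.prod_mono Ioc_subset_Icc_self Ioc_subset_Icc_self)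
  rw [Measure.volume_eq_prod, setIntegral_prod _ (by rwa [← Measure.volume_eq_prod]),
    intervalIntegral.integral_of_le hab]
  refine setIntegral_congr_fun measurableSet_Ioc fun r _ => ?_
  rw [intervalIntegral.integral_of_le hcd]

theorem intervalIntegral_prod_mono {a b c d : ℝ} (hab : a ≤ b) (hcd : c ≤ d)
    {G₁ G₂ : ℝ × ℝ → ℝ} (h₁ : ContinuousOn G₁ (Icc a b ×ˢ Icc c d))
    (h₂ : ContinuousOn G₂ (Icc a b ×ˢ Icc c d))
    (h : ∀ p : ℝ × ℝ, a < p.1 → p.1 ≤ b → G₁ p ≤ G₂ p) :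
    ∫ r in a..b, ∫ θ in c..d, G₁ (r, θ) ≤ ∫ r in a..b, ∫ θ in c..d, G₂ (r, θ) := by
  rw [intervalIntegral_prod_eq_setIntegral hab hcd h₁,
    intervalIntegral_prod_eq_setIntegral hab hcd h₂]
  have hs : Ioc a b ×ˢ Ioc c d ⊆ Icc a b ×ˢ Icc c d :=
    Set.prod_mono Ioc_subset_Icc_self Ioc_subset_Icc_self
  exact setIntegral_mono_on
    ((h₁.integrableOn_compact (isCompact_Icc.prod isCompact_Icc)).mono_set hs)
    ((h₂.integrableOn_compact (isCompact_Icc.prod isCompact_Icc)).mono_set hs)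
    (measurableSet_Ioc.prod measurableSet_Ioc) fun p hp => h p hp.1.1 hp.1.2

/-- The density `Im (w̄ ∂₂w) + s |w|²` whose flux through circles is controlled by
`stripDensity`. -/
noncomputable def stripFlux (w : ℝ × ℝ → ℂ) (s : ℝ → ℝ) (p : ℝ × ℝ) : ℝ :=
  (conj (w p) * fderiv ℝ w p (0, 1)).im + s p.1 * ‖w p‖ ^ 2

/-- This is the (r, θ)-divergence of the field with components `stripFlux w s` and -Im(w̄ ∂_r w):
the mixed second derivatives cancel by symmetry, and the two products of first derivatives add up,
whence the factor 2. -/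
noncomputable def stripDensity (w : ℝ × ℝ → ℂ) (s : ℝ → ℝ) (p : ℝ × ℝ) : ℝ :=
  2 * (conj (fderiv ℝ w p (1, 0)) * fderiv ℝ w p (0, 1)).im
    + (deriv s p.1 * ‖w p‖ ^ 2 + 2 * s p.1 * (conj (w p) * fderiv ℝ w p (1, 0)).re)

theorem hasDerivAt_along {E F : Type*} [NormedAddCommGroup E] [NormedSpace ℝ E]
    [NormedAddCommGroup F] [NormedSpace ℝ F] {f : E → F} {p : E} (hf : DifferentiableAt ℝ f p)
    (v : E) : HasDerivAt (fun t : ℝ => f (p + t • v)) (fderiv ℝ f p v) 0 :=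
  hf.hasFDerivAt.hasLineDerivAt v

theorem hasDerivAt_conj {f : ℝ → ℂ} {f' : ℂ} {t : ℝ} (hf : HasDerivAt f f' t) :
    HasDerivAt (fun t => conj (f t)) (conj f') t :=
  (Complex.conjCLE.toContinuousLinearMap.hasFDerivAt (x := f t)).comp_hasDerivAt t hf

theorem hasDerivAt_im {f : ℝ → ℂ} {f' : ℂ} {t : ℝ} (hf : HasDerivAt f f' t) :
    HasDerivAt (fun t => (f t).im) f'.im t :=
  (Complex.imCLM.hasFDerivAt (x := f t)).comp_hasDerivAt t hf

theorem stripDensity_eq_div {w : ℝ × ℝ → ℂ} {s : ℝ → ℝ} {p : ℝ × ℝ} (hw : ContDiffAt ℝ 2 w p)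
    (hs : ContDiffAt ℝ 1 s p.1) :
    fderiv ℝ (stripFlux w s) p (1, 0)
      + fderiv ℝ (fun q => -(conj (w q) * fderiv ℝ w q (1, 0)).im) p (0, 1) = stripDensity w s p
    ∧ DifferentiableAt ℝ (stripFlux w s) p
    ∧ DifferentiableAt ℝ (fun q => -(conj (w q) * fderiv ℝ w q (1, 0)).im) p := by
  have hw1 : DifferentiableAt ℝ w p := hw.differentiableAt (by norm_num)
  have hfw : DifferentiableAt ℝ (fderiv ℝ w) p :=
    (hw.fderiv_right (m := 1) (by norm_num)).differentiableAt (by norm_num)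
  have hsd : DifferentiableAt ℝ s p.1 := hs.differentiableAt one_ne_zero
  have hsymm := (hw.isSymmSndFDerivAt (by simp)) (1, 0) (0, 1)
  have hcw : DifferentiableAt ℝ (fun q => conj (w q)) p :=
    Complex.conjCLE.toContinuousLinearMap.differentiableAt.comp p hw1
  have hd : ∀ v, DifferentiableAt ℝ (fun q => fderiv ℝ w q v) p := fun v =>
    hfw.clm_apply (differentiableAt_const v)
  have him : ∀ v, DifferentiableAt ℝ (fun q => (conj (w q) * fderiv ℝ w q v).im) p := fun v =>
    Complex.imCLM.differentiableAt.comp p (hcw.mul (hd v))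
  have hsp : DifferentiableAt ℝ (fun q : ℝ × ℝ => s q.1) p := hsd.comp p differentiableAt_fst
  have d1 : DifferentiableAt ℝ (stripFlux w s) p := (him (0, 1)).add (hsp.mul (hw1.norm_sq ℝ))
  have d2 : DifferentiableAt ℝ (fun q => -(conj (w q) * fderiv ℝ w q (1, 0)).im) p :=
    (him (1, 0)).neg
  refine ⟨?_, d1, d2⟩
  have a1 := hasDerivAt_along hw1 (1, 0)
  have a2 := hasDerivAt_along hw1 (0, 1)
  have hfd : ∀ u v, HasDerivAt (fun t : ℝ => fderiv ℝ w (p + t • u) v)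
      (fderiv ℝ (fderiv ℝ w) p u v) 0 := fun u v =>
    ((ContinuousLinearMap.apply ℝ ℂ v).hasFDerivAt).comp_hasDerivAt 0 (hasDerivAt_along hfw u)
  have e1 : fderiv ℝ (stripFlux w s) p (1, 0) =
      (conj (fderiv ℝ w p (1, 0)) * fderiv ℝ w p (0, 1)
        + conj (w p) * fderiv ℝ (fderiv ℝ w) p (1, 0) (0, 1)).im
      + (deriv s p.1 * ‖w p‖ ^ 2 + s p.1 * (2 * (conj (w p) * fderiv ℝ w p (1, 0)).re)) := by
    refine (hasDerivAt_along d1 (1, 0)).unique ?_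
    have hsl : HasDerivAt (fun t : ℝ => s ((p + t • ((1 : ℝ), (0 : ℝ))).1)) (deriv s p.1) 0 := by
      have h1 : HasDerivAt (fun t : ℝ => (p + t • ((1 : ℝ), (0 : ℝ))).1) 1 0 := by
        simpa using (hasDerivAt_id (0 : ℝ)).const_add p.1
      have h2 : HasDerivAt s (deriv s p.1) ((p + (0 : ℝ) • ((1 : ℝ), (0 : ℝ))).1) := by
        simpa using hsd.hasDerivAt
      exact (h2.comp (0 : ℝ) h1).congr_deriv (mul_one _)
    have hn := a1.norm_sq
    have h := (hasDerivAt_im ((hasDerivAt_conj a1).mul (hfd (1, 0) (0, 1)))).fun_add (hsl.mul hn)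
    refine HasDerivAt.congr_deriv
      (show HasDerivAt (fun t : ℝ => stripFlux w s (p + t • ((1 : ℝ), (0 : ℝ)))) _ 0 from h) ?_
    simp only [zero_smul, add_zero, Complex.inner]
    ring_nf
  have e2 : fderiv ℝ (fun q => -(conj (w q) * fderiv ℝ w q (1, 0)).im) p (0, 1) =
      -(conj (fderiv ℝ w p (0, 1)) * fderiv ℝ w p (1, 0)
        + conj (w p) * fderiv ℝ (fderiv ℝ w) p (0, 1) (1, 0)).im := by
    refine (hasDerivAt_along d2 (0, 1)).unique ?_
    have h := (hasDerivAt_im ((hasDerivAt_conj a2).mul (hfd (0, 1) (1, 0)))).neg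
    refine HasDerivAt.congr_deriv (show HasDerivAt (fun t : ℝ => -(conj (w (p + t • ((0 : ℝ), (1 : ℝ))))
      * fderiv ℝ w (p + t • ((0 : ℝ), (1 : ℝ))) (1, 0)).im) _ 0 from h) ?_
    simp only [zero_smul, add_zero]
  rw [e1, e2, hsymm, stripDensity]
  simp
  ring

theorem ContDiffAt.continuousAt_fderiv_apply {w : ℝ × ℝ → ℂ} {p : ℝ × ℝ}
    (hw : ContDiffAt ℝ 2 w p) (v : ℝ × ℝ) : ContinuousAt (fun q => fderiv ℝ w q v) p :=
  ((hw.fderiv_right (m := 1) (by norm_num)).continuousAt).clm_apply continuousAt_const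

theorem continuousAt_stripDensity {w : ℝ × ℝ → ℂ} {s : ℝ → ℝ} {p : ℝ × ℝ}
    (hw : ContDiffAt ℝ 2 w p) (hs : ContDiffAt ℝ 1 s p.1) :
    ContinuousAt (stripDensity w s) p := by
  have c0 := hw.continuousAt
  have c1 := ContDiffAt.continuousAt_fderiv_apply hw (1, 0)
  have c2 := ContDiffAt.continuousAt_fderiv_apply hw (0, 1)
  have s0 : ContinuousAt (fun q : ℝ × ℝ => s q.1) p :=
    ContinuousAt.comp (f := Prod.fst) hs.continuousAt continuousAt_fst
  have hds : ContinuousAt (deriv s) p.1 := by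
    have h := (hs.fderiv_right (m := 0) (by norm_num)).continuousAt
    have : deriv s = fun x => fderiv ℝ s x 1 := funext fun x => fderiv_apply_one_eq_deriv.symm
    rw [this]
    exact h.clm_apply continuousAt_const
  have s1 : ContinuousAt (fun q : ℝ × ℝ => deriv s q.1) p :=
    ContinuousAt.comp (f := Prod.fst) hds continuousAt_fst
  have k1 := Complex.continuous_conj.continuousAt.comp c1
  have k0 := Complex.continuous_conj.continuousAt.comp c0
  have i1 := Complex.continuous_im.continuousAt.comp (k1.mul c2)
  have i2 := Complex.continuous_re.continuousAt.comp (k0.mul c1)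
  exact (continuousAt_const.mul i1).add
    ((s1.mul (c0.norm.pow 2)).add ((continuousAt_const.mul s0).mul i2))

/-- The divergence theorem on a rectangle; the sides θ = ±π cancel by periodicity, so only the
fluxes through the two circles survive. -/
theorem integral_stripDensity {w : ℝ × ℝ → ℂ} {s : ℝ → ℝ} {a b : ℝ} (hab : a ≤ b)
    (hw : ∀ p : ℝ × ℝ, p.1 ∈ Icc a b → ContDiffAt ℝ 2 w p)
    (hs : ∀ r ∈ Icc a b, ContDiffAt ℝ 1 s r)
    (hper : ∀ r θ, w (r, θ + 2 * Real.pi) = w (r, θ)) :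
    ∫ r in a..b, ∫ θ in (-Real.pi)..Real.pi, stripDensity w s (r, θ) =
      (∫ θ in (-Real.pi)..Real.pi, stripFlux w s (b, θ))
        - ∫ θ in (-Real.pi)..Real.pi, stripFlux w s (a, θ) := by
  have hpi : -Real.pi ≤ Real.pi := by linarith [Real.pi_pos]
  set k : ℝ × ℝ → ℝ := fun q => -(conj (w q) * fderiv ℝ w q (1, 0)).im with hk
  have key : ∀ p : ℝ × ℝ, p.1 ∈ Icc a b → _ := fun p hp => stripDensity_eq_div (hw p hp) (hs _ hp)
  have hmem : ∀ p ∈ (uIcc a b) ×ˢ (uIcc (-Real.pi) Real.pi), p.1 ∈ Icc a b := fun p hp => by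
    have := hp.1
    rwa [uIcc_of_le hab] at this
  have hmem' : ∀ p ∈ Ioo (min a b) (max a b) ×ˢ Ioo (min (-Real.pi) Real.pi)
      (max (-Real.pi) Real.pi), p.1 ∈ Icc a b := fun p hp => by
    have := hp.1
    rw [min_eq_left hab, max_eq_right hab] at this
    exact Ioo_subset_Icc_self this
  have hcont : ContinuousOn (fun p => fderiv ℝ (stripFlux w s) p (1, 0) + fderiv ℝ k p (0, 1))
      ((uIcc a b) ×ˢ (uIcc (-Real.pi) Real.pi)) := by
    refine ContinuousOn.congr (f := stripDensity w s) (fun p hp => ?_) fun p hp =>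
      (key p (hmem p hp)).1
    exact (continuousAt_stripDensity (hw _ (hmem p hp)) (hs _ (hmem p hp))).continuousWithinAt
  have h := integral2_divergence_prod_of_hasFDerivAt (stripFlux w s) k
    (fderiv ℝ (stripFlux w s)) (fderiv ℝ k) a (-Real.pi) b Real.pi
    (fun p hp => (key p (hmem p hp)).2.1.continuousAt.continuousWithinAt)
    (fun p hp => (key p (hmem p hp)).2.2.continuousAt.continuousWithinAt)
    (fun p hp => (key p (hmem' p hp)).2.1.hasFDerivAt)
    (fun p hp => (key p (hmem' p hp)).2.2.hasFDerivAt)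
    (hcont.integrableOn_compact (isCompact_uIcc.prod isCompact_uIcc))
  have hkper : ∀ r ∈ (uIcc a b), k (r, Real.pi) = k (r, -Real.pi) := by
    intro r _
    have e0 : w (r, Real.pi) = w (r, -Real.pi) := by
      rw [← hper r (-Real.pi), show -Real.pi + 2 * Real.pi = Real.pi by ring]
    have e1 : fderiv ℝ w (r, Real.pi) = fderiv ℝ w (r, -Real.pi) := by
      have hf : (fun q : ℝ × ℝ => w (q + (0, 2 * Real.pi))) = w := by
        funext q
        rw [show q + (0, 2 * Real.pi) = (q.1, q.2 + 2 * Real.pi) by ext <;> simp]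
        exact hper q.1 q.2
      have := fderiv_comp_add_right (𝕜 := ℝ) (f := w) (x := (r, -Real.pi))
        ((0 : ℝ), 2 * Real.pi)
      rw [hf] at this
      rw [this]
      congr 1
      ext <;> simp
      ring
    simp only [hk, e0, e1]
  have hk0 : (∫ x in a..b, k (x, Real.pi)) = ∫ x in a..b, k (x, -Real.pi) :=
    intervalIntegral.integral_congr hkper
  rw [hk0, sub_self, zero_add] at h
  rw [← h]
  refine intervalIntegral.integral_congr fun r hr => ?_
  refine intervalIntegral.integral_congr fun θ hθ => ?_
  rw [uIcc_of_le hab] at hr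
  exact ((key (r, θ) hr).1).symm

end PauliHardy

/-! ### The Wirtinger derivative, the weights and the pointwise inequalities -/

namespace PauliHardy
open Set Filter Topology ComplexConjugate

/-- Twice the Wirtinger derivative, `∂₀ v - i ∂₁ v`. -/
noncomputable def dz (v : Plane → ℂ) (x : Plane) : ℂ :=
  fderiv ℝ v x (EuclideanSpace.single 0 1) - Complex.I * fderiv ℝ v x (EuclideanSpace.single 1 1)

noncomputable def hardyWeight (ρ : ℝ) (x : Plane) : ℝ :=
  1 / (ρ ^ 2 + ‖x‖ ^ 2 * (1 + Real.log (‖x‖ / ρ) ^ 2))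

theorem hardyWeight_denom_pos {ρ : ℝ} (hρ : 0 < ρ) (x : Plane) :
    0 < ρ ^ 2 + ‖x‖ ^ 2 * (1 + Real.log (‖x‖ / ρ) ^ 2) := by positivity

theorem hardyWeight_nonneg {ρ : ℝ} (hρ : 0 < ρ) (x : Plane) : 0 ≤ hardyWeight ρ x :=
  (one_div_pos.2 (hardyWeight_denom_pos hρ x)).le

theorem hardyWeight_le {ρ : ℝ} (hρ : 0 < ρ) (x : Plane) : hardyWeight ρ x ≤ 1 / ρ ^ 2 := by
  unfold hardyWeight
  gcongr
  have : 0 ≤ ‖x‖ ^ 2 * (1 + Real.log (‖x‖ / ρ) ^ 2) := by positivity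
  linarith

theorem continuous_hardyWeight {ρ : ℝ} (hρ : 0 < ρ) : Continuous (hardyWeight ρ) := by
  refine continuous_const.div ?_ fun x => (hardyWeight_denom_pos hρ x).ne'
  have h : Continuous (fun x : Plane => ‖x‖ / ρ * Real.log (‖x‖ / ρ)) :=
    Real.continuous_mul_log.comp (continuous_norm.div_const ρ)
  have : (fun x : Plane => ρ ^ 2 + ‖x‖ ^ 2 * (1 + Real.log (‖x‖ / ρ) ^ 2))
      = fun x => ρ ^ 2 + (‖x‖ ^ 2 + ρ ^ 2 * (‖x‖ / ρ * Real.log (‖x‖ / ρ)) ^ 2) := by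
    funext x; field_simp
  rw [this]
  fun_prop

theorem gPlus_pos {α ρ r : ℝ} (hρ : 0 < ρ) : 0 < gPlus α ρ r := by
  unfold gPlus
  split_ifs with h
  · exact one_pos
  · have : 0 < r := by linarith
    positivity

theorem gPlus_of_le {α ρ r : ℝ} (h : r ≤ ρ) : gPlus α ρ r = 1 := if_pos h

theorem gPlus_of_ge {α ρ r : ℝ} (hρ : 0 < ρ) (h : ρ ≤ r) : gPlus α ρ r = ρ ^ (-α) * r ^ α := by
  rcases h.eq_or_lt with rfl | h
  · rw [gPlus_of_le le_rfl, ← Real.rpow_add hρ]; simp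
  · exact if_neg (not_le.2 h)

theorem continuous_gPlus {α ρ : ℝ} (hα : 0 ≤ α) (hρ : 0 < ρ) : Continuous (gPlus α ρ) := by
  unfold gPlus
  refine continuous_if_le continuous_id continuous_const continuousOn_const ?_ ?_
  · exact (continuous_const.mul (continuous_id.rpow_const fun _ => Or.inr hα)).continuousOn
  · rintro r rfl
    rw [← Real.rpow_add hρ]; simp

theorem fderiv_comp_polarPt {v : Plane → ℂ} (hv : ContDiff ℝ 2 v) (p u : ℝ × ℝ) :
    fderiv ℝ (fun p => v (polarPt p)) p u
    = fderiv ℝ v (polarPt p) (fderiv ℝ polarPt p u) := by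
  have := fderiv_comp p (hv.differentiable (by norm_num) _)
    (hasFDerivAt_polarPt p).differentiableAt
  exact congrArg (fun L => L u) this

/-- In the rotating frame ∂₀ - i∂₁ = e^{-iθ}(∂_r - (i/r)∂_θ), and the unimodular factor drops out.
-/
theorem norm_sq_dz_polarPt {v : Plane → ℂ} (hv : ContDiff ℝ 2 v) (p : ℝ × ℝ) (hp : p.1 ≠ 0) :
    ‖dz v (polarPt p)‖ ^ 2 = ‖fderiv ℝ (fun p => v (polarPt p)) p (1, 0)
      - Complex.I * fderiv ℝ (fun p => v (polarPt p)) p (0, 1) / p.1‖ ^ 2 := by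
  rw [fderiv_comp_polarPt hv, fderiv_comp_polarPt hv, fderiv_polarPt_radial,
    fderiv_polarPt_angular]
  simp only [map_add, map_smul, dz, Complex.real_smul]
  set a := fderiv ℝ v (polarPt p) (EuclideanSpace.single 0 1)
  set b := fderiv ℝ v (polarPt p) (EuclideanSpace.single 1 1)
  have hp' : (p.1 : ℂ) ≠ 0 := by exact_mod_cast hp
  have e : (Real.cos p.2 : ℂ) * a + (Real.sin p.2 : ℂ) * b
      - Complex.I * (((-(p.1 * Real.sin p.2) : ℝ) : ℂ) * a + ((p.1 * Real.cos p.2 : ℝ) : ℂ) * b) / p.1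
      = Complex.exp (p.2 * Complex.I) * (a - Complex.I * b) := by
    rw [Complex.exp_mul_I]
    push_cast
    field_simp
    linear_combination (Complex.sin p.2 * b) * Complex.I_sq
  rw [e, norm_mul, Complex.norm_exp_ofReal_mul_I, one_mul]

/-- Expanding the square produces the same term 2 Im(z̄r zt) on the right. With m = 1/ρ², the term
|zt|²/r is dropped and r|zr + (rm/4)z|² ≥ 0 completes the square. It remains to check cW + r²m²/16 ≤
m/2, and the left side is at most m/4 + m/16. -/
theorem strip_inner_pointwise {ρ r c W : ℝ} (hr : 0 < r) (hrρ : r ≤ ρ) (hc0 : 0 ≤ c)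
    (hc : c ≤ 1 / 4) (hW : W ≤ 1 / ρ ^ 2) (z zr zt : ℂ) :
    2 * (conj zr * zt).im + (-(r / (2 * ρ ^ 2)) * ‖z‖ ^ 2
      + 2 * (-(r ^ 2 / (4 * ρ ^ 2))) * (conj z * zr).re)
      ≤ r * (‖zr - Complex.I * zt / r‖ ^ 2 - c * (‖z‖ ^ 2 * W)) := by
  have hρ : 0 < ρ := hr.trans_le hrρ
  have hcW : c * W ≤ 1 / 4 * (1 / ρ ^ 2) := by
    calc c * W ≤ c * (1 / ρ ^ 2) := by gcongr
      _ ≤ _ := by gcongr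
  set m := 1 / ρ ^ 2 with hm
  have hm0 : 0 < m := by positivity
  have hrm : r ^ 2 * m ≤ 1 := by
    rw [hm, mul_one_div, div_le_one (by positivity)]
    gcongr
  have e1 : r / (2 * ρ ^ 2) = r * m / 2 := by rw [hm]; ring
  have e2 : r ^ 2 / (4 * ρ ^ 2) = r ^ 2 * m / 4 := by rw [hm]; ring
  rw [e1, e2]
  have hn : ∀ z : ℂ, ‖z‖ ^ 2 = z.re ^ 2 + z.im ^ 2 := fun z => by
    rw [← Complex.normSq_eq_norm_sq, Complex.normSq_apply]; ring
  have hI : zr - Complex.I * zt / r = ⟨zr.re + zt.im / r, zr.im - zt.re / r⟩ := by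
    apply Complex.ext <;> simp [Complex.div_re, Complex.div_im, Complex.normSq] <;> (field_simp; try ring)
  rw [hI]
  simp only [hn, Complex.mul_im, Complex.mul_re, Complex.conj_re, Complex.conj_im]
  have hq : r * ((zr.re + zt.im / r) ^ 2 + (zr.im - zt.re / r) ^ 2)
      = r * (zr.re ^ 2 + zr.im ^ 2) + (zt.im ^ 2 + zt.re ^ 2) / r
        + 2 * (zr.re * zt.im - zr.im * zt.re) := by
    field_simp; ring
  have hpos : 0 ≤ (zt.im ^ 2 + zt.re ^ 2) / r := by positivity
  have s1 : 0 ≤ r * ((zr.re + r * m / 4 * z.re) ^ 2 + (zr.im + r * m / 4 * z.im) ^ 2) := by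
    positivity
  have s2 : r * (c * W + r ^ 2 * m * m / 16) * (z.re ^ 2 + z.im ^ 2)
      ≤ r * (m / 2) * (z.re ^ 2 + z.im ^ 2) := by
    gcongr
    nlinarith
  nlinarith

/-- Here the discarded square is |αz + i wt|²/r, which vanishes on the resonant mode e^{iαθ}. The
rest is the one-dimensional logarithmic Hardy inequality, in the form r|wr - z/(2rd)|² ≥ 0, which
leaves the weight 1/(4d²r). -/
theorem strip_outer_pointwise {α r c W d : ℝ} (hr : 0 < r) (hd : 0 < d)
    (hW : c * W * r ^ 2 ≤ 1 / (4 * d ^ 2)) (z wr wt : ℂ) :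
    2 * (conj wr * wt).im + (-(1 / (2 * r * d ^ 2)) * ‖z‖ ^ 2
      + 2 * (-α + 1 / (2 * d)) * (conj z * wr).re)
      ≤ r * (‖(wr - α / r * z) - Complex.I * wt / r‖ ^ 2 - c * (‖z‖ ^ 2 * W)) := by
  have hn : ∀ z : ℂ, ‖z‖ ^ 2 = z.re ^ 2 + z.im ^ 2 := fun z => by
    rw [← Complex.normSq_eq_norm_sq, Complex.normSq_apply]; ring
  have hI : (wr - α / r * z) - Complex.I * wt / r
      = ⟨wr.re - α / r * z.re + wt.im / r, wr.im - α / r * z.im - wt.re / r⟩ := by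
    apply Complex.ext <;> simp [Complex.div_re, Complex.div_im, Complex.normSq] <;> (field_simp; try ring)
  rw [hI]
  simp only [hn, Complex.mul_im, Complex.mul_re, Complex.conj_re, Complex.conj_im]
  have hq : r * ((wr.re - α / r * z.re + wt.im / r) ^ 2 + (wr.im - α / r * z.im - wt.re / r) ^ 2)
      = r * (wr.re ^ 2 + wr.im ^ 2)
        + ((-α * z.re + wt.im) ^ 2 + (-α * z.im - wt.re) ^ 2) / r
        - 2 * α * (wr.re * z.re + wr.im * z.im)
        + 2 * (wr.re * wt.im - wr.im * wt.re) := by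
    field_simp; ring
  have hpos : 0 ≤ ((-α * z.re + wt.im) ^ 2 + (-α * z.im - wt.re) ^ 2) / r := by positivity
  have hs : r * ((wr.re - 1 / (2 * r * d) * z.re) ^ 2 + (wr.im - 1 / (2 * r * d) * z.im) ^ 2)
      = r * (wr.re ^ 2 + wr.im ^ 2) - 1 / d * (wr.re * z.re + wr.im * z.im)
        + 1 / (4 * d ^ 2) / r * (z.re ^ 2 + z.im ^ 2) := by
    field_simp; ring
  have hs0 : 0 ≤ r * ((wr.re - 1 / (2 * r * d) * z.re) ^ 2
      + (wr.im - 1 / (2 * r * d) * z.im) ^ 2) := by positivity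
  have hc : r * c * W * (z.re ^ 2 + z.im ^ 2)
      ≤ 1 / (4 * d ^ 2) / r * (z.re ^ 2 + z.im ^ 2) := by
    gcongr
    rw [le_div_iff₀ hr]
    linarith
  have e1 : 1 / (2 * r * d ^ 2) = 2 * (1 / (4 * d ^ 2) / r) := by field_simp; norm_num
  have e2 : 2 * (-α + 1 / (2 * d)) = -2 * α + 1 / d := by field_simp
  rw [e1, e2, mul_sub r, hq]
  nlinarith

end PauliHardy

/-! ### The weighted Hardy inequality -/

namespace PauliHardy
open Set Filter Topology ComplexConjugate

/-- With s = 2/(3α), Cauchy–Schwarz gives (L + s)² ≤ (1 + s²)(1 + L²), so it suffices that 4αs² ≤ π.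
Since αs = 2/3 and α ≥ 1, the left side is 8s/3 ≤ 16/9. This is where the constant α/(4α + π)
enters. -/
theorem hardy_constant_bound {α L : ℝ} (hα : 1 ≤ α) :
    α / (4 * α + Real.pi) * (1 / (1 + L ^ 2)) ≤ 1 / (4 * (L + 2 / (3 * α)) ^ 2) ∨ L < 0 := by
  rcases lt_or_ge L 0 with h | h
  · exact Or.inr h
  left
  have hα0 : 0 < α := by linarith
  have hs : 0 < L + 2 / (3 * α) := by positivity
  rw [div_mul_div_comm, div_le_div_iff₀ (by positivity) (by positivity)]
  set s := 2 / (3 * α) with hsd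
  have hsα : s * α = 2 / 3 := by rw [hsd]; field_simp
  have hs0 : 0 < s := by positivity
  have hs1 : s ≤ 2 / 3 := by nlinarith
  have hCS : (L + s) ^ 2 ≤ (1 + s ^ 2) * (1 + L ^ 2) := by nlinarith [sq_nonneg (1 - s * L)]
  have h1 : 4 * (α * (1 + s ^ 2)) ≤ 4 * α + Real.pi := by
    have : 4 * (α * s ^ 2) ≤ Real.pi := by
      have : α * s ^ 2 = 2 / 3 * s := by rw [← hsα]; ring
      rw [this]
      linarith [Real.pi_gt_three]
    linarith
  calc α * 1 * (4 * (L + s) ^ 2) = 4 * α * (L + s) ^ 2 := by ring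
    _ ≤ 4 * α * ((1 + s ^ 2) * (1 + L ^ 2)) := by gcongr
    _ = 4 * (α * (1 + s ^ 2)) * (1 + L ^ 2) := by ring
    _ ≤ (4 * α + Real.pi) * (1 + L ^ 2) := by gcongr
    _ = _ := by ring

/-- The weighted Hardy inequality for the Wirtinger derivative. -/
theorem radial_hardy {α ρ : ℝ} (hα : 1 ≤ α) (hρ : 0 < ρ) {v : Plane → ℂ} (hv : ContDiff ℝ 2 v)
    (hc : HasCompactSupport v) :
    α / (4 * α + Real.pi) * ∫ x, gPlus α ρ ‖x‖ ^ 2 * (‖v x‖ ^ 2 * hardyWeight ρ x)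
      ≤ ∫ x, gPlus α ρ ‖x‖ ^ 2 * ‖dz v x‖ ^ 2 := by
  have hα0 : 0 < α := by linarith
  have hpi := Real.pi_pos
  have hpi' : -Real.pi ≤ Real.pi := by linarith
  set c := α / (4 * α + Real.pi) with hcdef
  have hc0 : 0 ≤ c := by positivity
  have hc4 : c ≤ 1 / 4 := by
    rw [hcdef, div_le_div_iff₀ (by positivity) (by norm_num)]; linarith
  have hdz : Continuous (dz v) := by
    have h := hv.continuous_fderiv (by norm_num)
    exact (h.clm_apply continuous_const).sub
      (continuous_const.mul (h.clm_apply continuous_const))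
  have hg : Continuous (fun x : Plane => gPlus α ρ ‖x‖) :=
    (continuous_gPlus hα0.le hρ).comp continuous_norm
  have hW := continuous_hardyWeight hρ
  obtain ⟨R₁, hR₁, hs₁⟩ := hc.exists_norm_lt
  obtain ⟨R₂, hR₂, hs₂⟩ := (hc.fderiv (𝕜 := ℝ)).exists_norm_lt
  have hdz0 : ∀ x, R₂ ≤ ‖x‖ → dz v x = 0 := fun x hx => by simp [dz, hs₂ x hx]
  set R := max ρ (max R₁ R₂) with hR
  have hρR : ρ ≤ R := le_max_left _ _
  have hR1 : R₁ ≤ R := (le_max_left _ _).trans (le_max_right _ _)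
  have hR2 : R₂ ≤ R := (le_max_right _ _).trans (le_max_right _ _)
  have hR0 : 0 ≤ R := hρ.le.trans hρR
  have hcv := hv.continuous
  have hI : ∀ f : Plane → ℝ, Continuous f → (∀ x, R ≤ ‖x‖ → f x = 0) → Integrable f :=
    fun f hf h0 => hf.integrable_of_hasCompactSupport
      (HasCompactSupport.intro (isCompact_closedBall (0 : Plane) R) fun x hx =>
        h0 x (by simpa using (not_le.1 (fun h => hx (by simpa using h))).le))
  have I1 : Integrable (fun x => gPlus α ρ ‖x‖ ^ 2 * (‖v x‖ ^ 2 * hardyWeight ρ x)) :=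
    hI _ (by fun_prop) fun x hx => by simp [hs₁ x (hR1.trans hx)]
  have I2 : Integrable (fun x => gPlus α ρ ‖x‖ ^ 2 * ‖dz v x‖ ^ 2) :=
    hI _ (by fun_prop) fun x hx => by simp [hdz0 x (hR2.trans hx)]
  set f : Plane → ℝ := fun x => gPlus α ρ ‖x‖ ^ 2 * ‖dz v x‖ ^ 2
    - c * (gPlus α ρ ‖x‖ ^ 2 * (‖v x‖ ^ 2 * hardyWeight ρ x)) with hf
  suffices hmain : 0 ≤ ∫ x, f x by
    rw [hf, integral_sub I2 (I1.const_mul c), integral_const_mul] at hmain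
    linarith
  have hfc : Continuous f := by fun_prop
  have hf0 : ∀ x, R < ‖x‖ → f x = 0 := fun x hx => by
    simp [hf, hs₁ x (hR1.trans hx.le), hdz0 x (hR2.trans hx.le)]
  set F : ℝ × ℝ → ℝ := fun p => p.1 * f (polarPt p) with hF
  have hFc : Continuous F :=
    continuous_fst.mul (hfc.comp (contDiff_polarPt (n := 0)).continuous)
  rw [integral_eq_intervalIntegral_polar hR0 f F hFc.continuousOn (fun _ _ _ => rfl) hf0]
  have hFr : Continuous (fun r => ∫ θ in (-Real.pi)..Real.pi, F (r, θ)) :=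
    intervalIntegral.continuous_parametric_intervalIntegral_of_continuous' (by exact hFc) _ _
  -- The integral is split at r = ρ. Each part dominates the integral of a divergence, hence a flux
  -- through the circle r = ρ, with opposite orientations.
  rw [← intervalIntegral.integral_add_adjacent_intervals (hFr.intervalIntegrable 0 ρ)
    (hFr.intervalIntegrable ρ R)]
  -- the disc
  set V : ℝ × ℝ → ℂ := fun p => v (polarPt p) with hV
  have hV2 : ContDiff ℝ 2 V := hv.comp contDiff_polarPt
  have hVper : ∀ r θ, V (r, θ + 2 * Real.pi) = V (r, θ) := fun r θ => by
    simp only [hV, polarPt_add_two_pi]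
  -- The multiplier vanishes at r = 0, where ∂_θ V vanishes as well, so no flux leaves through the
  -- origin; it equals -1/4 at r = ρ.
  set s₁ : ℝ → ℝ := fun r => -(r ^ 2 / (4 * ρ ^ 2)) with hs₁d
  have hs₁c : ContDiff ℝ 1 s₁ := by fun_prop
  have hds₁ : ∀ r, deriv s₁ r = -(r / (2 * ρ ^ 2)) := fun r => by
    have h := (((hasDerivAt_id r).pow 2).div_const (4 * ρ ^ 2)).neg
    rw [show s₁ = -fun x => (id ^ 2) x / (4 * ρ ^ 2) from rfl, h.deriv]
    simp; ring
  have hdisc : (∫ θ in (-Real.pi)..Real.pi, stripFlux V s₁ (ρ, θ))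
      ≤ ∫ r in (0)..ρ, ∫ θ in (-Real.pi)..Real.pi, F (r, θ) := by
    have h1 := integral_stripDensity hρ.le (w := V) (s := s₁) (fun p _ => hV2.contDiffAt)
      (fun r _ => hs₁c.contDiffAt) hVper
    have h2 : ∀ θ, stripFlux V s₁ (0, θ) = 0 := fun θ => by
      have : fderiv ℝ V (0, θ) (0, 1) = 0 := by
        rw [hV, fderiv_comp_polarPt hv, fderiv_polarPt_angular]; simp
      simp [stripFlux, this, hs₁d]
    simp only [h2, intervalIntegral.integral_zero, sub_zero] at h1
    rw [← h1]
    refine intervalIntegral_prod_mono hρ.le hpi' (fun p hp =>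
      (continuousAt_stripDensity hV2.contDiffAt hs₁c.contDiffAt).continuousWithinAt)
      hFc.continuousOn fun p hp hpρ => ?_
    have hgp : gPlus α ρ ‖polarPt p‖ = 1 := by
      rw [norm_polarPt, abs_of_pos hp, gPlus_of_le hpρ]
    simp only [hF, hf, hgp, one_pow, one_mul, norm_sq_dz_polarPt hv p hp.ne', stripDensity, hds₁]
    exact strip_inner_pointwise hp hpρ hc0 hc4 (hardyWeight_le hρ _) (V p) _ _
  -- the exterior
  set G : ℝ → ℝ := fun r => ρ ^ (-α) * r ^ α with hG
  -- Absorbing the weight into w turns G ∂_r V into ∂_r w - (α/r)w. The -α in s₂ compensates the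
  -- cross term this creates. The shift 2/(3α) in d keeps d positive at ρ and gives s₂(ρ) = -α +
  -- 3α/4 = -α/4.
  set w : ℝ × ℝ → ℂ := fun p => (G p.1 : ℂ) * V p with hw
  set d : ℝ → ℝ := fun r => Real.log (r / ρ) + 2 / (3 * α) with hd
  set s₂ : ℝ → ℝ := fun r => -α + 1 / (2 * d r) with hs₂d
  have hdpos : ∀ r, ρ ≤ r → 0 < d r := fun r hr => by
    have : 0 ≤ Real.log (r / ρ) := Real.log_nonneg (by rwa [one_le_div hρ])
    have h2 : 0 < 2 / (3 * α) := by positivity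
    simp only [hd]; linarith
  have hGc : ∀ r, 0 < r → ContDiffAt ℝ 2 G r := fun r hr =>
    contDiffAt_const.mul (contDiffAt_id.rpow_const_of_ne hr.ne')
  have hdG : ∀ r, 0 < r → HasDerivAt G (G r * (α / r)) r := fun r hr => by
    have h := (Real.hasDerivAt_rpow_const (x := r) (p := α) (Or.inl hr.ne')).const_mul (ρ ^ (-α))
    refine h.congr_deriv ?_
    simp only [hG]
    rw [Real.rpow_sub_one hr.ne']
    field_simp
  have hwc : ∀ p : ℝ × ℝ, 0 < p.1 → ContDiffAt ℝ 2 w p := fun p hp => by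
    have h1 : ContDiffAt ℝ 2 (fun p : ℝ × ℝ => G p.1) p := (hGc _ hp).comp p contDiffAt_fst
    exact (Complex.ofRealCLM.contDiff.contDiffAt.comp p h1).mul hV2.contDiffAt
  have hdc : ∀ r, 0 < r → ContDiffAt ℝ 1 d r := fun r hr =>
    ((contDiffAt_id.div_const ρ).log (by simp [hr.ne', hρ.ne'])).add contDiffAt_const
  have hs₂c : ∀ r, ρ ≤ r → ContDiffAt ℝ 1 s₂ r := fun r hr =>
    contDiffAt_const.add (contDiffAt_const.div (contDiffAt_const.mul (hdc r (hρ.trans_le hr)))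
      (mul_pos two_pos (hdpos r hr)).ne')
  have hds₂ : ∀ r, ρ ≤ r → deriv s₂ r = -(1 / (2 * r * d r ^ 2)) := fun r hr => by
    have hr0 : 0 < r := hρ.trans_le hr
    have hdd : HasDerivAt d (1 / r) r := by
      have h := ((hasDerivAt_id r).div_const ρ).log (by simp [hr0.ne', hρ.ne'])
      refine (h.add_const (2 / (3 * α))).congr_deriv ?_
      simp; field_simp
    have h := ((hasDerivAt_const r (1 : ℝ)).fun_div (hdd.const_mul 2)
      (mul_pos two_pos (hdpos r hr)).ne').const_add (-α)
    rw [show s₂ = fun x => -α + 1 / (2 * d x) from rfl, h.deriv]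
    have := hdpos r hr
    field_simp
    ring
  have hwr : ∀ p : ℝ × ℝ, 0 < p.1 → fderiv ℝ w p (1, 0)
      = G p.1 * (fderiv ℝ V p (1, 0) + α / p.1 * V p) := fun p hp => by
    refine (hasDerivAt_along ((hwc p hp).differentiableAt (by norm_num)) (1, 0)).unique ?_
    have h1 : HasDerivAt (fun t : ℝ => (p + t • ((1 : ℝ), (0 : ℝ))).1) 1 0 := by
      simpa using (hasDerivAt_id (0 : ℝ)).const_add p.1
    have h2 : HasDerivAt G (G p.1 * (α / p.1)) ((p + (0 : ℝ) • ((1 : ℝ), (0 : ℝ))).1) := by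
      simpa using hdG p.1 hp
    have h3 := (h2.comp (0 : ℝ) h1).ofReal_comp.mul
      (hasDerivAt_along (hV2.differentiable (by norm_num) p) (1, 0))
    refine HasDerivAt.congr_deriv
      (show HasDerivAt (fun t : ℝ => w (p + t • ((1 : ℝ), (0 : ℝ)))) _ 0 from h3) ?_
    simp only [zero_smul, add_zero, Function.comp]
    push_cast
    ring
  have hwt : ∀ p : ℝ × ℝ, 0 < p.1 → fderiv ℝ w p (0, 1)
      = G p.1 * fderiv ℝ V p (0, 1) := fun p hp => by
    refine (hasDerivAt_along ((hwc p hp).differentiableAt (by norm_num)) (0, 1)).unique ?_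
    have h3 := (hasDerivAt_along (hV2.differentiable (by norm_num) p) (0, 1)).const_mul
      (G p.1 : ℂ)
    have e : (fun t : ℝ => w (p + t • ((0 : ℝ), (1 : ℝ))))
        = fun t : ℝ => (G p.1 : ℂ) * V (p + t • ((0 : ℝ), (1 : ℝ))) := by
      funext t; simp [hw]
    rw [e]
    exact h3
  have hwper : ∀ r θ, w (r, θ + 2 * Real.pi) = w (r, θ) := fun r θ => by
    simp only [hw, hVper]
  have hext : -(∫ θ in (-Real.pi)..Real.pi, stripFlux w s₂ (ρ, θ))
      ≤ ∫ r in ρ..R, ∫ θ in (-Real.pi)..Real.pi, F (r, θ) := by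
    have h1 := integral_stripDensity hρR (w := w) (s := s₂)
      (fun p hp => hwc p (hρ.trans_le hp.1)) (fun r hr => hs₂c r hr.1) hwper
    have h2 : ∀ θ, stripFlux w s₂ (R, θ) = 0 := fun θ => by
      have : V (R, θ) = 0 := hs₁ _ (by rw [norm_polarPt, abs_of_nonneg hR0]; exact hR1)
      simp [stripFlux, hw, this]
    simp only [h2, intervalIntegral.integral_zero, zero_sub] at h1
    rw [← h1]
    refine intervalIntegral_prod_mono hρR hpi' (fun p hp =>
      (continuousAt_stripDensity (hwc p (hρ.trans_le hp.1.1))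
        (hs₂c _ hp.1.1)).continuousWithinAt)
      hFc.continuousOn fun p hp hpR => ?_
    have hp0 : 0 < p.1 := hρ.trans hp
    have hgp : gPlus α ρ ‖polarPt p‖ = G p.1 := by
      rw [norm_polarPt, abs_of_pos hp0, gPlus_of_ge hρ hp.le]
    have hGpos : 0 < G p.1 := by positivity
    have hGn : ‖(G p.1 : ℂ)‖ = G p.1 := by
      rw [Complex.norm_real, Real.norm_of_nonneg hGpos.le]
    have hbound : c * hardyWeight ρ (polarPt p) * p.1 ^ 2 ≤ 1 / (4 * d p.1 ^ 2) := by
      have hL : 0 ≤ Real.log (p.1 / ρ) := Real.log_nonneg (by rw [one_le_div hρ]; exact hp.le)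
      refine le_trans ?_ ((hardy_constant_bound (L := Real.log (p.1 / ρ)) hα).resolve_right
        (not_lt.2 hL))
      rw [mul_assoc]
      gcongr
      rw [hardyWeight, norm_polarPt, abs_of_pos hp0, div_mul_eq_mul_div, one_mul,
        div_le_div_iff₀ (by positivity) (by positivity)]
      nlinarith [sq_nonneg ρ]
    have hkey := strip_outer_pointwise (α := α) hp0 (hdpos _ hp.le) hbound (w p)
      (fderiv ℝ w p (1, 0)) (fderiv ℝ w p (0, 1))
    have e1 : fderiv ℝ w p (1, 0) - α / p.1 * w p - Complex.I * fderiv ℝ w p (0, 1) / p.1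
        = G p.1 * (fderiv ℝ V p (1, 0) - Complex.I * fderiv ℝ V p (0, 1) / p.1) := by
      rw [hwr p hp0, hwt p hp0]
      simp only [hw]
      ring
    have e2 : ‖w p‖ ^ 2 = G p.1 ^ 2 * ‖V p‖ ^ 2 := by
      simp only [hw, norm_mul, hGn, mul_pow]
    have e3 : ‖(G p.1 : ℂ) * (fderiv ℝ V p (1, 0) - Complex.I * fderiv ℝ V p (0, 1) / p.1)‖ ^ 2
        = G p.1 ^ 2 * ‖fderiv ℝ V p (1, 0) - Complex.I * fderiv ℝ V p (0, 1) / p.1‖ ^ 2 := by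
      rw [norm_mul, hGn, mul_pow]
    rw [e1, e3] at hkey
    simp only [hF, hf, hgp, norm_sq_dz_polarPt hv p hp0.ne', stripDensity, hds₂ _ hp.le]
    refine hkey.trans_eq ?_
    rw [e2]
    ring
  -- the contributions of the circle of radius `ρ`
  have hcirc : ∀ θ, stripFlux V s₁ (ρ, θ) - stripFlux w s₂ (ρ, θ)
      = (α - 1) / 4 * ‖V (ρ, θ)‖ ^ 2 := fun θ => by
    have hGρ : G ρ = 1 := by simp only [hG]; rw [← Real.rpow_add hρ]; simp
    have e1 : w (ρ, θ) = V (ρ, θ) := by simp [hw, hGρ]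
    have e2 : s₁ ρ = -(1 / 4) := by simp only [hs₁d]; field_simp
    have e3 : s₂ ρ = -α / 4 := by
      simp only [hs₂d, hd, div_self hρ.ne', Real.log_one]; field_simp; ring
    simp only [stripFlux, hwt (ρ, θ) hρ, e1, e2, e3, hGρ]
    simp
    ring
  have hint : ∀ (w' : ℝ × ℝ → ℂ) (s : ℝ → ℝ), (∀ θ, ContDiffAt ℝ 2 w' (ρ, θ)) →
      IntervalIntegrable (fun θ => stripFlux w' s (ρ, θ)) volume (-Real.pi) Real.pi := by
    intro w' s h
    refine Continuous.intervalIntegrable (continuous_iff_continuousAt.2 fun θ => ?_) _ _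
    have hpair : ContinuousAt (fun θ : ℝ => (ρ, θ)) θ := by fun_prop
    have c0 : ContinuousAt (fun θ : ℝ => w' (ρ, θ)) θ :=
      ContinuousAt.comp (f := fun θ : ℝ => (ρ, θ)) (h θ).continuousAt hpair
    have c1 : ContinuousAt (fun θ : ℝ => fderiv ℝ w' (ρ, θ) (0, 1)) θ :=
      ContinuousAt.comp (f := fun θ : ℝ => (ρ, θ)) (g := fun q => fderiv ℝ w' q (0, 1))
        (ContDiffAt.continuousAt_fderiv_apply (h θ) (0, 1)) hpair
    exact (Complex.continuous_im.continuousAt.comp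
      ((Complex.continuous_conj.continuousAt.comp c0).mul c1)).add
      (continuousAt_const.mul (c0.norm.pow 2))
  -- As G(ρ) = 1, the angular-momentum parts of the two fluxes cancel, leaving s₁(ρ) - s₂(ρ) = (α -
  -- 1)/4, which is nonnegative for α ≥ 1.
  have hdiff : 0 ≤ (∫ θ in (-Real.pi)..Real.pi, stripFlux V s₁ (ρ, θ))
      - ∫ θ in (-Real.pi)..Real.pi, stripFlux w s₂ (ρ, θ) := by
    rw [← intervalIntegral.integral_sub (hint V s₁ fun θ => hV2.contDiffAt)
      (hint w s₂ fun θ => hwc _ hρ)]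
    refine intervalIntegral.integral_nonneg hpi' fun θ _ => ?_
    rw [hcirc]
    have : 0 ≤ (α - 1) / 4 := by linarith
    positivity
  linarith

end PauliHardy

/-! ### Mollification -/

namespace PauliHardy
open Set Filter Topology ComplexConjugate

/-- A sequence of bump functions shrinking to the origin. -/
noncomputable def bump (n : ℕ) : ContDiffBump (0 : Plane) where
  rIn := 1 / (2 * (n + 1))
  rOut := 1 / (n + 1)
  rIn_pos := by positivity
  rIn_lt_rOut := by
    have : (0 : ℝ) < n + 1 := by positivity
    gcongr
    linarith

noncomputable def mollifier (n : ℕ) : Plane → ℝ := (bump n).normed volume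

section Mollify
variable {E : Type*} [NormedAddCommGroup E] [NormedSpace ℝ E]

noncomputable def mollify (n : ℕ) (f : Plane → E) : Plane → E :=
  convolution (mollifier n) f (ContinuousLinearMap.lsmul ℝ ℝ) volume

theorem tendsto_bump_rOut : Tendsto (fun n => (bump n).rOut) atTop (𝓝 0) :=
  tendsto_one_div_add_atTop_nhds_zero_nat

theorem contDiff_mollifier (n : ℕ) : ContDiff ℝ ∞ (mollifier n) := (bump n).contDiff_normed

theorem hasCompactSupport_mollifier (n : ℕ) : HasCompactSupport (mollifier n) :=
  (bump n).hasCompactSupport_normed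

theorem mollifier_nonneg (n : ℕ) (x : Plane) : 0 ≤ mollifier n x := (bump n).nonneg_normed x

theorem isTest_mollifier_sub (n : ℕ) (x : Plane) : IsTest (fun y => mollifier n (x - y)) :=
  ⟨(contDiff_mollifier n).comp (contDiff_const.sub contDiff_id),
    (hasCompactSupport_mollifier n).comp_homeomorph (Homeomorph.subLeft x)⟩

theorem contDiff_mollify (n : ℕ) {f : Plane → E} (hf : LocallyIntegrable f) :
    ContDiff ℝ ∞ (mollify n f) := by
  have := (hasCompactSupport_mollifier n).contDiff_convolution_left (n := ⊤)
    (ContinuousLinearMap.lsmul ℝ ℝ) (contDiff_mollifier n) hf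
  exact this

theorem mollify_eq (n : ℕ) (f : Plane → E) (x : Plane) :
    mollify n f x = ∫ y, mollifier n (x - y) • f y := by
  rw [mollify, convolution_eq_swap]
  rfl

/-- The derivatives of a mollified function. -/
theorem fderiv_mollify (n : ℕ) {f : Plane → E} (hf : LocallyIntegrable f) (x : Plane) (j : Fin 2) :
    fderiv ℝ (mollify n f) x (EuclideanSpace.single j 1)
      = -∫ y, partialDeriv j (fun y => mollifier n (x - y)) y • f y := by
  have h1 : ContDiff ℝ 1 (mollifier n) := (contDiff_mollifier n).of_le (by exact_mod_cast le_top)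
  have h := (hasCompactSupport_mollifier n).hasFDerivAt_convolution_left
    (ContinuousLinearMap.lsmul ℝ ℝ) h1 hf x
  have hI := ((((hasCompactSupport_mollifier n).fderiv (𝕜 := ℝ)).convolutionExists_left
    ((ContinuousLinearMap.lsmul ℝ ℝ).precompL Plane)
    (h1.continuous_fderiv one_ne_zero) hf x).integrable_swap)
  rw [show fderiv ℝ (mollify n f) x = _ from h.fderiv, convolution_eq_swap,
    ContinuousLinearMap.integral_apply hI, ← integral_neg]
  congr 1
  funext y
  have e : fderiv ℝ (fun y => mollifier n (x - y)) y = -fderiv ℝ (mollifier n) (x - y) := by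
    have := (h1.differentiable one_ne_zero (x - y)).hasFDerivAt.comp y
      ((hasFDerivAt_id (𝕜 := ℝ) y).const_sub x)
    refine this.fderiv.trans ?_
    ext v
    simp
  simp [partialDeriv, e, ContinuousLinearMap.precompL_apply]

/-- Lebesgue differentiation; it requires the ratio of outer to inner radius of the bumps to stay
bounded, and here that ratio is 2. -/
theorem ae_tendsto_mollify {f : Plane → E} [CompleteSpace E] (hf : LocallyIntegrable f) :
    ∀ᵐ x, Tendsto (fun n => mollify n f x) atTop (𝓝 (f x)) :=
  ContDiffBump.ae_convolution_tendsto_right_of_locallyIntegrable (φ := bump) (K := 2)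
    tendsto_bump_rOut (Eventually.of_forall fun n => by
      change (1 : ℝ) / (n + 1) ≤ 2 * (1 / (2 * (n + 1)))
      apply le_of_eq
      field_simp) hf

theorem lintegral_mollifier (n : ℕ) : ∫⁻ y, ENNReal.ofReal (mollifier n y) = 1 := by
  have h1 : ∫ y, mollifier n y = 1 := (bump n).integral_normed
  have h2 : Integrable (mollifier n) := (bump n).integrable_normed
  rw [← ofReal_integral_eq_lintegral_ofReal h2 (Eventually.of_forall (mollifier_nonneg n)), h1,
    ENNReal.ofReal_one]

theorem integral_mollifier_sub (n : ℕ) (x : Plane) : ∫ y, mollifier n (x - y) = 1 := by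
  rw [integral_sub_left_eq_self (mollifier n)]
  exact (bump n).integral_normed

theorem integrable_mollifier_sub (n : ℕ) (x : Plane) :
    Integrable (fun y => mollifier n (x - y)) :=
  (bump n).integrable_normed.comp_sub_left x

theorem norm_mollify_le (n : ℕ) {f : Plane → E} {C : ℝ} (hf : ∀ᵐ x, ‖f x‖ ≤ C) (x : Plane) :
    ‖mollify n f x‖ ≤ C := by
  rw [mollify_eq]
  calc _ ≤ ∫ y, mollifier n (x - y) * C := by
        refine norm_integral_le_of_norm_le ((integrable_mollifier_sub n x).mul_const C) ?_
        filter_upwards [hf] with y hy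
        rw [norm_smul, Real.norm_of_nonneg (mollifier_nonneg n _)]
        exact mul_le_mul_of_nonneg_left hy (mollifier_nonneg n _)
    _ = C := by rw [integral_mul_const, integral_mollifier_sub, one_mul]

/-- The mollifier averages over a ball of radius 1/(n + 1). Applied to the Lipschitz potential h,
this gives uniform convergence on the whole plane. -/
theorem norm_mollify_sub_le [CompleteSpace E] (n : ℕ) {f : Plane → E} {C : ℝ} (hC : 0 ≤ C)
    (hf : Continuous f) (hL : ∀ x y, ‖f x - f y‖ ≤ C * ‖x - y‖) (x : Plane) :
    ‖mollify n f x - f x‖ ≤ C * (1 / (n + 1)) := by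
  rw [← dist_eq_norm]
  refine ContDiffBump.dist_normed_convolution_le hf.aestronglyMeasurable fun y hy => ?_
  rw [dist_eq_norm]
  refine (hL y x).trans ?_
  have : ‖y - x‖ ≤ 1 / (n + 1) := by
    rw [← dist_eq_norm]; exact hy.le
  gcongr

/-- Jensen's inequality: the mollifier is the density of a probability measure, for which the L¹
norm is at most the L² norm. -/
theorem enorm_mollify_sq_le (n : ℕ) {f : Plane → E} (hf : AEStronglyMeasurable f) (x : Plane) :
    ‖mollify n f x‖ₑ ^ (2 : ℝ)
      ≤ ∫⁻ y, ENNReal.ofReal (mollifier n y) * ‖f (x - y)‖ₑ ^ (2 : ℝ) := by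
  have hηm : Measurable (fun y => ENNReal.ofReal (mollifier n y)) :=
    (contDiff_mollifier n).continuous.measurable.ennreal_ofReal
  set ν : Measure Plane := volume.withDensity fun y => ENNReal.ofReal (mollifier n y) with hν
  have hprob : IsProbabilityMeasure ν := by
    constructor
    rw [hν, withDensity_apply _ MeasurableSet.univ, Measure.restrict_univ, lintegral_mollifier]
  have hfx : AEStronglyMeasurable (fun y => f (x - y)) volume :=
    hf.comp_measurePreserving (Measure.measurePreserving_sub_left volume x)
  have hfν : AEStronglyMeasurable (fun y => f (x - y)) ν :=
    hfx.mono_ac (withDensity_absolutelyContinuous _ _)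
  have h1 : ‖mollify n f x‖ₑ ≤ eLpNorm (fun y => f (x - y)) 1 ν := by
    rw [eLpNorm_one_eq_lintegral_enorm, hν,
      lintegral_withDensity_eq_lintegral_mul₀ hηm.aemeasurable hfx.enorm]
    refine (enorm_integral_le_lintegral_enorm _).trans_eq ?_
    congr 1
    funext y
    change ‖mollifier n y • f (x - y)‖ₑ = _
    rw [enorm_smul, Real.enorm_of_nonneg (mollifier_nonneg n y)]
    rfl
  have h2 := h1.trans (eLpNorm_le_eLpNorm_of_exponent_le (p := 1) (q := 2) (by norm_num) hfν)
  calc ‖mollify n f x‖ₑ ^ (2 : ℝ) ≤ (eLpNorm (fun y => f (x - y)) 2 ν) ^ (2 : ℝ) := by gcongr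
    _ = ∫⁻ y, ‖f (x - y)‖ₑ ^ (2 : ℝ) ∂ν := by
        have := eLpNorm_nnreal_pow_eq_lintegral (μ := ν) (f := fun y => f (x - y))
          (p := 2) (by norm_num)
        simpa using this
    _ = _ := by
        rw [hν, lintegral_withDensity_eq_lintegral_mul₀ hηm.aemeasurable (hfx.enorm.pow_const _)]
        rfl

/-- Mollification is a contraction of `L²`. -/
theorem eLpNorm_mollify_le (n : ℕ) {f : Plane → E} (hf : AEStronglyMeasurable f) :
    eLpNorm (mollify n f) 2 volume ≤ eLpNorm f 2 volume := by
  have hsq : ∀ g : Plane → E, eLpNorm g 2 volume ^ (2 : ℝ) = ∫⁻ x, ‖g x‖ₑ ^ (2 : ℝ) := fun g => by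
    have := eLpNorm_nnreal_pow_eq_lintegral (μ := volume) (f := g) (p := 2) (by norm_num)
    simpa using this
  rw [← ENNReal.rpow_le_rpow_iff (z := 2) (by norm_num), hsq, hsq]
  have hηm : Measurable (fun y => ENNReal.ofReal (mollifier n y)) :=
    (contDiff_mollifier n).continuous.measurable.ennreal_ofReal
  have hm : AEMeasurable (fun p : Plane × Plane => ENNReal.ofReal (mollifier n p.2)
      * ‖f (p.1 - p.2)‖ₑ ^ (2 : ℝ)) (volume.prod volume) :=
    (hηm.comp measurable_snd).aemeasurable.mul
      ((hf.comp_quasiMeasurePreserving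
        (quasiMeasurePreserving_sub_of_right_invariant volume volume)).enorm.pow_const _)
  calc _ ≤ ∫⁻ x, ∫⁻ y, ENNReal.ofReal (mollifier n y) * ‖f (x - y)‖ₑ ^ (2 : ℝ) :=
        lintegral_mono (enorm_mollify_sq_le n hf)
    _ = ∫⁻ y, ∫⁻ x, ENNReal.ofReal (mollifier n y) * ‖f (x - y)‖ₑ ^ (2 : ℝ) :=
        lintegral_lintegral_swap hm
    _ = ∫⁻ y, ENNReal.ofReal (mollifier n y) * ∫⁻ x, ‖f x‖ₑ ^ (2 : ℝ) := by
        congr 1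
        funext y
        rw [lintegral_const_mul' _ _ ENNReal.ofReal_ne_top,
          lintegral_sub_right_eq_self (fun x => ‖f x‖ₑ ^ (2 : ℝ))]
    _ = ∫⁻ x, ‖f x‖ₑ ^ (2 : ℝ) := by
        rw [lintegral_mul_const _ hηm, lintegral_mollifier, one_mul]

theorem mollify_sub (n : ℕ) {f g : Plane → E} (hf : LocallyIntegrable f)
    (hg : LocallyIntegrable g) : mollify n (f - g) = mollify n f - mollify n g := by
  have hI : ∀ {f : Plane → E}, LocallyIntegrable f → ∀ x,
      Integrable (fun y => mollifier n (x - y) • f y) := fun hf x =>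
    ((hasCompactSupport_mollifier n).convolutionExists_left (ContinuousLinearMap.lsmul ℝ ℝ)
      (contDiff_mollifier n).continuous hf x).integrable_swap
  funext x
  simp only [mollify_eq, Pi.sub_apply, smul_sub]
  exact integral_sub (hI hf x) (hI hg x)

theorem tendsto_eLpNorm_mollify_sub_of_contDiff [CompleteSpace E] {g : Plane → E}
    (hg : ContDiff ℝ ∞ g) (hc : HasCompactSupport g) :
    Tendsto (fun n => eLpNorm (mollify n g - g) 2 volume) atTop (𝓝 0) := by
  obtain ⟨R, hR, hsupp⟩ := hc.exists_norm_lt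
  obtain ⟨C, hC⟩ := (hc.fderiv (𝕜 := ℝ)).exists_bound_of_continuous
    (hg.continuous_fderiv (by simp))
  have hC0 : 0 ≤ C := (norm_nonneg _).trans (hC 0)
  have hL : ∀ x y, ‖g x - g y‖ ≤ C * ‖x - y‖ := fun x y =>
    Convex.norm_image_sub_le_of_norm_fderiv_le
      (fun z _ => hg.differentiable (by simp) z) (fun z _ => hC z) convex_univ
      (mem_univ y) (mem_univ x)
  have hsuppm : ∀ n, ∀ x, x ∉ Metric.closedBall (0 : Plane) (R + 1) → mollify n g x = 0 := by
    intro n x hx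
    have hx' : R + 1 < ‖x‖ := by simpa using hx
    rw [mollify_eq]
    refine integral_eq_zero_of_ae (Eventually.of_forall fun y => ?_)
    rcases le_total R ‖y‖ with h | h
    · simp [hsupp y h]
    · have : mollifier n (x - y) = 0 := by
        have hns : x - y ∉ Function.support (mollifier n) := by
          rw [mollifier, ContDiffBump.support_normed_eq, mem_ball_zero_iff, not_lt]
          have h1 : (bump n).rOut ≤ 1 := by
            change (1 : ℝ) / (n + 1) ≤ 1
            rw [div_le_one (by positivity)]
            linarith [(Nat.cast_nonneg n : (0:ℝ) ≤ n)]
          have := norm_sub_norm_le x y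
          linarith
        simpa using hns
      simp [this]
  have hbd : ∀ n : ℕ, eLpNorm (mollify n g - g) 2 volume ≤
      ENNReal.ofReal (C * (1 / (n + 1)))
        * volume (Metric.closedBall (0 : Plane) (R + 1)) ^ (1 / (2 : ℝ≥0∞).toReal) := by
    intro n
    refine eLpNorm_sub_le_of_dist_bdd volume (by norm_num)
      Metric.isClosed_closedBall.measurableSet (by positivity) (fun x => ?_) ?_ ?_
    · rw [dist_eq_norm]
      exact norm_mollify_sub_le n hC0 hg.continuous hL x
    · exact Function.support_subset_iff'.2 (hsuppm n)
    · refine Function.support_subset_iff'.2 fun x hx => hsupp x ?_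
      have hx' : R + 1 < ‖x‖ := by simpa using hx
      linarith
  refine tendsto_of_tendsto_of_tendsto_of_le_of_le tendsto_const_nhds ?_ (fun _ => zero_le) hbd
  have h1 : Tendsto (fun n : ℕ => ENNReal.ofReal (C * (1 / (n + 1)))) atTop (𝓝 0) := by
    have := (tendsto_one_div_add_atTop_nhds_zero_nat (𝕜 := ℝ)).const_mul C
    rw [mul_zero] at this
    simpa using (ENNReal.tendsto_ofReal this)
  have h2 : volume (Metric.closedBall (0 : Plane) (R + 1)) ^ (1 / (2 : ℝ≥0∞).toReal) ≠ ⊤ :=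
    ENNReal.rpow_ne_top_of_nonneg (by positivity) measure_closedBall_lt_top.ne
  simpa using ENNReal.Tendsto.mul_const h1 (Or.inr h2)

/-- Mollification converges in `L²`. -/
theorem tendsto_eLpNorm_mollify_sub [CompleteSpace E] {f : Plane → E} (hf : MemLp f 2 volume) :
    Tendsto (fun n => eLpNorm (mollify n f - f) 2 volume) atTop (𝓝 0) := by
  rw [ENNReal.tendsto_nhds_zero]
  intro ε hε
  obtain ⟨δ, hδ0, hδ⟩ : ∃ δ : ℝ, 0 < δ ∧ ENNReal.ofReal δ ≤ ε / 3 := by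
    have h3 : ε / 3 ≠ 0 := (ENNReal.div_pos hε.ne' (by norm_num)).ne'
    obtain ⟨d, hd0, hd⟩ := ENNReal.lt_iff_exists_nnreal_btwn.1 (pos_iff_ne_zero.2 h3)
    exact ⟨d, by exact_mod_cast hd0, by simpa using hd.le⟩
  obtain ⟨g, hgc, hgs, hg⟩ := hf.exist_eLpNorm_sub_le (by norm_num) (by norm_num) hδ0
  have hgL : MemLp g 2 volume := hgs.continuous.memLp_of_hasCompactSupport hgc
  have hfl : LocallyIntegrable f := hf.locallyIntegrable (by norm_num)
  have hgl : LocallyIntegrable g := hgL.locallyIntegrable (by norm_num)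
  have h3 : (0 : ℝ≥0∞) < ε / 3 := ENNReal.div_pos hε.ne' (by norm_num)
  filter_upwards [(ENNReal.tendsto_nhds_zero.1
    (tendsto_eLpNorm_mollify_sub_of_contDiff hgs hgc)) _ h3] with n hn
  have e : mollify n f - f = mollify n (f - g) + (mollify n g - g) - (f - g) := by
    rw [mollify_sub n hfl hgl]; abel
  have m1 : AEStronglyMeasurable (mollify n (f - g)) :=
    (contDiff_mollify n (hfl.sub hgl)).continuous.aestronglyMeasurable
  have m2 : AEStronglyMeasurable (mollify n g - g) :=
    ((contDiff_mollify n hgl).continuous.sub hgs.continuous).aestronglyMeasurable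
  have m3 : AEStronglyMeasurable (f - g) := hf.aestronglyMeasurable.sub hgL.aestronglyMeasurable
  rw [e]
  calc _ ≤ eLpNorm (mollify n (f - g) + (mollify n g - g)) 2 volume + eLpNorm (f - g) 2 volume :=
        eLpNorm_sub_le (m1.add m2) m3 (by norm_num)
    _ ≤ (eLpNorm (mollify n (f - g)) 2 volume + eLpNorm (mollify n g - g) 2 volume)
        + eLpNorm (f - g) 2 volume := by
        gcongr; exact eLpNorm_add_le m1 m2 (by norm_num)
    _ ≤ ε / 3 + ε / 3 + ε / 3 := by
        gcongr
        · exact (eLpNorm_mollify_le n m3).trans (hg.trans hδ)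
        · exact hg.trans hδ
    _ = ε := ENNReal.add_thirds ε

end Mollify

end PauliHardy

/-! ### The gauge transformation -/

namespace PauliHardy
open Set Filter Topology ComplexConjugate

theorem fderiv_mollify_of_weak {E : Type*} [NormedAddCommGroup E] [NormedSpace ℝ E] (n : ℕ)
    {f g : Plane → E} {j : Fin 2} (hf : LocallyIntegrable f)
    (hw : ∀ φ : Plane → ℝ, IsTest φ → ∫ x, partialDeriv j φ x • f x = -∫ x, φ x • g x)
    (x : Plane) : fderiv ℝ (mollify n f) x (EuclideanSpace.single j 1) = mollify n g x := by
  rw [fderiv_mollify n hf, hw _ (isTest_mollifier_sub n x), neg_neg, mollify_eq]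

theorem continuous_scalarPotential {B : Plane → ℝ} (hB : AdmissibleField B) :
    Continuous (scalarPotential B) := hB.differentiable_scalarPotential.continuous

theorem abs_partialDeriv_le (f : Plane → ℝ) (j : Fin 2) (x : Plane) :
    |partialDeriv j f x| ≤ ‖fderiv ℝ f x‖ := by
  refine (le_trans ((fderiv ℝ f x).le_opNorm _) ?_)
  simp

theorem measurable_partialDeriv (f : Plane → ℝ) (j : Fin 2) : Measurable (partialDeriv j f) :=
  measurable_fderiv_apply_const ℝ _ _

theorem AdmissibleField.weak_grad_scalarPotential {B : Plane → ℝ} (hB : AdmissibleField B)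
    (j : Fin 2) {φ : Plane → ℝ} (hφ : IsTest φ) :
    ∫ x, partialDeriv j φ x • scalarPotential B x
      = -∫ x, φ x • partialDeriv j (scalarPotential B) x := by
  obtain ⟨C, hC0, hC⟩ := hB.exists_norm_fderiv_scalarPotential_le
  have hc := continuous_scalarPotential hB
  have hd := hφ.continuous_partialDeriv j
  have hφc := hφ.smooth.continuous
  have h1 : Integrable (fun x => φ x * partialDeriv j (scalarPotential B) x) :=
    (hφc.integrable_of_hasCompactSupport hφ.compact).mul_bdd (c := C)
      (measurable_partialDeriv _ _).aestronglyMeasurable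
      (Eventually.of_forall fun x => (abs_partialDeriv_le _ _ x).trans (hC x))
  have h2 : Integrable (fun x => partialDeriv j φ x * scalarPotential B x) :=
    (hd.mul hc).integrable_of_hasCompactSupport (hφ.hasCompactSupport_partialDeriv j).mul_right
  have h3 : Integrable (fun x => φ x * scalarPotential B x) :=
    (hφc.mul hc).integrable_of_hasCompactSupport hφ.compact.mul_right
  have := integral_mul_fderiv_eq_neg_fderiv_mul_of_integrable (μ := (volume : Measure Plane))
    (f := φ) (g := scalarPotential B) (v := EuclideanSpace.single j 1) h2 h1 h3
    (fun x _ => hφ.smooth.differentiable (by simp) x)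
    (fun x _ => hB.differentiable_scalarPotential x)
  simp only [smul_eq_mul]
  rw [eq_neg_iff_add_eq_zero, add_comm, ← eq_neg_iff_add_eq_zero]
  exact this

theorem IsBoundedPotential.exists_bound {B : Plane → ℝ} {A : Plane → Plane}
    (hA : IsBoundedPotential B A) : ∃ C : ℝ, ∀ j : Fin 2, ∀ᵐ x, ‖A x j‖ ≤ C := by
  have hC : ∀ᵐ x, ‖A x‖ ≤ (eLpNorm A ∞ volume).toReal := by
    filter_upwards [ae_le_eLpNormEssSup (f := A) (μ := volume)] with x hx
    rw [← eLpNorm_exponent_top] at hx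
    simpa using ENNReal.toReal_mono hA.bounded.eLpNorm_ne_top hx
  exact ⟨_, fun j => hC.mono fun x hx => (PiLp.norm_apply_le (A x) j).trans hx⟩

theorem IsBoundedPotential.aestronglyMeasurable {B : Plane → ℝ} {A : Plane → Plane}
    (hA : IsBoundedPotential B A) (j : Fin 2) : AEStronglyMeasurable (fun x => A x j) :=
  (EuclideanSpace.proj (𝕜 := ℝ) j).continuous.comp_aestronglyMeasurable
    hA.bounded.aestronglyMeasurable

theorem IsBoundedPotential.memLp_top {B : Plane → ℝ} {A : Plane → Plane}
    (hA : IsBoundedPotential B A) (j : Fin 2) : MemLp (fun x => A x j) ∞ volume := by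
  obtain ⟨C, hC⟩ := hA.exists_bound
  exact memLp_top_of_bound (hA.aestronglyMeasurable j) C (hC j)

theorem IsBoundedPotential.locallyIntegrable {B : Plane → ℝ} {A : Plane → Plane}
    (hA : IsBoundedPotential B A) (j : Fin 2) : LocallyIntegrable (fun x => A x j) :=
  (hA.memLp_top j).locallyIntegrable le_top

theorem IsBoundedPotential.integrable_mul {B : Plane → ℝ} {A : Plane → Plane}
    (hA : IsBoundedPotential B A) (j : Fin 2) {f : Plane → ℝ} (hf : Integrable f) :
    Integrable (fun x => A x j * f x) := by
  obtain ⟨C, hC⟩ := hA.exists_bound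
  exact hf.bdd_mul (hA.aestronglyMeasurable j) (hC j)

theorem IsTest.integrable_partialDeriv {φ : Plane → ℝ} (hφ : IsTest φ) (j : Fin 2) :
    Integrable (partialDeriv j φ) :=
  (hφ.continuous_partialDeriv j).integrable_of_hasCompactSupport
    (hφ.hasCompactSupport_partialDeriv j)

theorem fderiv_clm_symm_of_curl_eq_zero {a₀ a₁ : Plane → ℝ} {x : Plane}
    (h₀ : DifferentiableAt ℝ a₀ x) (h₁ : DifferentiableAt ℝ a₁ x)
    (hcurl : fderiv ℝ a₁ x (EuclideanSpace.single 0 1)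
      = fderiv ℝ a₀ x (EuclideanSpace.single 1 1)) (u v : Plane) :
    fderiv ℝ (fun y => a₀ y • EuclideanSpace.proj (𝕜 := ℝ) (0 : Fin 2)
        + a₁ y • EuclideanSpace.proj (𝕜 := ℝ) (1 : Fin 2)) x u v
      = fderiv ℝ (fun y => a₀ y • EuclideanSpace.proj (𝕜 := ℝ) (0 : Fin 2)
        + a₁ y • EuclideanSpace.proj (𝕜 := ℝ) (1 : Fin 2)) x v u := by
  have h := (h₀.hasFDerivAt.smul_const (EuclideanSpace.proj (𝕜 := ℝ) (0 : Fin 2))).fun_add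
    (h₁.hasFDerivAt.smul_const (EuclideanSpace.proj (𝕜 := ℝ) (1 : Fin 2)))
  rw [h.fderiv]
  simp only [add_apply, ContinuousLinearMap.smulRight_apply, smul_apply, smul_eq_mul,
    PiLp.proj_apply]
  rw [clm_apply_plane (fderiv ℝ a₀ x) u, clm_apply_plane (fderiv ℝ a₀ x) v,
    clm_apply_plane (fderiv ℝ a₁ x) u, clm_apply_plane (fderiv ℝ a₁ x) v, hcurl]
  simp only [smul_eq_mul]
  ring

/-- A smooth curl-free field on the plane is a gradient. -/
theorem exists_potential_of_curl_eq_zero {a₀ a₁ : Plane → ℝ} (h₀ : ContDiff ℝ 1 a₀)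
    (h₁ : ContDiff ℝ 1 a₁)
    (hcurl : ∀ x, fderiv ℝ a₁ x (EuclideanSpace.single 0 1)
      = fderiv ℝ a₀ x (EuclideanSpace.single 1 1)) :
    ∃ φ : Plane → ℝ, ContDiff ℝ 2 φ ∧ ∀ x, fderiv ℝ φ x (EuclideanSpace.single 0 1) = a₀ x ∧
      fderiv ℝ φ x (EuclideanSpace.single 1 1) = a₁ x := by
  set Ω : Plane → Plane →L[ℝ] ℝ := fun y => a₀ y • EuclideanSpace.proj (𝕜 := ℝ) (0 : Fin 2)
        + a₁ y • EuclideanSpace.proj (𝕜 := ℝ) (1 : Fin 2) with hΩ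
  have hΩc : ContDiff ℝ 1 Ω := by fun_prop
  obtain ⟨φ, hφ⟩ := convex_univ.exists_forall_hasFDerivAt_of_fderiv_symmetric isOpen_univ
    (hΩc.differentiable one_ne_zero).differentiableOn fun x _ u v =>
      fderiv_clm_symm_of_curl_eq_zero (h₀.differentiable one_ne_zero x)
        (h₁.differentiable one_ne_zero x) (hcurl x) u v
  have hfd : fderiv ℝ φ = Ω := funext fun x => (hφ x (mem_univ x)).fderiv
  refine ⟨φ, ?_, fun x => ?_⟩
  · rw [show (2 : WithTop ℕ∞) = 1 + 1 from one_add_one_eq_two.symm, contDiff_succ_iff_fderiv]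
    refine ⟨fun x => (hφ x (mem_univ x)).differentiableAt, by simp, ?_⟩
    rwa [hfd]
  · rw [hfd]
    simp [hΩ]

/-- Complex gauge function of a mollified potential. -/
theorem IsBoundedPotential.exists_gauge {B : Plane → ℝ} (hB : AdmissibleField B)
    {A : Plane → Plane} (hA : IsBoundedPotential B A) (n : ℕ) :
    ∃ F : Plane → ℂ, ContDiff ℝ 2 F ∧ (∀ x, (F x).re = mollify n (scalarPotential B) x) ∧
      ∀ x, Complex.I * dz F x = ((mollify n (fun x => A x 0) x : ℝ) : ℂ)
        - Complex.I * ((mollify n (fun x => A x 1) x : ℝ) : ℂ) := by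
  have hh := hB.isBoundedPotential
  set h := scalarPotential B with hhdef
  have hhl : LocallyIntegrable h := (continuous_scalarPotential hB).locallyIntegrable
  have hH : ∀ j x, fderiv ℝ (mollify n h) x (EuclideanSpace.single j 1)
      = mollify n (partialDeriv j h) x := fun j x =>
    fderiv_mollify_of_weak n hhl (fun φ hφ => hB.weak_grad_scalarPotential j hφ) x
  set V := vectorPotential B with hV
  have hl : ∀ j : Fin 2, LocallyIntegrable ((fun x => A x j) - fun x => V x j) := fun j =>
    (hA.locallyIntegrable j).sub (hh.locallyIntegrable j)
  have hs : ∀ j : Fin 2, ContDiff ℝ ∞ (mollify n ((fun x => A x j) - fun x => V x j)) :=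
    fun j => contDiff_mollify n (hl j)
  have hs1 : ∀ j : Fin 2, ContDiff ℝ 1 (mollify n ((fun x => A x j) - fun x => V x j)) :=
    fun j => (hs j).of_le (by exact_mod_cast le_top)
  -- Both A and A_h have distributional curl B. Testing the two curl equations with y ↦ η_n(x - y),
  -- where η_n is the mollifier, shows that the mollified difference is classically curl-free.
  obtain ⟨φ, hφc, hφ⟩ := exists_potential_of_curl_eq_zero (hs1 0) (hs1 1) (fun x => by
    rw [fderiv_mollify n (hl 1), fderiv_mollify n (hl 0), neg_inj]
    have ht := isTest_mollifier_sub n x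
    set ψ : Plane → ℝ := fun y => mollifier n (x - y)
    have c1 := hA.curl_eq ψ ht
    have c2 := hh.curl_eq ψ ht
    have I1 := fun i j => hA.integrable_mul i (ht.integrable_partialDeriv j)
    have I2 := fun i j => hh.integrable_mul i (ht.integrable_partialDeriv j)
    rw [integral_sub (I1 0 1) (I1 1 0)] at c1
    rw [integral_sub (I2 0 1) (I2 1 0)] at c2
    have e : ∀ i j : Fin 2, ∫ y, partialDeriv j ψ y • ((fun x => A x i) - fun x => V x i) y
        = (∫ y, A y i * partialDeriv j ψ y) - ∫ y, V y i * partialDeriv j ψ y := fun i j => by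
      rw [← integral_sub (I1 i j) (I2 i j)]
      congr 1; funext y; simp; ring
    rw [e, e]
    linarith)
  have hhc : ContDiff ℝ 2 (mollify n h) :=
    mod_cast contDiff_infty.1 (contDiff_mollify n hhl) 2
  have hFc : ContDiff ℝ 2 (fun x => ((mollify n h x : ℝ) : ℂ) - Complex.I * (φ x : ℂ)) :=
    (Complex.ofRealCLM.contDiff.comp hhc).sub
      (contDiff_const.mul (Complex.ofRealCLM.contDiff.comp hφc))
  -- With h_n the mollified h, i∂h_n = ∂₁h_n + i∂₀h_n is the combination (component 0) - i
  -- (component 1) of the mollified A_h, while i∂(-iφ) = ∂₀φ - i∂₁φ contributes the mollified A -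
  -- A_h.
  refine ⟨fun x => ((mollify n h x : ℝ) : ℂ) - Complex.I * (φ x : ℂ), hFc, fun x => by simp, fun x => ?_⟩
  have hfd : ∀ v : Plane, fderiv ℝ (fun x => ((mollify n h x : ℝ) : ℂ) - Complex.I * (φ x : ℂ)) x v
      = (fderiv ℝ (mollify n h) x v : ℂ) - Complex.I * (fderiv ℝ φ x v : ℂ) := by
    intro v
    have k1 := (Complex.ofRealCLM.hasFDerivAt (x := mollify n h x)).comp x
      (hhc.differentiable (by norm_num) x).hasFDerivAt
    have k2 := ((Complex.ofRealCLM.hasFDerivAt (x := φ x)).comp x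
      (hφc.differentiable (by norm_num) x).hasFDerivAt).const_mul Complex.I
    have := (k1.sub k2).fderiv
    exact (congrArg (fun L : Plane →L[ℝ] ℂ => L v) this).trans (by simp)
  have m : ∀ j, mollify n ((fun x => A x j) - fun x => V x j) x
      = mollify n (fun x => A x j) x - mollify n (fun x => V x j) x := fun j => by
    rw [mollify_sub n (hA.locallyIntegrable j) (hh.locallyIntegrable j)]; rfl
  have v0 : mollify n (fun x => V x 0) x = mollify n (partialDeriv 1 h) x := by
    congr 1
  have v1 : mollify n (fun x => V x 1) x = -mollify n (partialDeriv 0 h) x := by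
    rw [mollify_eq, mollify_eq, ← integral_neg]
    congr 1; funext y; simp [hV, vectorPotential]; exact Or.inl rfl
  rw [dz, hfd, hfd, (hφ x).1, (hφ x).2, hH, hH, m, m, v0, v1]
  push_cast
  linear_combination (-((mollify n (fun x => A x 0) x : ℝ) : ℂ) + ((mollify n (partialDeriv 1 h) x : ℝ) : ℂ)
    - ((mollify n (partialDeriv 1 h) x : ℝ) : ℂ)
    + Complex.I * (((mollify n (fun x => A x 1) x : ℝ) : ℂ) + ((mollify n (partialDeriv 0 h) x : ℝ) : ℂ))
    ) * Complex.I_sq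

/-- `(P₁ - i P₂) u` for `P = i∇ + a`. -/
noncomputable def pauliOp (a : Fin 2 → Plane → ℝ) (u : Plane → ℂ) (Du : Fin 2 → Plane → ℂ) (x : Plane) : ℂ :=
  (Complex.I * Du 0 x + (a 0 x : ℂ) * u x)
    - Complex.I * (Complex.I * Du 1 x + (a 1 x : ℂ) * u x)

/-- The classical gradient of a complex function. -/
noncomputable def cgrad (u : Plane → ℂ) (j : Fin 2) (x : Plane) : ℂ :=
  fderiv ℝ u x (EuclideanSpace.single j 1)

/-- By the product rule e^F intertwines i∂ with P₀ - iP₁. The imaginary part of F affects only the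
phase, so only Re F enters the weights. -/
theorem norm_dz_exp_mul {F u : Plane → ℂ} {a : Fin 2 → Plane → ℝ} (hF : ContDiff ℝ 2 F)
    (hu : ContDiff ℝ 2 u) (x : Plane)
    (hFa : Complex.I * dz F x = (a 0 x : ℂ) - Complex.I * (a 1 x : ℂ)) :
    ‖dz (fun x => Complex.exp (F x) * u x) x‖
      = Real.exp (F x).re * ‖pauliOp a u (cgrad u) x‖ := by
  have hFd := (hF.differentiable (by norm_num) x).hasFDerivAt
  have hud := (hu.differentiable (by norm_num) x).hasFDerivAt
  have hd := (hFd.cexp.mul hud).fderiv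
  have hv : ∀ v, fderiv ℝ (fun x => Complex.exp (F x) * u x) x v
      = Complex.exp (F x) * fderiv ℝ u x v + u x * (Complex.exp (F x) * fderiv ℝ F x v) := by
    intro v
    exact (congrArg (fun L : Plane →L[ℝ] ℂ => L v) hd).trans (by simp)
  have e : Complex.I * dz (fun x => Complex.exp (F x) * u x) x
      = Complex.exp (F x) * pauliOp a u (cgrad u) x := by
    simp only [dz] at hFa
    rw [dz, hv, hv, pauliOp, cgrad, cgrad]
    linear_combination Complex.exp (F x) * u x * hFa
  have := congrArg norm e
  rwa [norm_mul, norm_mul, Complex.norm_I, one_mul, Complex.norm_exp] at this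

end PauliHardy

/-! ### The lower bound for smooth compactly supported functions -/

namespace PauliHardy
open Set Filter Topology ComplexConjugate

theorem continuous_cgrad {u : Plane → ℂ} (hu : ContDiff ℝ 2 u) (j : Fin 2) :
    Continuous (cgrad u j) :=
  (hu.continuous_fderiv (by norm_num)).clm_apply continuous_const

theorem hasCompactSupport_cgrad {u : Plane → ℂ} (hc : HasCompactSupport u) (j : Fin 2) :
    HasCompactSupport (cgrad u j) := hc.fderiv_apply (𝕜 := ℝ) _

theorem pauliOp_eq_zero {a : Fin 2 → Plane → ℝ} {u : Plane → ℂ} {Du : Fin 2 → Plane → ℂ}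
    {x : Plane} (h0 : u x = 0) (h1 : ∀ j, Du j x = 0) : pauliOp a u Du x = 0 := by
  simp [pauliOp, h0, h1]

theorem norm_pauliOp_le {a : Fin 2 → Plane → ℝ} {u : Plane → ℂ} {Du : Fin 2 → Plane → ℂ}
    {x : Plane} {C : ℝ} (ha : ∀ j, ‖a j x‖ ≤ C) :
    ‖pauliOp a u Du x‖ ≤ ‖Du 0 x‖ + ‖Du 1 x‖ + 2 * C * ‖u x‖ := by
  have h : ∀ j, ‖Complex.I * Du j x + (a j x : ℂ) * u x‖ ≤ ‖Du j x‖ + C * ‖u x‖ := fun j => by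
    refine (norm_add_le _ _).trans ?_
    rw [norm_mul, norm_mul, Complex.norm_I, one_mul, Complex.norm_real]
    gcongr
    exact ha j
  refine (norm_sub_le _ _).trans ?_
  rw [norm_mul, Complex.norm_I, one_mul]
  linarith [h 0, h 1]

theorem continuous_pauliOp {a : Fin 2 → Plane → ℝ} {u : Plane → ℂ} {Du : Fin 2 → Plane → ℂ}
    (ha : ∀ j, Continuous (a j)) (hu : Continuous u) (hD : ∀ j, Continuous (Du j)) :
    Continuous (pauliOp a u Du) := by
  have h0 := ha 0
  have h1 := ha 1
  have d0 := hD 0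
  have d1 := hD 1
  unfold pauliOp
  fun_prop

/-- `radial_hardy` is applied to v = e^F u, where |e^F| is the exponential of the mollified h,
whereas k and K refer to h itself. The discrepancy costs e^{2δ} in each of the two comparisons of
squared weights, hence e^{-4δ} in total. -/
theorem hardy_lower_bound_mollified {B : Plane → ℝ} (hB : AdmissibleField B)
    (hα : 1 ≤ flux B) {A : Plane → Plane} (hA : IsBoundedPotential B A) {ρ : ℝ} (hρ : 0 < ρ)
    {k K : ℝ} (hk : 0 < k) (hK : 0 < K)
    (hlo : ∀ x, k * gPlus (flux B) ρ ‖x‖ ≤ Real.exp (-scalarPotential B x))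
    (hup : ∀ x, Real.exp (-scalarPotential B x) ≤ K * gPlus (flux B) ρ ‖x‖)
    {u : Plane → ℂ} (hu : ContDiff ℝ 2 u) (hc : HasCompactSupport u) {δ : ℝ} (n : ℕ)
    (hδ : ∀ x, |mollify n (scalarPotential B) x - scalarPotential B x| ≤ δ) :
    Real.exp (-(4 * δ)) * (k ^ 2 * (flux B / (4 * flux B + Real.pi)
      * ∫ x, ‖u x‖ ^ 2 * hardyWeight ρ x))
      ≤ K ^ 2 * ∫ x, ‖pauliOp (fun j => mollify n fun x => A x j) u (cgrad u) x‖ ^ 2 := by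
  have hα0 : 0 < flux B := by linarith
  obtain ⟨F, hF, hFre, hFa⟩ := hA.exists_gauge hB n
  have hv : ContDiff ℝ 2 (fun x => Complex.exp (F x) * u x) := hF.cexp.mul hu
  have hvc : HasCompactSupport (fun x => Complex.exp (F x) * u x) := hc.mul_left
  have key := radial_hardy hα hρ hv hvc
  set h := scalarPotential B
  set g : Plane → ℝ := fun x => gPlus (flux B) ρ ‖x‖ with hg
  have hgc : Continuous g := (continuous_gPlus hα0.le hρ).comp continuous_norm
  have hW := continuous_hardyWeight hρ
  have hgp : ∀ x, 0 < g x := fun x => gPlus_pos hρ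
  set P := pauliOp (fun j => mollify n fun x => A x j) u (cgrad u) with hP
  have hPc : Continuous P := continuous_pauliOp
    (fun j => (contDiff_mollify n (hA.locallyIntegrable j)).continuous) hu.continuous
    (continuous_cgrad hu)
  have hPs : HasCompactSupport P := by
    refine HasCompactSupport.intro hc.isCompact fun x hx => ?_
    refine pauliOp_eq_zero (image_eq_zero_of_notMem_tsupport hx) fun j => ?_
    have := image_eq_zero_of_notMem_tsupport (fun hx' => hx (tsupport_fderiv_subset ℝ hx'))
    simp [cgrad, this]
  -- pointwise comparison of the weights
  have e1 : ∀ x, k * (g x * Real.exp (F x).re) ≤ Real.exp δ := fun x => by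
    rw [hFre]
    calc k * (g x * Real.exp (mollify n h x))
        = k * g x * Real.exp (mollify n h x) := by ring
      _ ≤ Real.exp (-h x) * Real.exp (mollify n h x) := by gcongr; exact hlo x
      _ = Real.exp (mollify n h x - h x) := by rw [← Real.exp_add]; ring_nf
      _ ≤ _ := by gcongr; exact (abs_le.1 (hδ x)).2
  have e2 : ∀ x, Real.exp (-δ) ≤ K * (g x * Real.exp (F x).re) := fun x => by
    rw [hFre]
    calc Real.exp (-δ) ≤ Real.exp (mollify n h x - h x) := by
          gcongr; exact (abs_le.1 (hδ x)).1
      _ = Real.exp (-h x) * Real.exp (mollify n h x) := by rw [← Real.exp_add]; ring_nf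
      _ ≤ K * g x * Real.exp (mollify n h x) := by gcongr; exact hup x
      _ = _ := by ring
  have nv : ∀ x, ‖Complex.exp (F x) * u x‖ = Real.exp (F x).re * ‖u x‖ := fun x => by
    rw [norm_mul, Complex.norm_exp]
  have ndz : ∀ x, ‖dz (fun x => Complex.exp (F x) * u x) x‖ = Real.exp (F x).re * ‖P x‖ :=
    fun x => norm_dz_exp_mul hF hu x (hFa x)
  simp only [nv, ndz] at key
  have hFrc : Continuous (fun x => (F x).re) := Complex.continuous_re.comp hF.continuous
  have huc := hu.continuous
  have I1 : Integrable (fun x => ‖u x‖ ^ 2 * hardyWeight ρ x) :=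
    Continuous.integrable_of_hasCompactSupport (by fun_prop)
      (HasCompactSupport.intro hc.isCompact fun x hx => by
        simp [image_eq_zero_of_notMem_tsupport hx])
  have I2 : Integrable (fun x => ‖P x‖ ^ 2) :=
    Continuous.integrable_of_hasCompactSupport (by fun_prop)
      (HasCompactSupport.intro hPs.isCompact fun x hx => by
        simp [image_eq_zero_of_notMem_tsupport hx])
  have I3 : Integrable (fun x => g x ^ 2 * ((Real.exp (F x).re * ‖u x‖) ^ 2 * hardyWeight ρ x)) :=
    Continuous.integrable_of_hasCompactSupport (by fun_prop)
      (HasCompactSupport.intro hc.isCompact fun x hx => by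
        simp [image_eq_zero_of_notMem_tsupport hx])
  have I4 : Integrable (fun x => g x ^ 2 * (Real.exp (F x).re * ‖P x‖) ^ 2) :=
    Continuous.integrable_of_hasCompactSupport (by fun_prop)
      (HasCompactSupport.intro hPs.isCompact fun x hx => by
        simp [image_eq_zero_of_notMem_tsupport hx])
  have b1 : Real.exp (-δ) ^ 2 * (∫ x, ‖u x‖ ^ 2 * hardyWeight ρ x)
      ≤ K ^ 2 * ∫ x, g x ^ 2 * ((Real.exp (F x).re * ‖u x‖) ^ 2 * hardyWeight ρ x) := by
    rw [← integral_const_mul, ← integral_const_mul]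
    refine integral_mono (I1.const_mul _) (I3.const_mul _) fun x => ?_
    have hw := hardyWeight_nonneg hρ x
    calc Real.exp (-δ) ^ 2 * (‖u x‖ ^ 2 * hardyWeight ρ x)
        ≤ (K * (g x * Real.exp (F x).re)) ^ 2 * (‖u x‖ ^ 2 * hardyWeight ρ x) := by
          gcongr; exact e2 x
      _ = _ := by ring
  have b2 : k ^ 2 * (∫ x, g x ^ 2 * (Real.exp (F x).re * ‖P x‖) ^ 2)
      ≤ Real.exp δ ^ 2 * ∫ x, ‖P x‖ ^ 2 := by
    rw [← integral_const_mul, ← integral_const_mul]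
    refine integral_mono (I4.const_mul _) (I2.const_mul _) fun x => ?_
    have := hgp x
    calc k ^ 2 * (g x ^ 2 * (Real.exp (F x).re * ‖P x‖) ^ 2)
        = (k * (g x * Real.exp (F x).re)) ^ 2 * ‖P x‖ ^ 2 := by ring
      _ ≤ _ := by gcongr; exact e1 x
  have hexp : Real.exp (-(4 * δ)) = Real.exp (-δ) ^ 2 * Real.exp (-δ) ^ 2 := by
    rw [← Real.exp_nat_mul, ← Real.exp_add]; ring_nf
  have hexp2 : Real.exp (-δ) ^ 2 * Real.exp δ ^ 2 = 1 := by
    rw [← mul_pow, ← Real.exp_add]; simp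
  set c := flux B / (4 * flux B + Real.pi) with hcd
  have hc0 : 0 ≤ c := by have := Real.pi_pos; positivity
  set X := ∫ x, ‖u x‖ ^ 2 * hardyWeight ρ x
  set Y := ∫ x, g x ^ 2 * ((Real.exp (F x).re * ‖u x‖) ^ 2 * hardyWeight ρ x)
  set Z := ∫ x, g x ^ 2 * (Real.exp (F x).re * ‖P x‖) ^ 2
  set T := ∫ x, ‖P x‖ ^ 2
  calc Real.exp (-(4 * δ)) * (k ^ 2 * (c * X))
      = Real.exp (-δ) ^ 2 * (k ^ 2 * (c * (Real.exp (-δ) ^ 2 * X))) := by rw [hexp]; ring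
    _ ≤ Real.exp (-δ) ^ 2 * (k ^ 2 * (c * (K ^ 2 * Y))) := by gcongr
    _ = Real.exp (-δ) ^ 2 * (k ^ 2 * (K ^ 2 * (c * Y))) := by ring
    _ ≤ Real.exp (-δ) ^ 2 * (k ^ 2 * (K ^ 2 * Z)) := by gcongr
    _ = K ^ 2 * (Real.exp (-δ) ^ 2 * (k ^ 2 * Z)) := by ring
    _ ≤ K ^ 2 * (Real.exp (-δ) ^ 2 * (Real.exp δ ^ 2 * T)) := by gcongr
    _ = K ^ 2 * (Real.exp (-δ) ^ 2 * Real.exp δ ^ 2 * T) := by ring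
    _ = K ^ 2 * T := by rw [hexp2, one_mul]

/-- The lower bound for smooth compactly supported functions. -/
theorem hardy_lower_bound_smooth {B : Plane → ℝ} (hB : AdmissibleField B)
    (hα : 1 ≤ flux B) {A : Plane → Plane} (hA : IsBoundedPotential B A) {ρ : ℝ} (hρ : 0 < ρ)
    {k K : ℝ} (hk : 0 < k) (hK : 0 < K)
    (hlo : ∀ x, k * gPlus (flux B) ρ ‖x‖ ≤ Real.exp (-scalarPotential B x))
    (hup : ∀ x, Real.exp (-scalarPotential B x) ≤ K * gPlus (flux B) ρ ‖x‖)
    {u : Plane → ℂ} (hu : ContDiff ℝ 2 u) (hc : HasCompactSupport u) :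
    k ^ 2 * (flux B / (4 * flux B + Real.pi) * ∫ x, ‖u x‖ ^ 2 * hardyWeight ρ x)
      ≤ K ^ 2 * ∫ x, ‖pauliOp (fun j x => A x j) u (cgrad u) x‖ ^ 2 := by
  obtain ⟨M, hM0, hM⟩ := hB.exists_norm_fderiv_scalarPotential_le
  obtain ⟨C, hC⟩ := hA.exists_bound
  have hLip : ∀ x y, ‖scalarPotential B x - scalarPotential B y‖ ≤ M * ‖x - y‖ := fun x y =>
    Convex.norm_image_sub_le_of_norm_fderiv_le
      (fun z _ => hB.differentiable_scalarPotential z) (fun z _ => hM z) convex_univ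
      (mem_univ y) (mem_univ x)
  have hn := fun n : ℕ => hardy_lower_bound_mollified hB hα hA hρ hk hK hlo hup hu hc
    (δ := M * (1 / (n + 1))) n fun x =>
      norm_mollify_sub_le n hM0 (continuous_scalarPotential hB) hLip x
  -- The error δ = M/(n + 1) tends to zero. On the right, dominated convergence applies: the
  -- mollified components of A are bounded by C uniformly in n and converge almost everywhere, while
  -- u has compact support.
  refine le_of_tendsto_of_tendsto' (b := atTop) ?_ ?_ hn
  · have h1 : Tendsto (fun n : ℕ => Real.exp (-(4 * (M * (1 / ((n : ℝ) + 1)))))) atTop (𝓝 1) := by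
      have h0 := (((tendsto_one_div_add_atTop_nhds_zero_nat (𝕜 := ℝ)).const_mul M).const_mul 4).neg
      simp only [mul_zero, neg_zero] at h0
      have := (Real.continuous_exp.tendsto 0).comp h0
      rwa [Real.exp_zero] at this
    have := h1.mul_const (k ^ 2 * (flux B / (4 * flux B + Real.pi)
      * ∫ x, ‖u x‖ ^ 2 * hardyWeight ρ x))
    rwa [one_mul] at this
  · refine Tendsto.const_mul _ ?_
    have cD := continuous_cgrad hu
    have c0 := cD 0
    have c1 := cD 1
    have huc := hu.continuous
    refine tendsto_integral_of_dominated_convergence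
      (fun x => (‖cgrad u 0 x‖ + ‖cgrad u 1 x‖ + 2 * C * ‖u x‖) ^ 2) (fun n => ?_) ?_ ?_ ?_
    · exact ((continuous_pauliOp (fun j => (contDiff_mollify n
        (hA.locallyIntegrable j)).continuous) huc cD).norm.pow 2).aestronglyMeasurable
    · refine Continuous.integrable_of_hasCompactSupport (by fun_prop)
        (HasCompactSupport.intro hc.isCompact fun x hx => ?_)
      have := image_eq_zero_of_notMem_tsupport (fun hx' => hx (tsupport_fderiv_subset ℝ hx'))
      simp [cgrad, this, image_eq_zero_of_notMem_tsupport hx]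
    · refine fun n => Eventually.of_forall fun x => ?_
      rw [Real.norm_of_nonneg (by positivity)]
      gcongr
      exact norm_pauliOp_le fun j => norm_mollify_le n (hC j) x
    · filter_upwards [ae_tendsto_mollify (hA.locallyIntegrable 0),
        ae_tendsto_mollify (hA.locallyIntegrable 1)] with x h0 h1
      have t0 := (Complex.continuous_ofReal.tendsto _).comp h0
      have t1 := (Complex.continuous_ofReal.tendsto _).comp h1
      have := ((t0.mul_const (u x)).const_add (Complex.I * cgrad u 0 x)).sub
        (((t1.mul_const (u x)).const_add (Complex.I * cgrad u 1 x)).const_mul Complex.I)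
      exact (this.norm.pow 2)

end PauliHardy

/-! ### Convergence in L² and density of smooth functions in H¹ -/

namespace PauliHardy
open Set Filter Topology ComplexConjugate

/-- Convergence in `L²(ℝ²; ℂ)`. -/
structure L2Tendsto (f : ℕ → Plane → ℂ) (g : Plane → ℂ) : Prop where
  memLp : ∀ n, MemLp (f n) 2 volume
  memLp_lim : MemLp g 2 volume
  tendsto : Tendsto (fun n => eLpNorm (f n - g) 2 volume) atTop (𝓝 0)

theorem eLpNorm_two_sq {f : Plane → ℂ} :
    eLpNorm f 2 volume ^ 2 = ∫⁻ x, ‖f x‖ₑ ^ 2 := by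
  have := eLpNorm_nnreal_pow_eq_lintegral (μ := volume) (f := f) (p := 2) (by norm_num)
  simpa using this

theorem tendsto_zero_of_sq_le {ι : Type*} {l : Filter ι} {a b : ι → ℝ≥0∞} (h : ∀ n, a n ^ 2 ≤ b n)
    (hb : Tendsto b l (𝓝 0)) : Tendsto a l (𝓝 0) := by
  have h2 : Tendsto (fun n => b n ^ (1 / 2 : ℝ)) l (𝓝 0) := by
    have := (ENNReal.continuous_rpow_const (y := 1 / 2)).tendsto 0 |>.comp hb
    simpa [Function.comp_def] using this
  refine tendsto_of_tendsto_of_tendsto_of_le_of_le tendsto_const_nhds h2 (fun _ => zero_le)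
    fun n => ?_
  have := ENNReal.rpow_le_rpow (h n) (by norm_num : (0 : ℝ) ≤ 1 / 2)
  rwa [← ENNReal.rpow_natCast, ← ENNReal.rpow_mul, show ((2 : ℕ) : ℝ) * (1 / 2) = 1 by norm_num,
    ENNReal.rpow_one] at this

namespace L2Tendsto
variable {f f' : ℕ → Plane → ℂ} {g g' : Plane → ℂ}

theorem of_le_add {a b : ℕ → ℝ≥0∞} (hf : ∀ n, MemLp (f n) 2 volume) (hg : MemLp g 2 volume)
    (h : ∀ n, eLpNorm (f n - g) 2 volume ≤ a n + b n) (ha : Tendsto a atTop (𝓝 0))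
    (hb : Tendsto b atTop (𝓝 0)) : L2Tendsto f g :=
  ⟨hf, hg, tendsto_of_tendsto_of_tendsto_of_le_of_le tendsto_const_nhds
    (by simpa using ha.add hb) (fun _ => zero_le) h⟩

theorem add (h : L2Tendsto f g) (h' : L2Tendsto f' g') :
    L2Tendsto (fun n x => f n x + f' n x) (fun x => g x + g' x) := by
  refine of_le_add (fun n => (h.memLp n).add (h'.memLp n)) (h.memLp_lim.add h'.memLp_lim)
    (fun n => ?_) h.tendsto h'.tendsto
  have e : ((fun x => f n x + f' n x) - fun x => g x + g' x) = (f n - g) + (f' n - g') := by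
    funext x; simp; ring
  rw [e]
  exact eLpNorm_add_le ((h.memLp n).sub h.memLp_lim).aestronglyMeasurable
    ((h'.memLp n).sub h'.memLp_lim).aestronglyMeasurable (by norm_num)

theorem bdd_mul (h : L2Tendsto f g) {m : Plane → ℂ} (hm : AEStronglyMeasurable m) {C : ℝ}
    (hC : ∀ᵐ x, ‖m x‖ ≤ C) : L2Tendsto (fun n x => m x * f n x) (fun x => m x * g x) := by
  have hM : ∀ {φ : Plane → ℂ}, MemLp φ 2 volume → MemLp (fun x => m x * φ x) 2 volume :=
    fun hφ => hφ.of_le_mul (c := C) (hm.mul hφ.aestronglyMeasurable) (by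
      filter_upwards [hC] with x hx
      rw [norm_mul]; gcongr)
  refine of_le_add (b := fun _ => 0) (fun n => hM (h.memLp n)) (hM h.memLp_lim) (fun n => ?_)
    (a := fun n => ENNReal.ofReal C * eLpNorm (f n - g) 2 volume) ?_ tendsto_const_nhds
  · rw [add_zero]
    refine eLpNorm_le_mul_eLpNorm_of_ae_le_mul ?_ 2
    filter_upwards [hC] with x hx
    simp only [Pi.sub_apply]
    rw [← mul_sub, norm_mul]
    gcongr
  · simpa using ENNReal.Tendsto.const_mul h.tendsto (Or.inr ENNReal.ofReal_ne_top)

theorem integral_norm_sq_tendsto (h : L2Tendsto f g) :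
    Tendsto (fun n => ∫ x, ‖f n x‖ ^ 2) atTop (𝓝 (∫ x, ‖g x‖ ^ 2)) := by
  have e : ∀ φ : Plane → ℂ, MemLp φ 2 volume →
      ∫ x, ‖φ x‖ ^ 2 = (eLpNorm φ 2 volume).toReal ^ 2 := fun φ hφ => by
    have hm : AEStronglyMeasurable (fun x => ‖φ x‖ ^ 2) volume :=
      hφ.aestronglyMeasurable.norm.pow 2
    rw [← ENNReal.toReal_pow, eLpNorm_two_sq, integral_eq_lintegral_of_nonneg_ae
      (Eventually.of_forall fun x => by positivity) hm]
    congr 2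
    funext x
    rw [ENNReal.ofReal_pow (norm_nonneg _), ofReal_norm]
  have hL : Tendsto (fun n => (h.memLp n).toLp (f n)) atTop (𝓝 (h.memLp_lim.toLp g)) :=
    (Lp.tendsto_Lp_iff_tendsto_eLpNorm'' _ _ _ _).2 h.tendsto
  have hN := hL.norm.pow 2
  simp only [Lp.norm_toLp] at hN
  simpa only [e _ (h.memLp _), e _ h.memLp_lim] using hN

end L2Tendsto

/-- Dominated convergence with majorant |f|². It is used with c = cutoff - 1, which tends to zero
pointwise though not uniformly. -/
theorem tendsto_eLpNorm_mul_of_tendsto_zero {f : Plane → ℂ} (hf : MemLp f 2 volume)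
    {c : ℕ → Plane → ℂ} (hc : ∀ n, AEStronglyMeasurable (c n)) (hb : ∀ n x, ‖c n x‖ ≤ 1)
    (hlim : ∀ x, Tendsto (fun n => c n x) atTop (𝓝 0)) :
    Tendsto (fun n => eLpNorm (fun x => c n x * f x) 2 volume) atTop (𝓝 0) := by
  refine tendsto_zero_of_sq_le (b := fun n => ∫⁻ x, ‖c n x * f x‖ₑ ^ 2)
    (fun n => eLpNorm_two_sq.le) ?_
  have h := tendsto_lintegral_of_dominated_convergence' (μ := (volume : Measure Plane))
    (F := fun n x => ‖c n x * f x‖ₑ ^ 2) (f := fun _ => 0) (fun x => ‖f x‖ₑ ^ 2)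
    (fun n => ((hc n).mul hf.aestronglyMeasurable).enorm.pow_const 2)
    (fun n => Eventually.of_forall fun x => ?_) ?_ (Eventually.of_forall fun x => ?_)
  · simpa using h
  · refine pow_le_pow_left' ?_ 2
    rw [enorm_mul]
    refine mul_le_of_le_one_left zero_le ?_
    rw [← ofReal_norm]
    exact ENNReal.ofReal_le_one.2 (hb n x)
  · rw [← eLpNorm_two_sq]
    exact ENNReal.pow_ne_top hf.eLpNorm_ne_top
  · have h1 := ((ENNReal.continuous_pow 2).tendsto _).comp ((hlim x).mul_const (f x)).enorm
    simpa [Function.comp_def] using h1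

/-- A fixed cutoff function. -/
noncomputable def cutoffBump : ContDiffBump (0 : Plane) where
  rIn := 1
  rOut := 2
  rIn_pos := one_pos
  rIn_lt_rOut := one_lt_two

noncomputable def cutoff (n : ℕ) (x : Plane) : ℝ := cutoffBump ((1 / ((n : ℝ) + 1)) • x)

theorem contDiff_cutoff (n : ℕ) : ContDiff ℝ ∞ (cutoff n) :=
  cutoffBump.contDiff.comp (contDiff_const_smul _)

theorem hasCompactSupport_cutoff (n : ℕ) : HasCompactSupport (cutoff n) :=
  cutoffBump.hasCompactSupport.comp_smul (by positivity)

theorem cutoff_nonneg (n : ℕ) (x : Plane) : 0 ≤ cutoff n x := cutoffBump.nonneg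
theorem cutoff_le_one (n : ℕ) (x : Plane) : cutoff n x ≤ 1 := cutoffBump.le_one

theorem tendsto_cutoff (x : Plane) : Tendsto (fun n => cutoff n x) atTop (𝓝 1) := by
  have h : Tendsto (fun n : ℕ => (1 / ((n : ℝ) + 1)) • x) atTop (𝓝 0) := by
    simpa using (tendsto_one_div_add_atTop_nhds_zero_nat (𝕜 := ℝ)).smul_const x
  have h1 := (cutoffBump.continuous.tendsto (0 : Plane)).comp h
  rwa [cutoffBump.one_of_mem_closedBall (Metric.mem_closedBall_self zero_le_one)] at h1

theorem exists_norm_fderiv_cutoff_le :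
    ∃ C : ℝ, 0 ≤ C ∧ ∀ (n : ℕ) (x : Plane), ‖fderiv ℝ (cutoff n) x‖ ≤ C * (1 / ((n : ℝ) + 1)) := by
  obtain ⟨C, hC⟩ := (cutoffBump.hasCompactSupport.fderiv (𝕜 := ℝ)).exists_bound_of_continuous
    ((cutoffBump.contDiff (n := 1)).continuous_fderiv one_ne_zero)
  refine ⟨C, (norm_nonneg _).trans (hC 0), fun n x => ?_⟩
  have hd : HasFDerivAt (cutoff n) ((fderiv ℝ cutoffBump ((1 / ((n : ℝ) + 1)) • x)).comp
      ((1 / ((n : ℝ) + 1)) • ContinuousLinearMap.id ℝ Plane)) x :=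
    (((cutoffBump.contDiff (n := 1)).differentiable one_ne_zero _).hasFDerivAt).comp x
      ((hasFDerivAt_id x).const_smul (1 / ((n : ℝ) + 1)))
  rw [hd.fderiv]
  refine (ContinuousLinearMap.opNorm_comp_le _ _).trans ?_
  gcongr
  · exact (norm_nonneg _).trans (hC 0)
  · exact hC _
  · rw [norm_smul, Real.norm_of_nonneg (by positivity)]
    refine mul_le_of_le_one_right (by positivity) ContinuousLinearMap.norm_id_le

theorem IsH1.fderiv_mollify {u : Plane → ℂ} {Du : Fin 2 → Plane → ℂ} (hu : IsH1 u Du) (n : ℕ)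
    (j : Fin 2) : cgrad (mollify n u) j = mollify n (Du j) := by
  funext x
  refine fderiv_mollify_of_weak n (hu.memLp.locallyIntegrable (by norm_num)) (fun φ hφ => ?_) x
  simpa only [Complex.real_smul] using hu.weak_grad j φ hφ

/-- Smooth compactly supported functions are dense in `H¹`. -/
theorem IsH1.exists_smooth_approx {u : Plane → ℂ} {Du : Fin 2 → Plane → ℂ} (hu : IsH1 u Du) :
    ∃ w : ℕ → Plane → ℂ, (∀ n, ContDiff ℝ ∞ (w n)) ∧ (∀ n, HasCompactSupport (w n)) ∧
      L2Tendsto w u ∧ ∀ j, L2Tendsto (fun n => cgrad (w n) j) (Du j) := by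
  have hul : LocallyIntegrable u := hu.memLp.locallyIntegrable (by norm_num)
  have hDl : ∀ j, LocallyIntegrable (Du j) := fun j =>
    (hu.memLp_grad j).locallyIntegrable (by norm_num)
  set w : ℕ → Plane → ℂ := fun n x => ((cutoff n x : ℝ) : ℂ) * mollify n u x with hw
  have hcc : ∀ n, ContDiff ℝ ∞ (fun x => ((cutoff n x : ℝ) : ℂ)) := fun n =>
    Complex.ofRealCLM.contDiff.comp (contDiff_cutoff n)
  have hws : ∀ n, ContDiff ℝ ∞ (w n) := fun n => (hcc n).mul (contDiff_mollify n hul)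
  have hcs : ∀ n, HasCompactSupport (fun x => ((cutoff n x : ℝ) : ℂ)) := fun n =>
    (hasCompactSupport_cutoff n).comp_left Complex.ofReal_zero
  have hwc : ∀ n, HasCompactSupport (w n) := fun n => (hcs n).mul_right
  have hcn : ∀ n x, ‖((cutoff n x : ℝ) : ℂ)‖ ≤ 1 := fun n x => by
    rw [Complex.norm_real, Real.norm_of_nonneg (cutoff_nonneg n x)]; exact cutoff_le_one n x
  -- cutting off a converging sequence
  have hcut : ∀ f : Plane → ℂ, MemLp f 2 volume →
      Tendsto (fun n => eLpNorm (fun x => ((cutoff n x : ℝ) : ℂ) * mollify n f x - f x) 2 volume)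
        atTop (𝓝 0) := by
    intro f hf
    have hfl : LocallyIntegrable f := hf.locallyIntegrable (by norm_num)
    have t2 := tendsto_eLpNorm_mul_of_tendsto_zero hf
      (c := fun n x => ((cutoff n x : ℝ) : ℂ) - 1)
      (fun n => ((hcc n).continuous.sub continuous_const).aestronglyMeasurable)
      (fun n x => by
        rw [← Complex.ofReal_one, ← Complex.ofReal_sub, Complex.norm_real, Real.norm_eq_abs,
          abs_le]
        constructor <;> linarith [cutoff_nonneg n x, cutoff_le_one n x])
      (fun x => by
        have := ((Complex.continuous_ofReal.tendsto 1).comp (tendsto_cutoff x)).sub_const 1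
        simpa using this)
    have t1 := tendsto_eLpNorm_mollify_sub hf
    refine tendsto_of_tendsto_of_tendsto_of_le_of_le tendsto_const_nhds
      (by simpa using t1.add t2) (fun _ => zero_le) fun n => ?_
    have m1 : AEStronglyMeasurable (fun x => ((cutoff n x : ℝ) : ℂ) * (mollify n f x - f x)) :=
      (hcc n).continuous.aestronglyMeasurable.mul
        ((contDiff_mollify n hfl).continuous.aestronglyMeasurable.sub hf.aestronglyMeasurable)
    have m2 : AEStronglyMeasurable (fun x => (((cutoff n x : ℝ) : ℂ) - 1) * f x) :=
      (((hcc n).continuous.sub continuous_const).aestronglyMeasurable).mul hf.aestronglyMeasurable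
    have e : (fun x => ((cutoff n x : ℝ) : ℂ) * mollify n f x - f x)
        = (fun x => ((cutoff n x : ℝ) : ℂ) * (mollify n f x - f x))
          + fun x => (((cutoff n x : ℝ) : ℂ) - 1) * f x := by
      funext x; simp; ring
    rw [e]
    refine (eLpNorm_add_le m1 m2 (by norm_num)).trans ?_
    gcongr
    refine eLpNorm_mono fun x => ?_
    rw [norm_mul]
    exact mul_le_of_le_one_left (norm_nonneg _) (hcn n x)
  have hmem : ∀ {f : Plane → ℂ}, Continuous f → HasCompactSupport f → MemLp f 2 volume :=
    fun hf hc => hf.memLp_of_hasCompactSupport hc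
  refine ⟨w, hws, hwc, ⟨fun n => hmem (hws n).continuous (hwc n), hu.memLp, hcut u hu.memLp⟩,
    fun j => ?_⟩
  obtain ⟨C, hC0, hC⟩ := exists_norm_fderiv_cutoff_le
  -- The first term converges by `hcut`. In the second, the gradient of the dilated cutoff is O(1/(n
  -- + 1)) uniformly, while mollification does not increase the L² norm of u.
  have hgrad : ∀ n x, cgrad (w n) j x = ((cutoff n x : ℝ) : ℂ) * mollify n (Du j) x
      + ((partialDeriv j (cutoff n) x : ℝ) : ℂ) * mollify n u x := by
    intro n x
    have h1 := (Complex.ofRealCLM.hasFDerivAt (x := cutoff n x)).comp x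
      ((contDiff_cutoff n).differentiable (by simp) x).hasFDerivAt
    have h2 := ((contDiff_mollify n hul).differentiable (by simp) x).hasFDerivAt
    have h3 := (h1.mul h2).fderiv
    have h4 := congrArg (fun L : Plane →L[ℝ] ℂ => L (EuclideanSpace.single j 1)) h3
    have h5 : cgrad (mollify n u) j x = mollify n (Du j) x := by rw [hu.fderiv_mollify n j]
    refine h4.trans ?_
    rw [← h5]
    simp [cgrad, partialDeriv]
    ring
  refine L2Tendsto.of_le_add (fun n => hmem (continuous_cgrad
    (by exact_mod_cast contDiff_infty.1 (hws n) 2) j) (hasCompactSupport_cgrad (hwc n) j))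
    (hu.memLp_grad j) (fun n => ?_) (hcut (Du j) (hu.memLp_grad j))
    (b := fun n => ENNReal.ofReal (C * (1 / ((n : ℝ) + 1))) * eLpNorm u 2 volume) ?_
  · have m1 : AEStronglyMeasurable (fun x => ((cutoff n x : ℝ) : ℂ) * mollify n (Du j) x - Du j x) :=
      ((hcc n).continuous.aestronglyMeasurable.mul
        (contDiff_mollify n (hDl j)).continuous.aestronglyMeasurable).sub
        (hu.memLp_grad j).aestronglyMeasurable
    have c2 : Continuous (partialDeriv j (cutoff n)) :=
      ((contDiff_cutoff n).continuous_fderiv (by simp)).clm_apply continuous_const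
    have m2 : AEStronglyMeasurable
        (fun x => ((partialDeriv j (cutoff n) x : ℝ) : ℂ) * mollify n u x) :=
      ((Complex.continuous_ofReal.comp c2).mul
        (contDiff_mollify n hul).continuous).aestronglyMeasurable
    have e : cgrad (w n) j - Du j = (fun x => ((cutoff n x : ℝ) : ℂ) * mollify n (Du j) x - Du j x)
        + fun x => ((partialDeriv j (cutoff n) x : ℝ) : ℂ) * mollify n u x := by
      funext x; simp [hgrad n x]; ring
    rw [e]
    refine (eLpNorm_add_le m1 m2 (by norm_num)).trans ?_
    gcongr
    refine (eLpNorm_le_mul_eLpNorm_of_ae_le_mul (g := mollify n u) (c := C * (1 / ((n : ℝ) + 1)))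
      (Eventually.of_forall fun x => ?_) 2).trans ?_
    · rw [norm_mul, Complex.norm_real]
      gcongr
      exact (abs_partialDeriv_le _ _ _).trans (hC n x)
    · gcongr
      exact eLpNorm_mollify_le n hu.memLp.aestronglyMeasurable
  · have h1 : Tendsto (fun n : ℕ => ENNReal.ofReal (C * (1 / ((n : ℝ) + 1)))) atTop (𝓝 0) := by
      have := (tendsto_one_div_add_atTop_nhds_zero_nat (𝕜 := ℝ)).const_mul C
      rw [mul_zero] at this
      simpa using (ENNReal.tendsto_ofReal this)
    simpa using ENNReal.Tendsto.mul_const h1 (Or.inr hu.memLp.eLpNorm_ne_top)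

end PauliHardy

/-! ### The form bound for the field -/

namespace PauliHardy
open Set Filter Topology ComplexConjugate

namespace L2Tendsto
variable {f : ℕ → Plane → ℂ} {g : Plane → ℂ}

theorem exists_seq_tendsto_ae (h : L2Tendsto f g) :
    ∃ ns : ℕ → ℕ, StrictMono ns ∧ ∀ᵐ x, Tendsto (fun i => f (ns i) x) atTop (𝓝 (g x)) :=
  (tendstoInMeasure_of_tendsto_eLpNorm two_ne_zero (fun n => (h.memLp n).aestronglyMeasurable)
    h.memLp_lim.aestronglyMeasurable h.tendsto).exists_seq_tendsto_ae

theorem comp_strictMono (h : L2Tendsto f g) {ns : ℕ → ℕ} (hns : StrictMono ns) :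
    L2Tendsto (fun n => f (ns n)) g :=
  ⟨fun n => h.memLp (ns n), h.memLp_lim, h.tendsto.comp hns.tendsto_atTop⟩

theorem tendsto_sub (h : L2Tendsto f g) :
    Tendsto (fun p : ℕ × ℕ => eLpNorm (f p.1 - f p.2) 2 volume) atTop (𝓝 0) := by
  rw [← prod_atTop_atTop_eq]
  have h1 := h.tendsto.comp (tendsto_fst (f := atTop) (g := (atTop : Filter ℕ)))
  have h2 := h.tendsto.comp (tendsto_snd (f := (atTop : Filter ℕ)) (g := atTop))
  refine tendsto_of_tendsto_of_tendsto_of_le_of_le tendsto_const_nhds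
    (by simpa using h1.add h2) (fun _ => zero_le) fun p => ?_
  have e : f p.1 - f p.2 = (f p.1 - g) - (f p.2 - g) := by simp
  rw [e]
  exact eLpNorm_sub_le ((h.memLp _).sub h.memLp_lim).aestronglyMeasurable
    ((h.memLp _).sub h.memLp_lim).aestronglyMeasurable (by norm_num)

/-- A Cauchy sequence in `L²` of pointwise multiples of a convergent sequence converges to the
multiple of the limit. -/
theorem mul_of_cauchy (h : L2Tendsto f g) {m : Plane → ℂ}
    (hm : ∀ n, MemLp (fun x => m x * f n x) 2 volume)
    (hc : Tendsto (fun p : ℕ × ℕ => eLpNorm (fun x => m x * (f p.1 x - f p.2 x)) 2 volume)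
      atTop (𝓝 0)) :
    L2Tendsto (fun n x => m x * f n x) (fun x => m x * g x) := by
  have hC : CauchySeq (fun n => (hm n).toLp _) := by
    rw [Lp.cauchySeq_Lp_iff_cauchySeq_eLpNorm]
    refine hc.congr fun p => eLpNorm_congr_ae ?_
    filter_upwards [(hm p.1).coeFn_toLp, (hm p.2).coeFn_toLp] with x h1 h2
    rw [Pi.sub_apply, h1, h2, mul_sub]
  obtain ⟨G, hG⟩ := cauchySeq_tendsto_of_complete hC
  have hG' : Tendsto (fun n => eLpNorm ((fun x => m x * f n x) - (G : Plane → ℂ)) 2 volume) atTop (𝓝 0) := by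
    refine ((Lp.tendsto_Lp_iff_tendsto_eLpNorm' _ _).1 hG).congr fun n => eLpNorm_congr_ae ?_
    filter_upwards [(hm n).coeFn_toLp] with x h1
    rw [Pi.sub_apply, Pi.sub_apply, h1]
  have L : L2Tendsto (fun n x => m x * f n x) G := ⟨hm, Lp.memLp G, hG'⟩
  obtain ⟨ns, hns, hae⟩ := L.exists_seq_tendsto_ae
  obtain ⟨ms, hms, hae'⟩ := (h.comp_strictMono hns).exists_seq_tendsto_ae
  -- The limit G is known only abstractly. It is identified almost everywhere by extracting, from a
  -- subsequence along which m f converges to G, a further one along which f converges to g.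
  have e : (G : Plane → ℂ) =ᵐ[volume] fun x => m x * g x := by
    filter_upwards [hae, hae'] with x h1 h2
    exact tendsto_nhds_unique (h1.comp hms.tendsto_atTop) (h2.const_mul (m x))
  refine ⟨hm, (memLp_congr_ae e).1 (Lp.memLp G), hG'.congr fun n => eLpNorm_congr_ae ?_⟩
  filter_upwards [e] with x hx
  rw [Pi.sub_apply, Pi.sub_apply, hx]

end L2Tendsto

theorem isTest_norm_sq {w : Plane → ℂ} (hw : ContDiff ℝ ∞ w) (hc : HasCompactSupport w) :
    IsTest (fun x => ‖w x‖ ^ 2) :=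
  ⟨hw.norm_sq ℝ, hc.comp_left (g := fun z : ℂ => ‖z‖ ^ 2) (by simp)⟩

theorem partialDeriv_norm_sq {w : Plane → ℂ} {x : Plane} (hw : DifferentiableAt ℝ w x)
    (j : Fin 2) :
    partialDeriv j (fun x => ‖w x‖ ^ 2) x = 2 * (cgrad w j x * conj (w x)).re := by
  have h := congrArg (fun L : Plane →L[ℝ] ℝ => L (EuclideanSpace.single j 1))
    hw.hasFDerivAt.norm_sq.fderiv
  refine h.trans ?_
  simp [cgrad, Complex.inner]
  ring

theorem norm_grad_le (φ : Plane → ℝ) (x : Plane) :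
    ‖grad φ x‖ ≤ |partialDeriv 0 φ x| + |partialDeriv 1 φ x| := by
  rw [EuclideanSpace.norm_eq]
  refine Real.sqrt_le_iff.2 ⟨by positivity, ?_⟩
  simp only [grad, Fin.sum_univ_two, Real.norm_eq_abs]
  simp
  nlinarith [abs_nonneg (partialDeriv 0 φ x), abs_nonneg (partialDeriv 1 φ x),
    sq_abs (partialDeriv 0 φ x), sq_abs (partialDeriv 1 φ x)]

theorem integrable_norm_sq {f : Plane → ℂ} (hf : Continuous f) (hc : HasCompactSupport f) :
    Integrable (fun x => ‖f x‖ ^ 2) :=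
  Continuous.integrable_of_hasCompactSupport (by fun_prop)
    (hc.comp_left (g := fun z : ℂ => ‖z‖ ^ 2) (by simp))

/-- The first-order estimate for the admissible field |B|, tested with |w|²: the gradient is
controlled through 2|w||∂_j w| ≤ |w|² + |∂_j w|². -/
theorem AdmissibleField.exists_integral_abs_mul_norm_sq_le {B : Plane → ℝ}
    (hB : AdmissibleField B) :
    ∃ C : ℝ, 0 ≤ C ∧ ∀ w : Plane → ℂ, ContDiff ℝ ∞ w → HasCompactSupport w →
      Integrable (fun x => |B x| * ‖w x‖ ^ 2) ∧
      ∫ x, |B x| * ‖w x‖ ^ 2 ≤ C * ((∫ x, ‖w x‖ ^ 2) + (∫ x, ‖cgrad w 0 x‖ ^ 2)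
        + ∫ x, ‖cgrad w 1 x‖ ^ 2) := by
  obtain ⟨C, hC0, hC⟩ := hB.abs.exists_integral_mul_le
  refine ⟨C * 2, by positivity, fun w hw hc => ⟨?_, ?_⟩⟩
  · have ht := isTest_norm_sq hw hc
    obtain ⟨M, hM⟩ := ht.compact.exists_bound_of_continuous ht.smooth.continuous
    exact hB.integrable.abs.mul_bdd ht.smooth.continuous.aestronglyMeasurable
      (Eventually.of_forall hM)
  · have hw2 : ContDiff ℝ 2 w := mod_cast contDiff_infty.1 hw 2
    have i0 := integrable_norm_sq hw.continuous hc
    have i1 := fun j => integrable_norm_sq (continuous_cgrad hw2 j) (hasCompactSupport_cgrad hc j)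
    have i01 : Integrable (fun x => ‖w x‖ ^ 2 + ‖cgrad w 0 x‖ ^ 2) := i0.add (i1 0)
    refine (hC _ (isTest_norm_sq hw hc)).trans ?_
    rw [mul_assoc]
    refine mul_le_mul_of_nonneg_left ?_ hC0
    rw [← integral_add i0 (i1 0), ← integral_add i01 (i1 1), ← integral_const_mul]
    have ht := isTest_norm_sq hw hc
    refine integral_mono
      (ht.continuous_grad.integrable_of_hasCompactSupport ht.hasCompactSupport_grad).norm
      ((i01.add (i1 1)).const_mul 2) fun x => ?_
    have hd : DifferentiableAt ℝ w x := hw.differentiable (by simp) x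
    have hj : ∀ j, |partialDeriv j (fun x => ‖w x‖ ^ 2) x| ≤ ‖w x‖ ^ 2 + ‖cgrad w j x‖ ^ 2 :=
      fun j => by
        rw [partialDeriv_norm_sq hd, abs_mul, abs_two]
        have := Complex.abs_re_le_norm (cgrad w j x * conj (w x))
        rw [norm_mul, RCLike.norm_conj] at this
        nlinarith [sq_nonneg (‖w x‖ - ‖cgrad w j x‖)]
    refine (norm_grad_le _ x).trans ?_
    have := add_le_add (hj 0) (hj 1)
    nlinarith [sq_nonneg ‖cgrad w 0 x‖, sq_nonneg ‖cgrad w 1 x‖]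

theorem cgrad_sub {v w : Plane → ℂ} (hv : ContDiff ℝ ∞ v) (hw : ContDiff ℝ ∞ w) (j : Fin 2) :
    cgrad (v - w) j = cgrad v j - cgrad w j := by
  funext x
  simp [cgrad, fderiv_sub (hv.differentiable (by simp) x) (hw.differentiable (by simp) x)]

theorem ofReal_integral_norm_sq {f : Plane → ℂ} (hf : MemLp f 2 volume) :
    ENNReal.ofReal (∫ x, ‖f x‖ ^ 2) = eLpNorm f 2 volume ^ 2 := by
  have hi : Integrable (fun x => ‖f x‖ ^ 2) :=
    (memLp_two_iff_integrable_sq_norm hf.aestronglyMeasurable).1 hf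
  rw [eLpNorm_two_sq, ofReal_integral_eq_lintegral_ofReal hi
    (Eventually.of_forall fun x => by positivity)]
  congr 1
  funext x
  rw [ENNReal.ofReal_pow (norm_nonneg _), ofReal_norm]

/-- Multiplication by the square root of a weight dominated by an admissible field is continuous
from `H¹` to `L²`. -/
theorem L2Tendsto.sqrt_mul {B b : Plane → ℝ} (hB : AdmissibleField B)
    (hb : AEStronglyMeasurable b) (hb0 : ∀ x, 0 ≤ b x) (hbB : ∀ x, b x ≤ |B x|)
    {w : ℕ → Plane → ℂ} {u : Plane → ℂ} {Du : Fin 2 → Plane → ℂ}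
    (hs : ∀ n, ContDiff ℝ ∞ (w n)) (hc : ∀ n, HasCompactSupport (w n))
    (h : L2Tendsto w u) (hD : ∀ j, L2Tendsto (fun n => cgrad (w n) j) (Du j)) :
    L2Tendsto (fun n x => ((√(b x) : ℝ) : ℂ) * w n x) (fun x => ((√(b x) : ℝ) : ℂ) * u x) := by
  obtain ⟨C, hC0, hC⟩ := hB.exists_integral_abs_mul_norm_sq_le
  have hm : AEStronglyMeasurable (fun x => ((√(b x) : ℝ) : ℂ)) :=
    Complex.continuous_ofReal.comp_aestronglyMeasurable
      (Real.continuous_sqrt.comp_aestronglyMeasurable hb)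
  have hn : ∀ (v : Plane → ℂ) x, ‖((√(b x) : ℝ) : ℂ) * v x‖ ^ 2 = b x * ‖v x‖ ^ 2 := fun v x => by
    rw [norm_mul, mul_pow, Complex.norm_real, Real.norm_eq_abs, sq_abs, Real.sq_sqrt (hb0 x)]
  have hmem : ∀ v : Plane → ℂ, ContDiff ℝ ∞ v → HasCompactSupport v →
      MemLp (fun x => ((√(b x) : ℝ) : ℂ) * v x) 2 volume := fun v hv hvc => by
    have hmv : AEStronglyMeasurable (fun x => ((√(b x) : ℝ) : ℂ) * v x) volume :=
      hm.mul hv.continuous.aestronglyMeasurable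
    rw [memLp_two_iff_integrable_sq_norm hmv]
    refine (hC v hv hvc).1.mono' (hmv.norm.pow 2)
      (Eventually.of_forall fun x => ?_)
    rw [Real.norm_of_nonneg (by positivity), hn]
    gcongr
    exact hbB x
  have hbd : ∀ v : Plane → ℂ, ContDiff ℝ ∞ v → HasCompactSupport v →
      eLpNorm (fun x => ((√(b x) : ℝ) : ℂ) * v x) 2 volume ^ 2
        ≤ ENNReal.ofReal C * (eLpNorm v 2 volume ^ 2 + eLpNorm (cgrad v 0) 2 volume ^ 2
          + eLpNorm (cgrad v 1) 2 volume ^ 2) := fun v hv hvc => by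
    have hv2 : ContDiff ℝ 2 v := mod_cast contDiff_infty.1 hv 2
    have m0 : MemLp v 2 volume := hv.continuous.memLp_of_hasCompactSupport hvc
    have m1 := fun j => (continuous_cgrad hv2 j).memLp_of_hasCompactSupport (p := 2)
      (μ := volume) (hasCompactSupport_cgrad hvc j)
    rw [← ofReal_integral_norm_sq (hmem v hv hvc), ← ofReal_integral_norm_sq m0,
      ← ofReal_integral_norm_sq (m1 0), ← ofReal_integral_norm_sq (m1 1),
      ← ENNReal.ofReal_add (by positivity) (by positivity),
      ← ENNReal.ofReal_add (by positivity) (by positivity), ← ENNReal.ofReal_mul hC0]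
    refine ENNReal.ofReal_le_ofReal (le_trans ?_ (hC v hv hvc).2)
    simp only [hn]
    refine integral_mono_of_nonneg (Eventually.of_forall fun x => ?_) (hC v hv hvc).1
      (Eventually.of_forall fun x => ?_)
    · exact mul_nonneg (hb0 x) (by positivity)
    · exact mul_le_mul_of_nonneg_right (hbB x) (by positivity)
  -- That √b u lies in L² is not known beforehand, as b need not be bounded. The form bound applied
  -- to the differences of the w n gives a Cauchy sequence instead, and membership of the limit
  -- follows.
  refine h.mul_of_cauchy (fun n => hmem _ (hs n) (hc n)) ?_
  have lim : Tendsto (fun p : ℕ × ℕ => ENNReal.ofReal C * (eLpNorm (w p.1 - w p.2) 2 volume ^ 2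
      + eLpNorm (cgrad (w p.1) 0 - cgrad (w p.2) 0) 2 volume ^ 2
      + eLpNorm (cgrad (w p.1) 1 - cgrad (w p.2) 1) 2 volume ^ 2)) atTop (𝓝 0) := by
    have sq : ∀ {a : ℕ × ℕ → ℝ≥0∞}, Tendsto a atTop (𝓝 0) →
        Tendsto (fun p => a p ^ 2) atTop (𝓝 0) := fun ha => by
      simpa [Function.comp_def] using ((ENNReal.continuous_pow 2).tendsto _).comp ha
    have := ENNReal.Tendsto.const_mul (((sq h.tendsto_sub).add (sq (hD 0).tendsto_sub)).add
      (sq (hD 1).tendsto_sub)) (Or.inr (ENNReal.ofReal_ne_top (r := C)))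
    simpa using this
  refine tendsto_zero_of_sq_le (fun p => ?_) lim
  rw [← cgrad_sub (hs _) (hs _), ← cgrad_sub (hs _) (hs _)]
  exact hbd (w p.1 - w p.2) ((hs _).sub (hs _)) ((hc _).sub (hc _))

end PauliHardy

/-! ### The energy identity and the lower bound on H¹ -/

namespace PauliHardy
open Set Filter Topology ComplexConjugate

/-- The `j`-th component of `(i∇ + A) u`. -/
noncomputable def kin (A : Plane → Plane) (u : Plane → ℂ) (Du : Fin 2 → Plane → ℂ) (j : Fin 2)
    (x : Plane) : ℂ :=
  Complex.I * Du j x + ((A x j : ℝ) : ℂ) * u x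

/-- The cross term of |P₀u - iP₁u|² is -2 Im(P₀u · conj(P₁u)). The part quadratic in A is real and
disappears; the part linear in A assembles into derivatives of |u|²; the rest is a Jacobian. -/
theorem norm_pauliOp_sq (A : Plane → Plane) (u : Plane → ℂ) (Du : Fin 2 → Plane → ℂ)
    (x : Plane) :
    ‖pauliOp (fun j x => A x j) u Du x‖ ^ 2 = ‖kin A u Du 0 x‖ ^ 2 + ‖kin A u Du 1 x‖ ^ 2
      + (A x 0 * (2 * (Du 1 x * conj (u x)).re) - A x 1 * (2 * (Du 0 x * conj (u x)).re))
      - 2 * (Du 0 x * conj (Du 1 x)).im := by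
  simp only [pauliOp, kin, Complex.sq_norm, Complex.normSq_apply]
  simp
  ring

/-- The Jacobian is a null Lagrangian: integrating by parts and exchanging the second derivatives
shows that ∫ ∂₀w · conj(∂₁w) equals its own conjugate. -/
theorem integral_im_cgrad_mul_conj {w : Plane → ℂ} (hw : ContDiff ℝ ∞ w)
    (hc : HasCompactSupport w) : ∫ x, (cgrad w 0 x * conj (cgrad w 1 x)).im = 0 := by
  set v : Plane → ℂ := fun x => conj (w x) with hv
  have hvs : ContDiff ℝ ∞ v := Complex.conjCLE.contDiff.comp hw
  have hvd : ∀ j x, cgrad v j x = conj (cgrad w j x) := fun j x => by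
    have h := (Complex.conjCLE.hasFDerivAt (x := w x)).comp x
      (hw.differentiable (by simp) x).hasFDerivAt
    have h' : fderiv ℝ v x = _ := h.fderiv
    simp [cgrad, h']
  have hcs : ∀ j, ContDiff ℝ ∞ (cgrad v j) := fun j =>
    (hvs.fderiv_right (m := ∞) (by simp)).clm_apply contDiff_const
  have hcc := fun i => continuous_cgrad (mod_cast contDiff_infty.1 hw 2 : ContDiff ℝ 2 w) i
  have hsc := fun i => hasCompactSupport_cgrad hc i
  have parts : ∀ i j : Fin 2, ∫ x, w x * fderiv ℝ (cgrad v j) x (EuclideanSpace.single i 1)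
      = -∫ x, cgrad w i x * cgrad v j x := fun i j => by
    refine integral_mul_fderiv_eq_neg_fderiv_mul_of_integrable ?_ ?_ ?_
      (fun x _ => hw.differentiable (by simp) x) fun x _ => (hcs j).differentiable (by simp) x
    · exact ((hcc i).mul (hcs j).continuous).integrable_of_hasCompactSupport (hsc i).mul_right
    · exact (hw.continuous.mul (((hcs j).continuous_fderiv (by simp)).clm_apply
        continuous_const)).integrable_of_hasCompactSupport hc.mul_right
    · exact (hw.continuous.mul (hcs j).continuous).integrable_of_hasCompactSupport hc.mul_right
  have symm : ∀ x, fderiv ℝ (cgrad v 1) x (EuclideanSpace.single 0 1)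
      = fderiv ℝ (cgrad v 0) x (EuclideanSpace.single 1 1) := fun x => by
    have hd : DifferentiableAt ℝ (fderiv ℝ v) x :=
      (hvs.fderiv_right (m := ∞) (by simp)).differentiable (by simp) x
    have e : ∀ (j : Fin 2) (y : Plane), fderiv ℝ (cgrad v j) x y
        = fderiv ℝ (fderiv ℝ v) x y (EuclideanSpace.single j 1) := fun j y => by
      have := (hd.hasFDerivAt.clm_apply
        (hasFDerivAt_const (EuclideanSpace.single j (1 : ℝ)) x)).fderiv
      have h' : fderiv ℝ (cgrad v j) x = _ := this
      simp [h']
    rw [e, e]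
    have hv2 : ContDiff ℝ 2 v := mod_cast contDiff_infty.1 hvs 2
    exact (hv2.contDiffAt.isSymmSndFDerivAt (by simp)) _ _
  have h := parts 0 1
  simp only [symm] at h
  rw [parts 1 0, neg_inj] at h
  have hI : Integrable (fun x => cgrad w 0 x * conj (cgrad w 1 x)) :=
    ((hcc 0).mul (Complex.continuous_conj.comp (hcc 1))).integrable_of_hasCompactSupport
      (hsc 0).mul_right
  have him : ∫ x, (cgrad w 0 x * conj (cgrad w 1 x)).im
      = (∫ x, cgrad w 0 x * conj (cgrad w 1 x)).im := integral_im hI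
  have e1 : ∫ x, cgrad w 1 x * cgrad v 0 x
      = conj (∫ x, cgrad w 0 x * conj (cgrad w 1 x)) := by
    rw [← integral_conj]
    simp only [hvd, map_mul, Complex.conj_conj, mul_comm]
  rw [e1] at h
  simp only [hvd] at h
  rw [him]
  have := congrArg Complex.im h
  rw [Complex.conj_im] at this
  linarith

section Energy
variable {B : Plane → ℝ} {A : Plane → Plane} {u : Plane → ℂ} {Du : Fin 2 → Plane → ℂ}

theorem L2Tendsto.kin (hA : IsBoundedPotential B A) {w : ℕ → Plane → ℂ}
    {Dw : ℕ → Fin 2 → Plane → ℂ} (h : L2Tendsto w u)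
    (hD : ∀ j, L2Tendsto (fun n => Dw n j) (Du j)) (j : Fin 2) :
    L2Tendsto (fun n => kin A (w n) (Dw n) j) (kin A u Du j) := by
  obtain ⟨C, hC⟩ := hA.exists_bound
  refine ((hD j).bdd_mul (m := fun _ => Complex.I) aestronglyMeasurable_const (C := 1)
    (Eventually.of_forall fun x => by simp)).add (h.bdd_mul
    (Complex.continuous_ofReal.comp_aestronglyMeasurable (hA.aestronglyMeasurable j)) (C := C) ?_)
  filter_upwards [hC j] with x hx
  simpa using hx

theorem L2Tendsto.pauliOp (hA : IsBoundedPotential B A) {w : ℕ → Plane → ℂ}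
    {Dw : ℕ → Fin 2 → Plane → ℂ} (h : L2Tendsto w u)
    (hD : ∀ j, L2Tendsto (fun n => Dw n j) (Du j)) :
    L2Tendsto (fun n => pauliOp (fun j x => A x j) (w n) (Dw n))
      (pauliOp (fun j x => A x j) u Du) := by
  have := (h.kin hA hD 0).add ((h.kin hA hD 1).bdd_mul (m := fun _ => -Complex.I)
    aestronglyMeasurable_const (C := 1) (Eventually.of_forall fun x => by simp))
  simp only [neg_mul, ← sub_eq_add_neg] at this
  exact this

theorem L2Tendsto.const {f : Plane → ℂ} (hf : MemLp f 2 volume) : L2Tendsto (fun _ => f) f :=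
  ⟨fun _ => hf, hf, by simp⟩

/-- The linear part of the cross term is the curl equation tested with |w|² and yields ∫ B|w|²; the
Jacobian integrates to zero. -/
theorem integral_norm_pauliOp_sq_smooth (hA : IsBoundedPotential B A)
    {w : Plane → ℂ} (hw : ContDiff ℝ ∞ w) (hc : HasCompactSupport w) :
    ∫ x, ‖pauliOp (fun j x => A x j) w (cgrad w) x‖ ^ 2
      = (∫ x, ‖kin A w (cgrad w) 0 x‖ ^ 2) + (∫ x, ‖kin A w (cgrad w) 1 x‖ ^ 2)
        + ∫ x, B x * ‖w x‖ ^ 2 := by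
  have hw2 : ContDiff ℝ 2 w := mod_cast contDiff_infty.1 hw 2
  have m0 : MemLp w 2 volume := hw.continuous.memLp_of_hasCompactSupport hc
  have m1 := fun j => (continuous_cgrad hw2 j).memLp_of_hasCompactSupport (p := 2)
      (μ := volume) (hasCompactSupport_cgrad hc j)
  have iK : ∀ j, Integrable (fun x => ‖kin A w (cgrad w) j x‖ ^ 2) := fun j =>
    ((L2Tendsto.const m0).kin hA (Dw := fun _ => cgrad w)
      (fun i => L2Tendsto.const (m1 i)) j).memLp_lim.integrable_norm_pow two_ne_zero
  have ht := isTest_norm_sq hw hc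
  have iA : Integrable (fun x => A x 0 * partialDeriv 1 (fun x => ‖w x‖ ^ 2) x
      - A x 1 * partialDeriv 0 (fun x => ‖w x‖ ^ 2) x) :=
    (hA.integrable_mul 0 (ht.integrable_partialDeriv 1)).sub
      (hA.integrable_mul 1 (ht.integrable_partialDeriv 0))
  have iM : Integrable (fun x => (cgrad w 0 x * conj (cgrad w 1 x)).im) :=
    (((continuous_cgrad hw2 0).mul (Complex.continuous_conj.comp
      (continuous_cgrad hw2 1))).integrable_of_hasCompactSupport
        (hasCompactSupport_cgrad hc 0).mul_right).im
  have e : ∀ x, ‖pauliOp (fun j x => A x j) w (cgrad w) x‖ ^ 2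
      = ‖kin A w (cgrad w) 0 x‖ ^ 2 + ‖kin A w (cgrad w) 1 x‖ ^ 2
        + (A x 0 * partialDeriv 1 (fun x => ‖w x‖ ^ 2) x
          - A x 1 * partialDeriv 0 (fun x => ‖w x‖ ^ 2) x)
        - 2 * (cgrad w 0 x * conj (cgrad w 1 x)).im := fun x => by
    have hd : DifferentiableAt ℝ w x := hw.differentiable (by simp) x
    rw [norm_pauliOp_sq, partialDeriv_norm_sq hd, partialDeriv_norm_sq hd]
  simp only [e]
  have iKK : Integrable (fun x => ‖kin A w (cgrad w) 0 x‖ ^ 2 + ‖kin A w (cgrad w) 1 x‖ ^ 2) :=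
    (iK 0).add (iK 1)
  have iKA : Integrable (fun x => ‖kin A w (cgrad w) 0 x‖ ^ 2 + ‖kin A w (cgrad w) 1 x‖ ^ 2
      + (A x 0 * partialDeriv 1 (fun x => ‖w x‖ ^ 2) x
        - A x 1 * partialDeriv 0 (fun x => ‖w x‖ ^ 2) x)) := iKK.add iA
  rw [integral_sub iKA (iM.const_mul 2), integral_const_mul,
    integral_im_cgrad_mul_conj hw hc, integral_add iKK iA, integral_add (iK 0) (iK 1),
    hA.curl_eq _ ht]
  simp

/-- The Pauli form of an `H¹` function is the square of the norm of its image under the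
first-order operator. -/
theorem integrable_pauliDensity_and_QPlus_eq (hB : AdmissibleField B)
    (hA : IsBoundedPotential B A) (hu : IsH1 u Du) :
    Integrable (pauliDensity B A u Du) ∧
      QPlus B A u Du = ∫ x, ‖pauliOp (fun j x => A x j) u Du x‖ ^ 2 := by
  obtain ⟨w, hs, hc, h, hD⟩ := hu.exists_smooth_approx
  have hBm := hB.aestronglyMeasurable
  -- The field has no sign, so its positive and negative parts are treated separately. Both are
  -- dominated by |B|, so ∫ B|w_n|² converges as a difference of squared L² norms.
  have hp := h.sqrt_mul hB (b := fun x => max (B x) 0) (hBm.sup aestronglyMeasurable_const)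
    (fun x => le_max_right _ _) (fun x => max_le (le_abs_self _) (abs_nonneg _)) hs hc hD
  have hm := h.sqrt_mul hB (b := fun x => max (-B x) 0) (hBm.neg.sup aestronglyMeasurable_const)
    (fun x => le_max_right _ _) (fun x => max_le (neg_le_abs _) (abs_nonneg _)) hs hc hD
  have e : ∀ (v : Plane → ℂ) x, B x * ‖v x‖ ^ 2 = ‖((√(max (B x) 0) : ℝ) : ℂ) * v x‖ ^ 2
      - ‖((√(max (-B x) 0) : ℝ) : ℂ) * v x‖ ^ 2 := fun v x => by
    simp only [norm_mul, mul_pow, Complex.norm_real, Real.norm_eq_abs, sq_abs]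
    rw [Real.sq_sqrt (le_max_right _ _), Real.sq_sqrt (le_max_right _ _), ← sub_mul]
    rcases le_total (B x) 0 with h0 | h0
    · rw [max_eq_right h0, max_eq_left (by linarith)]; ring
    · rw [max_eq_left h0, max_eq_right (by linarith)]; ring
  have eB : ∀ v : Plane → ℂ, MemLp (fun x => ((√(max (B x) 0) : ℝ) : ℂ) * v x) 2 volume →
      MemLp (fun x => ((√(max (-B x) 0) : ℝ) : ℂ) * v x) 2 volume →
      Integrable (fun x => B x * ‖v x‖ ^ 2) ∧ ∫ x, B x * ‖v x‖ ^ 2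
        = (∫ x, ‖((√(max (B x) 0) : ℝ) : ℂ) * v x‖ ^ 2)
          - ∫ x, ‖((√(max (-B x) 0) : ℝ) : ℂ) * v x‖ ^ 2 := fun v h1 h2 => by
    simp only [e v]
    exact ⟨(h1.integrable_norm_pow two_ne_zero).sub (h2.integrable_norm_pow two_ne_zero),
      integral_sub (h1.integrable_norm_pow two_ne_zero) (h2.integrable_norm_pow two_ne_zero)⟩
  have hBl : Tendsto (fun n => ∫ x, B x * ‖w n x‖ ^ 2) atTop (𝓝 (∫ x, B x * ‖u x‖ ^ 2)) := by
    rw [(eB u hp.memLp_lim hm.memLp_lim).2]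
    refine (hp.integral_norm_sq_tendsto.sub hm.integral_norm_sq_tendsto).congr fun n => ?_
    exact ((eB (w n) (hp.memLp n) (hm.memLp n)).2).symm
  have hK := h.kin hA hD
  have iK : ∀ j, Integrable (fun x => ‖kin A u Du j x‖ ^ 2) := fun j =>
    (hK j).memLp_lim.integrable_norm_pow two_ne_zero
  have iB := (eB u hp.memLp_lim hm.memLp_lim).1
  have hl := (((hK 0).integral_norm_sq_tendsto.add (hK 1).integral_norm_sq_tendsto).add
    hBl).congr fun n => (integral_norm_pauliOp_sq_smooth hA (hs n) (hc n)).symm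
  have heq := tendsto_nhds_unique (h.pauliOp hA hD).integral_norm_sq_tendsto hl
  have ed : pauliDensity B A u Du
      = fun x => ‖kin A u Du 0 x‖ ^ 2 + ‖kin A u Du 1 x‖ ^ 2 + B x * ‖u x‖ ^ 2 := by
    funext x
    simp only [pauliDensity, Fin.sum_univ_two, kin]
  have iKK : Integrable (fun x => ‖kin A u Du 0 x‖ ^ 2 + ‖kin A u Du 1 x‖ ^ 2) :=
    (iK 0).add (iK 1)
  refine ⟨by rw [ed]; exact iKK.add iB, ?_⟩
  rw [heq, QPlus, ed, integral_add iKK iB, integral_add (iK 0) (iK 1)]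

/-- Both sides are continuous along the smooth approximation: the Hardy weight is bounded by 1/ρ²,
and Q₊ is now the squared L² norm of a first-order operator with bounded coefficients. -/
theorem hardy_lower_bound (hB : AdmissibleField B) (hα : 1 ≤ flux B)
    (hA : IsBoundedPotential B A) {ρ k K : ℝ} (hρ : 0 < ρ) (hk : 0 < k) (hK : 0 < K)
    (hlo : ∀ x, k * gPlus (flux B) ρ ‖x‖ ≤ Real.exp (-scalarPotential B x))
    (hup : ∀ x, Real.exp (-scalarPotential B x) ≤ K * gPlus (flux B) ρ ‖x‖)
    (hu : IsH1 u Du) :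
    k ^ 2 * (flux B / (4 * flux B + Real.pi) * ∫ x, ‖u x‖ ^ 2 * hardyWeight ρ x)
      ≤ K ^ 2 * QPlus B A u Du := by
  obtain ⟨w, hs, hc, h, hD⟩ := hu.exists_smooth_approx
  rw [(integrable_pauliDensity_and_QPlus_eq hB hA hu).2]
  have hW := h.bdd_mul (m := fun x => ((√(hardyWeight ρ x) : ℝ) : ℂ)) (C := √(1 / ρ ^ 2))
    (Complex.continuous_ofReal.comp (Real.continuous_sqrt.comp
      (continuous_hardyWeight hρ))).aestronglyMeasurable
    (Eventually.of_forall fun x => by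
      rw [Complex.norm_real, Real.norm_of_nonneg (Real.sqrt_nonneg _)]
      exact Real.sqrt_le_sqrt (hardyWeight_le hρ x))
  have e : ∀ (v : Plane → ℂ) x, ‖((√(hardyWeight ρ x) : ℝ) : ℂ) * v x‖ ^ 2
      = ‖v x‖ ^ 2 * hardyWeight ρ x := fun v x => by
    rw [norm_mul, mul_pow, Complex.norm_real, Real.norm_eq_abs, sq_abs,
      Real.sq_sqrt (hardyWeight_nonneg hρ x), mul_comm]
  have h1 := hW.integral_norm_sq_tendsto
  simp only [e] at h1
  refine le_of_tendsto_of_tendsto' ((h1.const_mul _).const_mul _)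
    ((h.pauliOp hA hD).integral_norm_sq_tendsto.const_mul _) fun n => ?_
  exact hardy_lower_bound_smooth hB hα hA hρ hk hK hlo hup
    (mod_cast contDiff_infty.1 (hs n) 2) (hc n)

end Energy

end PauliHardy

/-! ### The constants k₊ and K₊, and conclusion -/

namespace PauliHardy
open Set Filter Topology ComplexConjugate

theorem bddBelow_range_exp_div_gPlus (B : Plane → ℝ) {ρ : ℝ} (hρ : 0 < ρ) :
    BddBelow (range fun x : Plane =>
      Real.exp (-scalarPotential B x) / gPlus (flux B) ρ ‖x‖) :=
  ⟨0, by rintro _ ⟨x, rfl⟩; exact div_nonneg (Real.exp_pos _).le (gPlus_pos hρ).le⟩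

theorem kPlus_nonneg (B : Plane → ℝ) {ρ : ℝ} (hρ : 0 < ρ) : 0 ≤ kPlus B ρ :=
  le_ciInf fun _ => div_nonneg (Real.exp_pos _).le (gPlus_pos hρ).le

theorem kPlus_mul_le (B : Plane → ℝ) {ρ : ℝ} (hρ : 0 < ρ) (x : Plane) :
    kPlus B ρ * gPlus (flux B) ρ ‖x‖ ≤ Real.exp (-scalarPotential B x) :=
  (le_div_iff₀ (gPlus_pos hρ)).1 (ciInf_le (bddBelow_range_exp_div_gPlus B hρ) x)

/-- Neither positivity of k₊ nor finiteness of K₊ has to be established: in either degenerate case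
β₊ = 0, and the claim reduces to Q₊ ≥ 0, which holds because Q₊ is the integral of a square. -/
theorem hardy_inequality {B : Plane → ℝ} {A : Plane → Plane} {u : Plane → ℂ}
    {Du : Fin 2 → Plane → ℂ} (hB : AdmissibleField B) (hα : 1 ≤ flux B)
    (hA : IsBoundedPotential B A) {ρ : ℝ} (hρ : 0 < ρ) (hu : IsH1 u Du) :
    betaPlus B ρ * (flux B / (4 * flux B + Real.pi)) * (∫ x, ‖u x‖ ^ 2 * hardyWeight ρ x)
      ≤ QPlus B A u Du := by
  have hQ : 0 ≤ QPlus B A u Du := by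
    rw [(integrable_pauliDensity_and_QPlus_eq hB hA hu).2]
    positivity
  rcases (kPlus_nonneg B hρ).eq_or_lt with hk | hk
  · simpa [betaPlus, ← hk] using hQ
  by_cases hbdd : BddAbove (range fun x : Plane =>
      Real.exp (-scalarPotential B x) / gPlus (flux B) ρ ‖x‖)
  · have hK0 : 0 < KPlus B ρ :=
      (div_pos (Real.exp_pos _) (gPlus_pos hρ)).trans_le (le_ciSup hbdd 0)
    have h := hardy_lower_bound hB hα hA hρ hk hK0 (kPlus_mul_le B hρ)
      (fun x => (div_le_iff₀ (gPlus_pos hρ)).1 (le_ciSup hbdd x)) hu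
    have e : betaPlus B ρ * (flux B / (4 * flux B + Real.pi))
        * (∫ x, ‖u x‖ ^ 2 * hardyWeight ρ x)
        = kPlus B ρ ^ 2 * (flux B / (4 * flux B + Real.pi)
          * ∫ x, ‖u x‖ ^ 2 * hardyWeight ρ x) / KPlus B ρ ^ 2 := by
      rw [betaPlus, div_pow]
      ring
    rw [e, div_le_iff₀ (by positivity), mul_comm (QPlus B A u Du)]
    exact h
  -- The real supremum of an unbounded set is 0 by convention, and division by zero gives 0, so β₊ =
  -- 0.
  · have : KPlus B ρ = 0 := Real.sSup_of_not_bddAbove hbdd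
    simpa [betaPlus, this] using hQ

end PauliHardy

theorem theorem2p4 (B : PauliHardy.Plane → ℝ) (hB : PauliHardy.AdmissibleField B)
    (hα_nonneg : 0 ≤ PauliHardy.flux B) (hα_int : ∃ n : ℤ, PauliHardy.flux B = n)
    (A : PauliHardy.Plane → PauliHardy.Plane)
    (hA : A = PauliHardy.vectorPotential B ∨ PauliHardy.IsBoundedPotential B A)
    (ρ : ℝ) (hρ : 0 < ρ)
    (u : PauliHardy.Plane → ℂ) (Du : Fin 2 → PauliHardy.Plane → ℂ)
    (hu : PauliHardy.IsH1 u Du) :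
    Integrable (PauliHardy.pauliDensity B A u Du) volume ∧
      PauliHardy.betaPlus B ρ *
          (PauliHardy.flux B / (4 * PauliHardy.flux B + Real.pi)) *
          (∫ x : PauliHardy.Plane,
            ‖u x‖ ^ 2 / (ρ ^ 2 + ‖x‖ ^ 2 * (1 + Real.log (‖x‖ / ρ) ^ 2))) ≤
        PauliHardy.QPlus B A u Du := by
  have hA' : PauliHardy.IsBoundedPotential B A := by
    rcases hA with rfl | hA
    · exact hB.isBoundedPotential
    · exact hA
  obtain ⟨hint, hQ⟩ := PauliHardy.integrable_pauliDensity_and_QPlus_eq hB hA' hu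
  refine ⟨hint, ?_⟩
  obtain ⟨n, hn⟩ := hα_int
  -- For α = 0 the lower bound is zero and Q₊ is the integral of a square; a positive integer α is
  -- at least 1.
  rcases hα_nonneg.eq_or_lt with h0 | h0
  · rw [← h0, hQ]
    simp only [zero_div, mul_zero, zero_mul]
    positivity
  · have hα : 1 ≤ PauliHardy.flux B := by
      rw [hn] at h0 ⊢
      exact_mod_cast h0
    simpa only [PauliHardy.hardyWeight, mul_one_div] using
      PauliHardy.hardy_inequality hB hα hA' hρ hu
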